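/- Let $\theta_1,\dots,\theta_4$ be independent random variables, each uniformly distributed on $[0,2\pi]$, and let $Q$ be the ideal quadrilateral in the hyperbolic plane (curvature $-1$, unit disk model) whose vertices are the four points $e^{i\theta_1},\dots,e^{i\theta_4}$ of the circle at infinity; almost surely these points are distinct. For each of the two pairs of opposite sides of $Q$ take the orientation preserving isometry that maps one side of the pair onto the other, sends the endpoints of the first side to the endpoints of the second so that no endpoint goes to the diagonally opposite vertex of $Q$, and identifies the closest points of the two sides. Let $\Gamma$ be the group generated by these two side pairings and let $T=\mathbb H^2/\Gamma$ be the resulting rectangular punctured torus. Then $\Gamma$ exists almost surely, almost surely $T$ has a shortest closed geodesic, and the length $\ell$ of that geodesic has the probability density $$X_\ell(\ell)=\frac{6}{\pi^2}\,\operatorname{csch}(\ell)\Big[4\log\cosh\frac{\ell}{2}+2(\cosh \ell-1)\log\coth\frac{\ell}{2}\Big],\qquad 0<\ell\le \log\frac{\sqrt2+1}{\sqrt2-1},$$ and density $0$ elsewhere. The expected value is $$E[\ell]=\int_0^{\log\frac{\sqrt2+1}{\sqrt2-1}} \ell\,X_\ell(\ell)\,d\ell=0.984154\ldots,$$ that is,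 $0.984154\le E[\ell]<0.984155$. The median of $\ell$ is unique and equals $0.99929\ldots$, that is, it lies in $[0.99929,\,0.99930)$. -/

import Mathlib

open MeasureTheory ProbabilityTheory UpperHalfPlane OnePoint
open scoped MatrixGroups

noncomputable section

namespace RandomTorus

open Classical in
/-- The boundary values of the Cayley isometry `w ↦ i (1 + w) / (1 - w)` from the unit disk (with
`0 ↦ i`) onto the upper half-plane: it identifies the circle at infinity of the disk with the ideal
boundary `ℝ ∪ {∞}` of the upper half-plane `ℍ` (metric of curvature `-1`). -/
def idealPoint (w : Circle) : OnePoint ℝ :=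
  if w = 1 then ∞ else ((Complex.I * (1 + (w : ℂ)) / (1 - (w : ℂ))).re : ℝ)

/-- The hyperbolic line with the two given (distinct) ideal endpoints: a half-circle orthogonal to
the real axis, or a vertical half-line if one of the endpoints is `∞`. -/
def hypLine : OnePoint ℝ → OnePoint ℝ → Set ℍ
  | OnePoint.some a, OnePoint.some b =>
      {z | ‖(z : ℂ) - (((a + b) / 2 : ℝ) : ℂ)‖ = |a - b| / 2}
  | OnePoint.some a, OnePoint.infty => {z | z.re = a}
  | OnePoint.infty, OnePoint.some b => {z | z.re = b}
  | OnePoint.infty, OnePoint.infty => ∅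

/-- Four points of the circle, listed in strict counterclockwise cyclic order. -/
def CounterClockwise (v : Fin 4 → Circle) : Prop :=
  ∃ t : Fin 4 → ℝ, t 0 < t 1 ∧ t 1 < t 2 ∧ t 2 < t 3 ∧ t 3 < t 0 + 2 * Real.pi ∧
    ∀ k, v k = Circle.exp (t k)

/-- The points `a` and `b` realise the hyperbolic distance between the sets `S` and `T`. -/
def IsClosestPair (S T : Set ℍ) (a b : ℍ) : Prop :=
  a ∈ S ∧ b ∈ T ∧ ∀ x ∈ S, ∀ y ∈ T, dist a b ≤ dist x y

/-- The orientation preserving isometry `f` of `ℍ` maps the side with ideal endpoints `p`, `q` onto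
the side with ideal endpoints `p'`, `q'` (sending `p` to `p'` and `q` to `q'`) in such a way that the
closest points of the two sides are identified. -/
def PairsSides (f : SL(2, ℝ)) (p q p' q' : OnePoint ℝ) : Prop :=
  (f : GL (Fin 2) ℝ) • p = p' ∧ (f : GL (Fin 2) ℝ) • q = q' ∧
    ∃ a b : ℍ, IsClosestPair (hypLine p q) (hypLine p' q') a b ∧ f • a = b

/-- `Γ` is generated by side pairings which identify the opposite sides of the ideal quadrilateral
whose vertices are the four points `z 0, …, z 3` of the circle (in any order), closest points of
opposite sides being identified. With the vertices `p 0, p 1, p 2, p 3` in counterclockwise order,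
the sides are `p 0 p 1`, `p 1 p 2`, `p 2 p 3`, `p 3 p 0`; the first is paired with the third and the
second with the fourth, compatibly with orientation. Isometries are represented by matrices, which
they determine up to sign. -/
def IsRectangularTorusGroup (z : Fin 4 → Circle) (Γ : Subgroup SL(2, ℝ)) : Prop :=
  ∃ σ : Equiv.Perm (Fin 4), CounterClockwise (fun k => z (σ k)) ∧
    ∃ f g : SL(2, ℝ),
      PairsSides f (idealPoint (z (σ 0))) (idealPoint (z (σ 1)))
        (idealPoint (z (σ 3))) (idealPoint (z (σ 2))) ∧
      PairsSides g (idealPoint (z (σ 1))) (idealPoint (z (σ 2)))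
        (idealPoint (z (σ 0))) (idealPoint (z (σ 3))) ∧
      Γ = Subgroup.closure {f, g}

/-- The quotient surface `ℍ / Γ`. -/
abbrev Surface (Γ : Subgroup SL(2, ℝ)) : Type := MulAction.orbitRel.Quotient Γ ℍ

/-- The canonical projection `ℍ → ℍ / Γ`. -/
def proj (Γ : Subgroup SL(2, ℝ)) (z : ℍ) : Surface Γ := Quotient.mk _ z

/-- The lengths of the closed geodesics of `ℍ / Γ`: a (complete, unit speed) geodesic of `ℍ / Γ` is
the projection of a unit speed geodesic line of `ℍ`, and it is a closed geodesic of length `L > 0`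
if it is periodic with period `L`. Multiply traversed closed geodesics are included. -/
def closedGeodesicLengths (Γ : Subgroup SL(2, ℝ)) : Set ℝ :=
  {L | 0 < L ∧ ∃ c : ℝ → ℍ, Isometry c ∧ Function.Periodic (fun t => proj Γ (c t)) L}

/-- The length of the shortest closed geodesic of `ℍ / Γ` (meaningful when the minimum exists). -/
def shortestLength (Γ : Subgroup SL(2, ℝ)) : ℝ := sInf (closedGeodesicLengths Γ)

/-- The upper end `log ((√2 + 1) / (√2 - 1))` of the range of lengths. -/
def maxLength : ℝ := Real.log ((√2 + 1) / (√2 - 1))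

/-- `(6/π²) csch x [4 log cosh (x/2) + 2 (cosh x - 1) log coth (x/2)]`. -/
def lengthFormula (x : ℝ) : ℝ :=
  6 / Real.pi ^ 2 * (1 / Real.sinh x) *
    (4 * Real.log (Real.cosh (x / 2)) +
      2 * (Real.cosh x - 1) * Real.log (Real.cosh (x / 2) / Real.sinh (x / 2)))

/-- The density: `lengthFormula` on `0 < x ≤ maxLength`, and zero elsewhere. -/
def lengthDensity : ℝ → ℝ := (Set.Ioc 0 maxLength).indicator lengthFormula

/-- `m` is a median of the real random variable `X`. -/
def IsMedian {Ω : Type*} [MeasurableSpace Ω] (P : Measure Ω) (X : Ω → ℝ) (m : ℝ) : Prop :=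
  1 / 2 ≤ P {ω | X ω ≤ m} ∧ 1 / 2 ≤ P {ω | m ≤ X ω}

end RandomTorus

end

/-! ### The modular action in real coordinates. -/

namespace RandomTorus

/-! Geometry. An isometry moves the vertices to `-k, -1/k, 1/k, k` with `k > 1`. Two opposite sides
are then concentric half-circles whose closest points lie on the imaginary axis, so their pairing is
the dilation by `k²`; a quarter turn about `i` puts the other two sides in the same position with
parameter `k' = (k + 1)/(k - 1)`. The generators therefore translate by `2 log k` and `2 log k'`,
and the claim is that the smaller of these is the length of a shortest closed geodesic.

For the lower bound, a cyclically reduced word in the generators is read as a path through copies of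
the quadrilateral. In frames adapted to the sides, every crossing (straight, or a turn to one side
or the other) has a matrix with nonnegative entries. A closed path turning always to the same side
encircles the puncture and is parabolic. Any other nontrivial one contains a straight crossing or
two successive opposite turns, and such a block alone forces the trace to be at least that of the
shorter generator (`trace_sq_prod_letter`). Since the group is countable, a periodic geodesic is
translated by one group element at three of its points; a parabolic cannot do this, because the
three points would lie on one horocycle. Otherwise the trace bounds the displacement
(`isLeast_closedGeodesicLengths`).

Cross ratio. If `u` is the smallest of the three products of opposite chords divided by the largest,
then Ptolemy's relation turns the length into `ℓ = 2 artanh √u`, that is `u = tanh² (ℓ/2)`, whatever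
the order of the vertices (`lengthOfModulus_eq`).

Law. Rotating one vertex to `∞` makes the other three independent Cauchy variables `x, x + v, x + l
v`. Integrating out `x` and then `v` by partial fractions gives the density of the cross ratio `l`,
which is invariant under the six anharmonic substitutions. Folding the line onto `(0, 1/2)`
multiplies it by six, and `u = tanh² (ℓ/2)` produces the stated formula (`map_angleLaw`).

Numbers. The density in `u`, and the mean integrand in `w = tanh (ℓ/2)`, are power series with
nonnegative coefficients, partly multiplied by `-log`. Truncating them bounds the integrals from
below, and explicit tails bound them from above. The distribution function is continuous and
strictly increasing on the support, which makes the median unique. -/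

theorem sl_smul_coe_eq_coe_iff (f : SL(2, ℝ)) (p q : ℝ) :
    (f : GL (Fin 2) ℝ) • (p : OnePoint ℝ) = (q : OnePoint ℝ) ↔
      f 0 0 * p + f 0 1 = q * (f 1 0 * p + f 1 1) := by
  have hdet := f.det_coe
  rw [Matrix.det_fin_two] at hdet
  have hsmul : (f : GL (Fin 2) ℝ) • (p : OnePoint ℝ) = if f 1 0 * p + f 1 1 = 0 then ∞ else
      (((f 0 0 * p + f 0 1) / (f 1 0 * p + f 1 1) : ℝ) : OnePoint ℝ) := OnePoint.smul_some_eq_ite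
  rw [hsmul]
  split_ifs with h
  · simp only [OnePoint.infty_ne_coe, false_iff]
    intro h'
    rw [h, mul_zero] at h'
    -- Numerator and denominator cannot vanish together, since this combination of them is the
    -- determinant; so the cross-multiplied equation already excludes the image `∞`.
    have h1 : f 0 0 * (f 1 0 * p + f 1 1) - f 1 0 * (f 0 0 * p + f 0 1) = 1 := by
      linear_combination hdet
    rw [h, h'] at h1
    norm_num at h1
  · rw [OnePoint.coe_eq_coe, div_eq_iff h]

theorem sl_denom_ne_zero (f : SL(2, ℝ)) {p q : ℝ}
    (h : f 0 0 * p + f 0 1 = q * (f 1 0 * p + f 1 1)) : f 1 0 * p + f 1 1 ≠ 0 := by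
  have hdet := f.det_coe
  rw [Matrix.det_fin_two] at hdet
  intro h'
  rw [h', mul_zero] at h
  have h1 : f 0 0 * (f 1 0 * p + f 1 1) - f 1 0 * (f 0 0 * p + f 0 1) = 1 := by
    linear_combination hdet
  rw [h, h'] at h1
  norm_num at h1

theorem sl_smul_denom_pos (f : SL(2, ℝ)) (z : ℍ) :
    0 < (f 1 0 * z.re + f 1 1) ^ 2 + (f 1 0 * z.im) ^ 2 := by
  have hdet := f.det_coe
  rw [Matrix.det_fin_two] at hdet
  have hz := z.im_pos
  rcases eq_or_ne (f 1 0) 0 with h | h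
  · rw [h] at hdet ⊢
    have : f 1 1 ≠ 0 := by rintro h'; rw [h'] at hdet; norm_num at hdet
    simp only [zero_mul, zero_add]
    positivity
  · have : f 1 0 * z.im ≠ 0 := mul_ne_zero h hz.ne'
    positivity

theorem sl_smul_re (f : SL(2, ℝ)) (z : ℍ) :
    (f • z).re = ((f 0 0 * z.re + f 0 1) * (f 1 0 * z.re + f 1 1) + f 0 0 * f 1 0 * z.im ^ 2) /
      ((f 1 0 * z.re + f 1 1) ^ 2 + (f 1 0 * z.im) ^ 2) := by
  have h := congrArg Complex.re (coe_specialLinearGroup_apply f z)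
  rw [UpperHalfPlane.coe_re] at h
  rw [h, Complex.div_re]
  have hp := sl_smul_denom_pos f z
  simp only [Algebra.algebraMap_self, RingHom.id_apply, Complex.add_re, Complex.mul_re,
    Complex.ofReal_re, Complex.ofReal_im, Complex.add_im, Complex.mul_im, Complex.normSq_apply,
    UpperHalfPlane.coe_re, UpperHalfPlane.coe_im, zero_mul, sub_zero, add_zero]
  rw [← add_div]
  congr 1 <;> ring

theorem sl_smul_im (f : SL(2, ℝ)) (z : ℍ) :
    (f • z).im = z.im / ((f 1 0 * z.re + f 1 1) ^ 2 + (f 1 0 * z.im) ^ 2) := by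
  have hdet := f.det_coe
  rw [Matrix.det_fin_two] at hdet
  have h := congrArg Complex.im (coe_specialLinearGroup_apply f z)
  rw [UpperHalfPlane.coe_im] at h
  rw [h, Complex.div_im]
  have hp := sl_smul_denom_pos f z
  simp only [Algebra.algebraMap_self, RingHom.id_apply, Complex.add_re, Complex.mul_re,
    Complex.ofReal_re, Complex.ofReal_im, Complex.add_im, Complex.mul_im, Complex.normSq_apply,
    UpperHalfPlane.coe_re, UpperHalfPlane.coe_im, zero_mul, sub_zero, add_zero]
  rw [← sub_div]
  congr 1
  · linear_combination z.im * hdet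
  · ring

theorem mem_hypLine_coe (a b : ℝ) (z : ℍ) :
    z ∈ hypLine (a : OnePoint ℝ) (b : OnePoint ℝ) ↔
      z.re ^ 2 + z.im ^ 2 - (a + b) * z.re + a * b = 0 := by
  change ‖(z : ℂ) - (((a + b) / 2 : ℝ) : ℂ)‖ = |a - b| / 2 ↔ _
  rw [← sq_eq_sq₀ (norm_nonneg _) (by positivity), ← Complex.normSq_eq_norm_sq,
    Complex.normSq_apply, div_pow, sq_abs]
  simp only [Complex.sub_re, Complex.sub_im, Complex.ofReal_re, Complex.ofReal_im,
    UpperHalfPlane.coe_re, UpperHalfPlane.coe_im]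
  constructor <;> intro h <;> linear_combination h

/-- The quadratic equation of the image line, evaluated at `h • z` and multiplied by `|cz + d|² (cp
+ d)(cq + d)`, is the equation of the original line at `z`, and this factor does not vanish. -/
theorem smul_mem_hypLine_iff (h : SL(2, ℝ)) {p q p' q' : ℝ}
    (hp : (h : GL (Fin 2) ℝ) • (p : OnePoint ℝ) = (p' : OnePoint ℝ))
    (hq : (h : GL (Fin 2) ℝ) • (q : OnePoint ℝ) = (q' : OnePoint ℝ)) (z : ℍ) :
    h • z ∈ hypLine (p' : OnePoint ℝ) (q' : OnePoint ℝ) ↔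
      z ∈ hypLine (p : OnePoint ℝ) (q : OnePoint ℝ) := by
  rw [sl_smul_coe_eq_coe_iff] at hp hq
  have hp0 := sl_denom_ne_zero h hp
  have hq0 := sl_denom_ne_zero h hq
  have hdet := h.det_coe
  rw [Matrix.det_fin_two] at hdet
  rw [mem_hypLine_coe, mem_hypLine_coe, sl_smul_re, sl_smul_im]
  have hD := sl_smul_denom_pos h z
  have hp1 := eq_div_of_mul_eq hp0 hp.symm
  have hq1 := eq_div_of_mul_eq hq0 hq.symm
  set a := h 0 0
  set b := h 0 1
  set c := h 1 0
  set d := h 1 1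
  set x := z.re
  set y := z.im
  have hD0 := hD.ne'
  have key : ((((a * x + b) * (c * x + d) + a * c * y ^ 2) / ((c * x + d) ^ 2 + (c * y) ^ 2)) ^ 2 +
      (y / ((c * x + d) ^ 2 + (c * y) ^ 2)) ^ 2 -
      (p' + q') * (((a * x + b) * (c * x + d) + a * c * y ^ 2) /
        ((c * x + d) ^ 2 + (c * y) ^ 2)) + p' * q') *
      (((c * x + d) ^ 2 + (c * y) ^ 2) * ((c * p + d) * (c * q + d))) =
      x ^ 2 + y ^ 2 - (p + q) * x + p * q := by
    have e1 : (((a * x + b) * (c * x + d) + a * c * y ^ 2) /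
        ((c * x + d) ^ 2 + (c * y) ^ 2)) ^ 2 + (y / ((c * x + d) ^ 2 + (c * y) ^ 2)) ^ 2 =
        ((a * x + b) ^ 2 + (a * y) ^ 2) / ((c * x + d) ^ 2 + (c * y) ^ 2) := by
      rw [div_pow, div_pow, ← add_div, div_eq_div_iff (by positivity) hD0]
      have : y ^ 2 = (a * d - b * c) ^ 2 * y ^ 2 := by rw [hdet]; ring
      linear_combination ((c * x + d) ^ 2 + (c * y) ^ 2) * this
    rw [e1, ← mul_div_assoc, div_sub_div _ _ hD0 hD0, ← sub_eq_zero]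
    have e2 : x ^ 2 + y ^ 2 - (p + q) * x + p * q =
        (a * d - b * c) ^ 2 * (x ^ 2 + y ^ 2 - (p + q) * x + p * q) := by rw [hdet]; ring
    rw [e2]
    have e3 : ∀ u v D w : ℝ, D ≠ 0 → ((u * D - D * v) / (D * D) + p' * q') * (D * w) =
        (u - v + p' * q' * D) * w := by
      intro u v D w hD; field_simp
    rw [e3 _ _ _ _ hD0]
    have e4 : ((a * x + b) ^ 2 + (a * y) ^ 2 -
        (p' + q') * ((a * x + b) * (c * x + d) + a * c * y ^ 2) +
        p' * q' * ((c * x + d) ^ 2 + (c * y) ^ 2)) * ((c * p + d) * (c * q + d)) =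
        ((a * x + b) ^ 2 + (a * y) ^ 2) * ((c * p + d) * (c * q + d)) -
        ((p' * (c * p + d)) * (c * q + d) + (q' * (c * q + d)) * (c * p + d)) *
          ((a * x + b) * (c * x + d) + a * c * y ^ 2) +
        (p' * (c * p + d)) * (q' * (c * q + d)) * ((c * x + d) ^ 2 + (c * y) ^ 2) := by ring
    rw [e4, ← hp, ← hq]
    ring
  have hw : ((c * x + d) ^ 2 + (c * y) ^ 2) * ((c * p + d) * (c * q + d)) ≠ 0 :=
    mul_ne_zero hD0 (mul_ne_zero hp0 hq0)
  rw [← key, mul_eq_zero, or_iff_left hw]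

theorem IsClosestPair.smul {S T S' T' : Set ℍ} (h : SL(2, ℝ))
    (hS : ∀ z, h • z ∈ S' ↔ z ∈ S) (hT : ∀ z, h • z ∈ T' ↔ z ∈ T) {a b : ℍ}
    (hab : IsClosestPair S T a b) : IsClosestPair S' T' (h • a) (h • b) := by
  refine ⟨(hS _).2 hab.1, (hT _).2 hab.2.1, fun x hx y hy => ?_⟩
  have := hab.2.2 (h⁻¹ • x) ((hS _).1 (by rwa [smul_inv_smul])) (h⁻¹ • y)
    ((hT _).1 (by rwa [smul_inv_smul]))
  rwa [dist_smul, ← dist_smul h a b] at this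

theorem PairsSides.conj {f h : SL(2, ℝ)} {p q p' q' P Q P' Q' : ℝ}
    (hp : (h : GL (Fin 2) ℝ) • (p : OnePoint ℝ) = (P : OnePoint ℝ))
    (hq : (h : GL (Fin 2) ℝ) • (q : OnePoint ℝ) = (Q : OnePoint ℝ))
    (hp' : (h : GL (Fin 2) ℝ) • (p' : OnePoint ℝ) = (P' : OnePoint ℝ))
    (hq' : (h : GL (Fin 2) ℝ) • (q' : OnePoint ℝ) = (Q' : OnePoint ℝ))
    (hf : PairsSides f p q p' q') : PairsSides (h * f * h⁻¹) P Q P' Q' := by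
  obtain ⟨h1, h2, a, b, hab, hfa⟩ := hf
  refine ⟨?_, ?_, h • a, h • b, hab.smul h (smul_mem_hypLine_iff h hp hq)
    (smul_mem_hypLine_iff h hp' hq'), ?_⟩
  · rw [← hp, map_mul, map_mul, map_inv, mul_smul, mul_smul, inv_smul_smul, h1, hp']
  · rw [← hq, map_mul, map_mul, map_inv, mul_smul, mul_smul, inv_smul_smul, h2, hq']
  · rw [mul_smul, mul_smul, inv_smul_smul, hfa]

theorem sl_neg_smul (f : SL(2, ℝ)) (z : ℍ) : -f • z = f • z := by
  apply UpperHalfPlane.ext_re_im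
  · rw [sl_smul_re, sl_smul_re]
    simp only [Matrix.SpecialLinearGroup.coe_neg, Matrix.neg_apply]
    congr 1 <;> ring
  · rw [sl_smul_im, sl_smul_im]
    simp only [Matrix.SpecialLinearGroup.coe_neg, Matrix.neg_apply]
    congr 1; ring

/-- The hyperbolic matrix `diag (k, k⁻¹)`. -/
noncomputable def diagSL (k : ℝ) (hk : k ≠ 0) : SL(2, ℝ) :=
  ⟨!![k, 0; 0, k⁻¹], by simp [Matrix.det_fin_two, hk]⟩

theorem diagSL_smul_re {k : ℝ} (hk : k ≠ 0) (z : ℍ) : (diagSL k hk • z).re = k ^ 2 * z.re := by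
  rw [sl_smul_re]
  simp [diagSL]
  field_simp

theorem diagSL_smul_im {k : ℝ} (hk : k ≠ 0) (z : ℍ) : (diagSL k hk • z).im = k ^ 2 * z.im := by
  rw [sl_smul_im]
  simp [diagSL]
  field_simp

/-! ### Closest points of concentric half-circles, and their side pairing. -/

theorem cosh_dist_eq (z w : ℍ) :
    Real.cosh (dist z w) = 1 + ((z.re - w.re) ^ 2 + (z.im - w.im) ^ 2) / (2 * z.im * w.im) := by
  rw [UpperHalfPlane.cosh_dist, Complex.dist_eq, ← Complex.normSq_eq_norm_sq, Complex.normSq_apply]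
  simp [sq]

theorem diagSL_smul_coe {k : ℝ} (hk : k ≠ 0) {p q : ℝ} (h : q = k ^ 2 * p) :
    (diagSL k hk : GL (Fin 2) ℝ) • (p : OnePoint ℝ) = (q : OnePoint ℝ) := by
  rw [sl_smul_coe_eq_coe_iff, h]
  simp [diagSL]
  field_simp

/-- The point `i y` of the upper half-plane. -/
def imPoint (y : ℝ) (hy : 0 < y) : ℍ := UpperHalfPlane.mk ⟨0, y⟩ hy

@[simp] theorem imPoint_re (y : ℝ) (hy : 0 < y) : (imPoint y hy).re = 0 := rfl

@[simp] theorem imPoint_im (y : ℝ) (hy : 0 < y) : (imPoint y hy).im = y := rfl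

theorem mem_hypLine_neg (r : ℝ) (z : ℍ) :
    z ∈ hypLine ((-r : ℝ) : OnePoint ℝ) (r : OnePoint ℝ) ↔ z.re ^ 2 + z.im ^ 2 = r ^ 2 := by
  rw [mem_hypLine_coe]
  constructor <;> intro h <;> linear_combination h

/-- On circles of radii `1/k` and `k` the squares in `cosh dist` sum to the constant `k² + k⁻²`, so
comparing distances becomes a relation between `a.re * b.re` and `a.im * b.im` alone. -/
theorem dist_le_dist_iff_of_concentric {k : ℝ} (hk : 1 < k) {a b : ℍ}
    (ha : a.re ^ 2 + a.im ^ 2 = k⁻¹ ^ 2) (hb : b.re ^ 2 + b.im ^ 2 = k ^ 2) :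
    dist a b ≤ dist (imPoint k⁻¹ (by positivity)) (imPoint k (by positivity)) ↔
      (k ^ 2 + k⁻¹ ^ 2) * (1 - a.im * b.im) ≤ 2 * a.re * b.re := by
  have hk0 : 0 < k := by linarith
  have h1 := a.im_pos
  have h2 := b.im_pos
  rw [← abs_of_nonneg (dist_nonneg (x := a) (y := b)),
    ← abs_of_nonneg (dist_nonneg (x := imPoint k⁻¹ _) (y := imPoint k _)), ← Real.cosh_le_cosh,
    cosh_dist_eq, cosh_dist_eq]
  simp only [imPoint_re, imPoint_im, mul_assoc, inv_mul_cancel₀ hk0.ne', add_le_add_iff_left]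
  rw [div_le_iff₀ (by positivity)]
  have hki : k * k⁻¹ = 1 := mul_inv_cancel₀ hk0.ne'
  generalize k⁻¹ = r at *
  have e : ((0 - 0) ^ 2 + (r - k) ^ 2) / (2 * 1) * (2 * (a.im * b.im)) =
    (r ^ 2 + k ^ 2 - 2) * (a.im * b.im) := by linear_combination -2 * (a.im * b.im) * hki
  rw [e]
  constructor <;> intro h <;> nlinarith

theorem mul_add_mul_le_one_of_concentric {k : ℝ} (hk : 1 < k) {a b : ℍ}
    (ha : a.re ^ 2 + a.im ^ 2 = k⁻¹ ^ 2) (hb : b.re ^ 2 + b.im ^ 2 = k ^ 2) :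
    a.re * b.re + a.im * b.im ≤ 1 := by
  have hk0 : 0 < k := by linarith
  have hki : k * k⁻¹ = 1 := mul_inv_cancel₀ hk0.ne'
  generalize k⁻¹ = r at *
  have h : (a.re * b.re + a.im * b.im) ^ 2 ≤ 1 ^ 2 := by
    have : (a.re ^ 2 + a.im ^ 2) * (b.re ^ 2 + b.im ^ 2) = 1 := by
      rw [ha, hb]; linear_combination (k * r + 1) * hki
    nlinarith [sq_nonneg (a.re * b.im - a.im * b.re)]
  exact (abs_le_of_sq_le_sq' h zero_le_one).2

theorem two_lt_sq_add_inv_sq {k : ℝ} (hk : 1 < k) : 2 < k ^ 2 + k⁻¹ ^ 2 := by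
  have hk0 : 0 < k := by linarith
  have hki : k * k⁻¹ = 1 := mul_inv_cancel₀ hk0.ne'
  have h1 : k⁻¹ < 1 := inv_lt_one_of_one_lt₀ hk
  nlinarith [mul_pos (sub_pos.2 (h1.trans hk)) (sub_pos.2 (h1.trans hk))]

/-- The closest points of two concentric half-circles lie on the imaginary axis. -/
theorem isClosestPair_concentric_iff {k : ℝ} (hk : 1 < k) {a b : ℍ} :
    IsClosestPair (hypLine ((-k⁻¹ : ℝ) : OnePoint ℝ) ((k⁻¹ : ℝ) : OnePoint ℝ))
      (hypLine ((-k : ℝ) : OnePoint ℝ) (k : OnePoint ℝ)) a b ↔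
    a = imPoint k⁻¹ (by positivity) ∧ b = imPoint k (by positivity) := by
  have hk0 : 0 < k := by linarith
  have hki0 : 0 < k⁻¹ := inv_pos.2 hk0
  have hki : k * k⁻¹ = 1 := mul_inv_cancel₀ hk0.ne'
  have h2 := two_lt_sq_add_inv_sq hk
  constructor
  · rintro ⟨ha, hb, hmin⟩
    have h1 := hmin (imPoint k⁻¹ hki0) (by rw [mem_hypLine_neg]; simp)
      (imPoint k hk0) (by rw [mem_hypLine_neg]; simp)
    rw [mem_hypLine_neg] at ha hb
    rw [dist_le_dist_iff_of_concentric hk ha hb] at h1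
    have h3 := mul_add_mul_le_one_of_concentric hk ha hb
    -- Cauchy–Schwarz gives `a.re * b.re ≤ 1 - a.im * b.im`; as `k² + k⁻² > 2`, minimality forces
    -- this difference to be nonpositive. But `a.im ≤ 1/k` and `b.im ≤ k`, so both are equalities.
    have h4 : 1 ≤ a.im * b.im := by nlinarith
    have ha1 : a.im ≤ k⁻¹ := by
      have := a.im_pos; nlinarith [sq_nonneg a.re]
    have hb1 : b.im ≤ k := by
      have := b.im_pos; nlinarith [sq_nonneg b.re]
    have ha2 : a.im = k⁻¹ := by
      refine le_antisymm ha1 ?_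
      have := a.im_pos
      have : k⁻¹ * k ≤ a.im * k := by nlinarith
      exact le_of_mul_le_mul_right this hk0
    have hb2 : b.im = k := by
      refine le_antisymm hb1 ?_
      rw [ha2] at h4
      nlinarith
    have ha3 : a.re = 0 := by
      rw [ha2] at ha; simpa using ha
    have hb3 : b.re = 0 := by
      rw [hb2] at hb; simpa using hb
    exact ⟨UpperHalfPlane.ext_re_im ha3 ha2, UpperHalfPlane.ext_re_im hb3 hb2⟩
  · rintro ⟨rfl, rfl⟩
    refine ⟨by rw [mem_hypLine_neg]; simp, by rw [mem_hypLine_neg]; simp, fun x hx y hy => ?_⟩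
    rw [mem_hypLine_neg] at hx hy
    by_contra! h
    have h1 := (dist_le_dist_iff_of_concentric hk hx hy).1 h.le
    have h3 := mul_add_mul_le_one_of_concentric hk hx hy
    have h4 : 1 ≤ x.im * y.im := by nlinarith
    have h5 := (not_iff_not.2 (dist_le_dist_iff_of_concentric hk
      (a := imPoint k⁻¹ hki0) (b := imPoint k hk0) (by simp) (by simp))).2
    have ha1 : x.im ≤ k⁻¹ := by
      have := x.im_pos; nlinarith [sq_nonneg x.re]
    have hb1 : y.im ≤ k := by
      have := y.im_pos; nlinarith [sq_nonneg y.re]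
    have ha2 : x.im = k⁻¹ := by
      refine le_antisymm ha1 ?_
      have := x.im_pos
      have : k⁻¹ * k ≤ x.im * k := by nlinarith
      exact le_of_mul_le_mul_right this hk0
    have hb2 : y.im = k := by
      refine le_antisymm hb1 ?_
      rw [ha2] at h4
      nlinarith
    have ha3 : x.re = 0 := by
      rw [ha2] at hx; simpa using hx
    have hb3 : y.re = 0 := by
      rw [hb2] at hy; simpa using hy
    rw [show x = imPoint k⁻¹ hki0 from UpperHalfPlane.ext_re_im ha3 ha2,
      show y = imPoint k hk0 from UpperHalfPlane.ext_re_im hb3 hb2] at h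
    exact lt_irrefl _ h

/-- In the symmetric position, the side pairing is the dilation by `k²`. -/
theorem pairsSides_concentric_iff {k : ℝ} (hk : 1 < k) (f : SL(2, ℝ)) :
    PairsSides f ((-k⁻¹ : ℝ) : OnePoint ℝ) ((k⁻¹ : ℝ) : OnePoint ℝ) ((-k : ℝ) : OnePoint ℝ)
      (k : OnePoint ℝ) ↔ f = diagSL k (by positivity) ∨ f = -diagSL k (by positivity) := by
  have hk0 : 0 < k := by linarith
  have hki0 : 0 < k⁻¹ := inv_pos.2 hk0
  have hki : k * k⁻¹ = 1 := mul_inv_cancel₀ hk0.ne'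
  have hpair : PairsSides (diagSL k hk0.ne') ((-k⁻¹ : ℝ) : OnePoint ℝ) ((k⁻¹ : ℝ) : OnePoint ℝ)
      ((-k : ℝ) : OnePoint ℝ) (k : OnePoint ℝ) := by
    refine ⟨diagSL_smul_coe _ (by field_simp), diagSL_smul_coe _ (by field_simp), _, _,
      (isClosestPair_concentric_iff hk).2 ⟨rfl, rfl⟩, ?_⟩
    apply UpperHalfPlane.ext_re_im
    · rw [diagSL_smul_re]; simp
    · rw [diagSL_smul_im]; simp; field_simp
  constructor
  · rintro ⟨h1, h2, a, b, hab, hfa⟩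
    obtain ⟨rfl, rfl⟩ := (isClosestPair_concentric_iff hk).1 hab
    rw [sl_smul_coe_eq_coe_iff] at h1 h2
    have hdet := f.det_coe
    rw [Matrix.det_fin_two] at hdet
    have h3 := congrArg UpperHalfPlane.re hfa
    have hD := sl_smul_denom_pos f (imPoint k⁻¹ hki0)
    rw [sl_smul_re, div_eq_iff hD.ne'] at h3
    simp only [imPoint_re, imPoint_im, mul_zero, zero_add, zero_mul] at h3
    -- The two endpoint equations say that the off-diagonal entries agree and that `f 0 0 = k² * f 1
    -- 1`. One parameter remains, and it is killed by sending `i/k` to the imaginary axis.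
    have hbc : f 0 1 = f 1 0 := by linear_combination h1 / 2 + h2 / 2 + f 1 0 * hki
    have had : f 0 0 = k ^ 2 * f 1 1 := by
      linear_combination k * (h2 - h1) / 2 + (k ^ 2 * f 1 1 * 0 - f 0 0) * hki
    have hb0 : f 1 0 = 0 := by
      have h4 : f 1 0 * (f 1 1 * 2) = 0 := by
        rw [hbc, had] at h3
        linear_combination h3 - f 1 1 * f 1 0 * (k * k⁻¹ + 1) * hki
      rcases mul_eq_zero.1 h4 with h | h
      · exact h
      · have h5 : f 1 1 = 0 := by linarith
        rw [had, hbc, h5] at hdet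
        nlinarith [sq_nonneg (f 1 0)]
    have hd : (f 1 1 - k⁻¹) * (f 1 1 + k⁻¹) = 0 := by
      rw [had, hbc, hb0] at hdet
      have h6 : k ^ 2 * ((f 1 1 - k⁻¹) * (f 1 1 + k⁻¹)) = 0 := by
        linear_combination hdet - (k * k⁻¹ + 1) * hki
      exact (mul_eq_zero.1 h6).resolve_left (by positivity)
    rcases mul_eq_zero.1 hd with h | h
    · left
      have h7 : f 1 1 = k⁻¹ := by linarith
      ext i j
      fin_cases i <;> fin_cases j <;> simp [diagSL, hbc, had, hb0, h7]
      field_simp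
    · right
      have h7 : f 1 1 = -k⁻¹ := by linarith
      ext i j
      rw [Matrix.SpecialLinearGroup.coe_neg, Matrix.neg_apply]
      fin_cases i <;> fin_cases j <;> simp [diagSL, hbc, had, hb0, h7]
      field_simp
  · rintro (rfl | rfl)
    · exact hpair
    · obtain ⟨h1, h2, a, b, hab, hfa⟩ := hpair
      refine ⟨?_, ?_, a, b, hab, ?_⟩
      · rw [sl_smul_coe_eq_coe_iff] at h1 ⊢
        simp only [Matrix.SpecialLinearGroup.coe_neg, Matrix.neg_apply]
        linear_combination -h1
      · rw [sl_smul_coe_eq_coe_iff] at h2 ⊢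
        simp only [Matrix.SpecialLinearGroup.coe_neg, Matrix.neg_apply]
        linear_combination -h2
      · rw [← hfa]
        exact sl_neg_smul _ _

/-- The rotation by a quarter turn about `i`. -/
noncomputable def quarterTurn : SL(2, ℝ) :=
  ⟨!![1 / √2, 1 / √2; -(1 / √2), 1 / √2], by
    rw [Matrix.det_fin_two_of]
    have : (1 / √2) * (1 / √2) = (1 / 2 : ℝ) := by rw [div_mul_div_comm]; norm_num
    linear_combination 2 * this⟩

theorem quarterTurn_smul_coe {p q : ℝ} (h : p + 1 = q * (1 - p)) :
    (quarterTurn : GL (Fin 2) ℝ) • (p : OnePoint ℝ) = (q : OnePoint ℝ) := by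
  rw [sl_smul_coe_eq_coe_iff]
  simp [quarterTurn]
  linear_combination (√2)⁻¹ * h

/-! ### Bringing a quadrilateral into symmetric position. -/

theorem exists_sl_of_det {a b c d : ℝ} (h : a * d - b * c = 1) :
    ∃ g : SL(2, ℝ), g 0 0 = a ∧ g 0 1 = b ∧ g 1 0 = c ∧ g 1 1 = d :=
  ⟨⟨!![a, b; c, d], by rw [Matrix.det_fin_two_of, h]⟩, rfl, rfl, rfl, rfl⟩

/-- Positively ordered ideal vertices. -/
def PosTriple (a b c : ℝ) : Prop := 0 < (b - a) * (c - b) * (c - a)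

/-- Four cyclically ordered real points can be moved by an isometry to the vertices of an ideal
rectangle that is symmetric with respect to the imaginary axis and the unit circle. -/
theorem exists_normalization {p₀ p₁ p₂ p₃ : ℝ} (h₀ : PosTriple p₀ p₁ p₂)
    (h₃ : PosTriple p₁ p₂ p₃) (hcr : 0 < (p₁ - p₀) * (p₂ - p₁) * (p₃ - p₂) * (p₃ - p₀)) :
    ∃ k : ℝ, 1 < k ∧ ∃ h : SL(2, ℝ),
      (h : GL (Fin 2) ℝ) • (p₀ : OnePoint ℝ) = ((-k : ℝ) : OnePoint ℝ) ∧
      (h : GL (Fin 2) ℝ) • (p₁ : OnePoint ℝ) = ((-k⁻¹ : ℝ) : OnePoint ℝ) ∧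
      (h : GL (Fin 2) ℝ) • (p₂ : OnePoint ℝ) = ((k⁻¹ : ℝ) : OnePoint ℝ) ∧
      (h : GL (Fin 2) ℝ) • (p₃ : OnePoint ℝ) = (k : OnePoint ℝ) ∧
      4 * ((p₂ - p₀) * (p₃ - p₁)) = (k + k⁻¹) ^ 2 * ((p₂ - p₁) * (p₃ - p₀)) := by
  have n10 : p₁ - p₀ ≠ 0 := by rintro h; simp [h] at hcr
  have n21 : p₂ - p₁ ≠ 0 := by rintro h; simp [h] at hcr
  have n32 : p₃ - p₂ ≠ 0 := by rintro h; simp [h] at hcr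
  have n30 : p₃ - p₀ ≠ 0 := by rintro h; simp [h] at hcr
  have n20 : p₂ - p₀ ≠ 0 := by rintro h; simp [PosTriple, h] at h₀
  have n31 : p₃ - p₁ ≠ 0 := by rintro h; simp [PosTriple, h] at h₃
  have hA : 0 < (p₁ - p₀) / (p₂ - p₀) * (p₂ - p₁) := by
    rw [div_mul_eq_mul_div, ← mul_div_mul_right _ _ n20]
    exact div_pos h₀ (mul_self_pos.2 n20)
  have hB : 0 < (p₃ - p₁) / (p₃ - p₂) * (p₂ - p₁) := by
    rw [div_mul_eq_mul_div, ← mul_div_mul_right _ _ n32]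
    refine div_pos (h₃.trans_eq ?_) (mul_self_pos.2 n32)
    ring
  -- The map sought is `x ↦ k⁻¹ (t + μ)/(t - μ)` with `t = (x - p₁)/(x - p₂)`, which sends `p₁, p₂`
  -- to `-1/k, 1/k`. At `p₀` and `p₃` the coordinate `t` equals `A` and `B`; placing them at `-k`
  -- and `k` forces `μ² = A B`, `β² = B/A` and `k² = (β + 1)/(β - 1)`.
  set A := (p₁ - p₀) / (p₂ - p₀) with hAdef
  set B := (p₃ - p₁) / (p₃ - p₂) with hBdef
  have hA0 : A ≠ 0 := by rintro h; simp [h] at hA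
  have hB0 : B ≠ 0 := by rintro h; simp [h] at hB
  have hA1 : A * (p₂ - p₀) = p₁ - p₀ := div_mul_cancel₀ _ n20
  have hB1 : B * (p₃ - p₂) = p₃ - p₁ := div_mul_cancel₀ _ n32
  have hBA : B / A - 1 = (p₂ - p₁) * (p₃ - p₀) / ((p₃ - p₂) * (p₁ - p₀)) := by
    rw [hAdef, hBdef]
    field_simp
    ring
  have hBA1 : 1 < B / A := by
    rw [← sub_pos, hBA, ← mul_div_mul_right _ _ (mul_ne_zero n32 n10)]
    refine div_pos (hcr.trans_eq ?_) (mul_self_pos.2 (mul_ne_zero n32 n10))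
    ring
  set β := √(B / A) with hβ
  have hβ2 : β ^ 2 = B / A := Real.sq_sqrt (by linarith)
  have hβ1 : 1 < β := by
    rw [hβ, Real.lt_sqrt zero_le_one]
    simpa using hBA1
  have hβ0 : 0 < β := by linarith
  have hβA : β ^ 2 * A = B := by rw [hβ2, div_mul_cancel₀ _ hA0]
  set μ := β * A with hμ
  have hμB : β * μ = B := by rw [← hβA]; ring
  have hμpos : 0 < μ * (p₂ - p₁) := by
    rw [hμ, mul_assoc]; positivity
  set k := √((β + 1) / (β - 1)) with hk
  have hβm : 0 < β - 1 := by linarith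
  have hk2 : k ^ 2 = (β + 1) / (β - 1) := Real.sq_sqrt (by positivity)
  have hk1 : 1 < k := by
    rw [hk, Real.lt_sqrt zero_le_one, one_pow, lt_div_iff₀ hβm]
    linarith
  have hk0 : 0 < k := by linarith
  have hkβ : k ^ 2 * (β - 1) = β + 1 := by rw [hk2, div_mul_cancel₀ _ hβm.ne']
  have hΔ : 0 < 2 * (μ * (p₂ - p₁)) / k := by positivity
  -- Before scaling, the matrix has determinant `2 μ (p₂ - p₁)/k`; its positivity is where the
  -- cyclic orientation enters.
  set r := (√(2 * (μ * (p₂ - p₁)) / k))⁻¹ with hr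
  have hr2 : r ^ 2 * (2 * (μ * (p₂ - p₁)) / k) = 1 := by
    rw [hr, inv_pow, Real.sq_sqrt hΔ.le, inv_mul_cancel₀ hΔ.ne']
  obtain ⟨h, h00, h01, h10, h11⟩ := exists_sl_of_det
    (a := r * ((1 + μ) / k)) (b := r * (-(p₁ + μ * p₂) / k)) (c := r * (1 - μ))
    (d := r * (-(p₁ - μ * p₂))) (by linear_combination hr2)
  refine ⟨k, hk1, h, ?_, ?_, ?_, ?_, ?_⟩
  · rw [sl_smul_coe_eq_coe_iff]
    rw [h00, h01, h10, h11]
    have : (1 + μ) * p₀ - (p₁ + μ * p₂) = -k ^ 2 * ((1 - μ) * p₀ - (p₁ - μ * p₂)) := by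
      have e : (1 + μ) * p₀ - (p₁ + μ * p₂) = -((β + 1) * A * (p₂ - p₀)) := by
        linear_combination hA1 + (p₀ - p₂) * hμ
      have e' : (1 - μ) * p₀ - (p₁ - μ * p₂) = (β - 1) * A * (p₂ - p₀) := by
        linear_combination hA1 - (p₀ - p₂) * hμ
      rw [e, e']
      linear_combination A * (p₂ - p₀) * hkβ
    field_simp
    linear_combination r * this
  · rw [sl_smul_coe_eq_coe_iff]
    rw [h00, h01, h10, h11]
    field_simp
    ring
  · rw [sl_smul_coe_eq_coe_iff]
    rw [h00, h01, h10, h11]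
    field_simp
    ring
  · rw [sl_smul_coe_eq_coe_iff]
    rw [h00, h01, h10, h11]
    have : (1 + μ) * p₃ - (p₁ + μ * p₂) = k ^ 2 * ((1 - μ) * p₃ - (p₁ - μ * p₂)) := by
      have e : (1 + μ) * p₃ - (p₁ + μ * p₂) = (β + 1) * μ * (p₃ - p₂) := by
        linear_combination -hB1 - (p₃ - p₂) * hμB
      have e' : (1 - μ) * p₃ - (p₁ - μ * p₂) = (β - 1) * μ * (p₃ - p₂) := by
        linear_combination -hB1 - (p₃ - p₂) * hμB
      rw [e, e']
      linear_combination -μ * (p₃ - p₂) * hkβ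
    field_simp
    linear_combination r * this
  · have e : (k + k⁻¹) ^ 2 * (β ^ 2 - 1) = 4 * β ^ 2 := by
      have e1 : (k + k⁻¹) ^ 2 * (k ^ 2) = (k ^ 2 + 1) ^ 2 := by field_simp
      have e2 : (k + k⁻¹) ^ 2 * (k ^ 2 * (β - 1)) * (β - 1) = (k ^ 2 * (β - 1) + (β - 1)) ^ 2 := by
        linear_combination (β - 1) ^ 2 * e1
      rw [hkβ] at e2
      linear_combination e2
    have e3 : (β ^ 2 - 1) * ((p₃ - p₂) * (p₁ - p₀)) = (p₂ - p₁) * (p₃ - p₀) := by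
      rw [hβ2, hBA, div_mul_cancel₀ _ (mul_ne_zero n32 n10)]
    have e4 : β ^ 2 * ((p₃ - p₂) * (p₁ - p₀)) = (p₂ - p₀) * (p₃ - p₁) := by
      rw [← hA1, ← hB1, ← hβA]; ring
    rw [← e3, ← e4]
    linear_combination -(p₃ - p₂) * (p₁ - p₀) * e

end RandomTorus

/-! ### Crossing the quadrilateral: letters, side frames and turns. -/

namespace RandomTorus

/-- The letters of the group of the rectangular torus in symmetric position: the translations along
the unit circle and along the imaginary axis, and their inverses. -/
noncomputable def letter (k : ℝ) : Fin 4 → Matrix (Fin 2) (Fin 2) ℝ :=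
  ![!![(k ^ 2 + 1) / (k ^ 2 - 1), 2 * k / (k ^ 2 - 1);
      2 * k / (k ^ 2 - 1), (k ^ 2 + 1) / (k ^ 2 - 1)],
    !![k, 0; 0, k⁻¹],
    !![(k ^ 2 + 1) / (k ^ 2 - 1), -(2 * k / (k ^ 2 - 1));
      -(2 * k / (k ^ 2 - 1)), (k ^ 2 + 1) / (k ^ 2 - 1)],
    !![k⁻¹, 0; 0, k]]

/-- Frames carrying the imaginary axis to the four sides. -/
def sideFrame (k : ℝ) : Fin 4 → Matrix (Fin 2) (Fin 2) ℝ :=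
  ![!![k, -1; -1, k], !![1, 1; -k, k], !![1, -k; k, -1], !![k, -k; 1, 1]]

/-- Is the side one of the second pair of opposite sides? -/
def sideParity : Fin 4 → Bool := ![false, true, false, true]

/-- Crossing the quadrilateral straight on. -/
noncomputable def straight (k : ℝ) : Bool → Matrix (Fin 2) (Fin 2) ℝ
  | false => !![(k ^ 2 + 1) / (k ^ 2 - 1), 2 * k / (k ^ 2 - 1);
      2 * k / (k ^ 2 - 1), (k ^ 2 + 1) / (k ^ 2 - 1)]
  | true => !![(k ^ 2 + 1) / (2 * k), (k ^ 2 - 1) / (2 * k);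
      (k ^ 2 - 1) / (2 * k), (k ^ 2 + 1) / (2 * k)]

/-- Crossing the quadrilateral while turning to one side. -/
noncomputable def upperTurn (k : ℝ) : Bool → Matrix (Fin 2) (Fin 2) ℝ
  | false => !![1, (k ^ 2 + 1) / (k ^ 2 - 1); 0, 2 * k / (k ^ 2 - 1)]
  | true => !![1, (k ^ 2 + 1) / (2 * k); 0, (k ^ 2 - 1) / (2 * k)]

/-- Crossing the quadrilateral while turning to the other side. -/
noncomputable def lowerTurn (k : ℝ) : Bool → Matrix (Fin 2) (Fin 2) ℝ
  | false => !![2 * k / (k ^ 2 - 1), 0; (k ^ 2 + 1) / (k ^ 2 - 1), 1]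
  | true => !![(k ^ 2 - 1) / (2 * k), 0; (k ^ 2 + 1) / (2 * k), 1]

/-- The letter `j` maps side `j` to the opposite side `j + 2`, so `T` is the change of frame across
the quadrilateral from side `i` to side `j + 2`. Excluding `j = i + 2` excludes backtracking, and
the other three sides give the straight crossing and the two turns. The sign is harmless since only
squared traces matter. The frames of the two pairs of sides have different determinants, so turns do
not have determinant one. -/
theorem letter_mul_sideFrame {k : ℝ} (hk : 1 < k) {i j : Fin 4} (hij : j ≠ i + 2) :
    ∃ T, (letter k j * sideFrame k j = sideFrame k i * T ∨
        letter k j * sideFrame k j = -(sideFrame k i * T)) ∧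
      ((T = straight k (sideParity i) ∧ sideParity j = sideParity i) ∨
        (T = upperTurn k (sideParity i) ∧ sideParity j = !sideParity i) ∨
        (T = lowerTurn k (sideParity i) ∧ sideParity j = !sideParity i)) := by
  have hk0 : k ≠ 0 := by positivity
  have hk1 : k ^ 2 - 1 ≠ 0 := by nlinarith
  have hm : ∀ {a b c d a' b' c' d' : ℝ}, a = a' → b = b' → c = c' → d = d' →
      !![a, b; c, d] = !![a', b'; c', d'] := by rintro _ _ _ _ _ _ _ _ rfl rfl rfl rfl; rfl
  have e00 : letter k 0 * sideFrame k 0 = sideFrame k 0 * straight k false := by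
    simp only [letter, sideFrame, straight, Matrix.cons_val, Matrix.mul_fin_two]
    apply hm <;> field_simp <;> ring
  have e11 : letter k 1 * sideFrame k 1 = sideFrame k 1 * straight k true := by
    simp only [letter, sideFrame, straight, Matrix.cons_val, Matrix.mul_fin_two]
    apply hm <;> field_simp <;> ring
  have e22 : letter k 2 * sideFrame k 2 = sideFrame k 2 * straight k false := by
    simp only [letter, sideFrame, straight, Matrix.cons_val, Matrix.mul_fin_two]
    apply hm <;> field_simp <;> ring
  have e33 : letter k 3 * sideFrame k 3 = sideFrame k 3 * straight k true := by
    simp only [letter, sideFrame, straight, Matrix.cons_val, Matrix.mul_fin_two]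
    apply hm <;> field_simp <;> ring
  have e01 : letter k 1 * sideFrame k 1 = sideFrame k 0 * upperTurn k false := by
    simp only [letter, sideFrame, upperTurn, Matrix.cons_val, Matrix.mul_fin_two]
    apply hm <;> field_simp <;> ring
  have e12 : letter k 2 * sideFrame k 2 = -(sideFrame k 1 * upperTurn k true) := by
    simp only [letter, sideFrame, upperTurn, Matrix.cons_val, Matrix.mul_fin_two]
    ext a b; fin_cases a <;> fin_cases b <;> simp <;> field_simp <;> ring
  have e23 : letter k 3 * sideFrame k 3 = sideFrame k 2 * upperTurn k false := by
    simp only [letter, sideFrame, upperTurn, Matrix.cons_val, Matrix.mul_fin_two]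
    apply hm <;> field_simp <;> ring
  have e30 : letter k 0 * sideFrame k 0 = sideFrame k 3 * upperTurn k true := by
    simp only [letter, sideFrame, upperTurn, Matrix.cons_val, Matrix.mul_fin_two]
    apply hm <;> field_simp <;> ring
  have e03 : letter k 3 * sideFrame k 3 = sideFrame k 0 * lowerTurn k false := by
    simp only [letter, sideFrame, lowerTurn, Matrix.cons_val, Matrix.mul_fin_two]
    apply hm <;> field_simp <;> ring
  have e10 : letter k 0 * sideFrame k 0 = sideFrame k 1 * lowerTurn k true := by
    simp only [letter, sideFrame, lowerTurn, Matrix.cons_val, Matrix.mul_fin_two]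
    apply hm <;> field_simp <;> ring
  have e21 : letter k 1 * sideFrame k 1 = -(sideFrame k 2 * lowerTurn k false) := by
    simp only [letter, sideFrame, lowerTurn, Matrix.cons_val, Matrix.mul_fin_two]
    ext a b; fin_cases a <;> fin_cases b <;> simp <;> field_simp <;> ring
  have e32 : letter k 2 * sideFrame k 2 = sideFrame k 3 * lowerTurn k true := by
    simp only [letter, sideFrame, lowerTurn, Matrix.cons_val, Matrix.mul_fin_two]
    apply hm <;> field_simp <;> ring
  fin_cases i <;> fin_cases j <;> first
    | exact absurd rfl hij
    | exact ⟨_, Or.inl e00, Or.inl ⟨rfl, rfl⟩⟩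
    | exact ⟨_, Or.inl e11, Or.inl ⟨rfl, rfl⟩⟩
    | exact ⟨_, Or.inl e22, Or.inl ⟨rfl, rfl⟩⟩
    | exact ⟨_, Or.inl e33, Or.inl ⟨rfl, rfl⟩⟩
    | exact ⟨_, Or.inl e01, Or.inr (Or.inl ⟨rfl, rfl⟩)⟩
    | exact ⟨_, Or.inr e12, Or.inr (Or.inl ⟨rfl, rfl⟩)⟩
    | exact ⟨_, Or.inl e23, Or.inr (Or.inl ⟨rfl, rfl⟩)⟩
    | exact ⟨_, Or.inl e30, Or.inr (Or.inl ⟨rfl, rfl⟩)⟩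
    | exact ⟨_, Or.inl e03, Or.inr (Or.inr ⟨rfl, rfl⟩)⟩
    | exact ⟨_, Or.inl e10, Or.inr (Or.inr ⟨rfl, rfl⟩)⟩
    | exact ⟨_, Or.inr e21, Or.inr (Or.inr ⟨rfl, rfl⟩)⟩
    | exact ⟨_, Or.inl e32, Or.inr (Or.inr ⟨rfl, rfl⟩)⟩

end RandomTorus

/-! ### Nonnegative matrices and the trace bound for words. -/

namespace RandomTorus

/-- A `2 × 2` matrix with nonnegative entries. -/
def NonnegEntries (M : Matrix (Fin 2) (Fin 2) ℝ) : Prop := ∀ i j, 0 ≤ M i j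

theorem NonnegEntries.mul {M N : Matrix (Fin 2) (Fin 2) ℝ} (hM : NonnegEntries M)
    (hN : NonnegEntries N) : NonnegEntries (M * N) := by
  intro i j
  rw [Matrix.mul_apply]
  exact Finset.sum_nonneg fun l _ => mul_nonneg (hM i l) (hN l j)

theorem NonnegEntries.one : NonnegEntries 1 := by
  intro i j; rw [Matrix.one_apply]; split_ifs <;> norm_num

theorem nonnegEntries_of {a b c d : ℝ} (ha : 0 ≤ a) (hb : 0 ≤ b) (hc : 0 ≤ c) (hd : 0 ≤ d) :
    NonnegEntries !![a, b; c, d] := by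
  intro i j; fin_cases i <;> fin_cases j <;> simpa

/-- A nonnegative matrix whose occurrence in a product forces a large trace. -/
structure IsLongBlock (m : ℝ) (A : Matrix (Fin 2) (Fin 2) ℝ) : Prop where
  nonneg : NonnegEntries A
  det_pos : 0 < A.det
  le_diag : m * A.det ≤ A 0 0 * A 1 1

/-- By cyclicity the trace is that of `A * Z` with `Z = Y * X` nonnegative and `det Z = 1 / det A`,
hence `Z 0 0 * Z 1 1 ≥ det Z`. The terms `A 0 0 * Z 0 0` and `A 1 1 * Z 1 1` then have product at
least `m`, and the arithmetic-geometric mean inequality bounds their sum. -/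
theorem IsLongBlock.four_mul_le_trace_sq {m : ℝ}
    {X A Y : Matrix (Fin 2) (Fin 2) ℝ} (hA : IsLongBlock m A) (hX : NonnegEntries X)
    (hY : NonnegEntries Y) (hdet : (X * A * Y).det = 1) : 4 * m ≤ (X * A * Y).trace ^ 2 := by
  have htr : (X * A * Y).trace = (A * (Y * X)).trace := by
    rw [Matrix.mul_assoc, Matrix.trace_mul_comm, Matrix.mul_assoc]
  have hZ := hY.mul hX
  have hZd : A.det * (Y * X).det = 1 := by
    rw [← hdet]; simp only [Matrix.det_mul]; ring
  rw [htr]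
  generalize Y * X = Z at hZ hZd
  rw [Matrix.trace_fin_two, Matrix.mul_apply, Matrix.mul_apply, Fin.sum_univ_two, Fin.sum_univ_two]
  have h1 : 0 ≤ A 0 0 * Z 0 0 := mul_nonneg (hA.nonneg _ _) (hZ _ _)
  have h2 : 0 ≤ A 0 1 * Z 1 0 := mul_nonneg (hA.nonneg _ _) (hZ _ _)
  have h3 : 0 ≤ A 1 0 * Z 0 1 := mul_nonneg (hA.nonneg _ _) (hZ _ _)
  have h4 : 0 ≤ A 1 1 * Z 1 1 := mul_nonneg (hA.nonneg _ _) (hZ _ _)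
  have hZ1 : Z.det ≤ Z 0 0 * Z 1 1 := by
    rw [Matrix.det_fin_two]; linarith [mul_nonneg (hZ 0 1) (hZ 1 0)]
  have hZ0 : 0 < Z.det := by
    by_contra! h
    have := mul_nonpos_of_nonneg_of_nonpos hA.det_pos.le h
    linarith
  have h5 : m ≤ (A 0 0 * Z 0 0) * (A 1 1 * Z 1 1) := calc
    m = (m * A.det) * Z.det := by rw [mul_assoc, hZd, mul_one]
    _ ≤ (A 0 0 * A 1 1) * (Z 0 0 * Z 1 1) :=
      mul_le_mul hA.le_diag hZ1 hZ0.le (mul_nonneg (hA.nonneg _ _) (hA.nonneg _ _))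
    _ = _ := by ring
  nlinarith [sq_nonneg (A 0 0 * Z 0 0 - A 1 1 * Z 1 1)]

/-- The ratio of the diagonal entries of the turns. -/
noncomputable def turnWeight (k : ℝ) : Bool → ℝ
  | false => 1
  | true => (k ^ 2 - 1) / (2 * k)

/-- The monodromy of a path that is trivial, or turns always to the same side, or contains a long
block. -/
inductive PathShape (k m : ℝ) (b b' : Bool) (P : Matrix (Fin 2) (Fin 2) ℝ) : Prop
  | nil (hb : b = b') (hP : P = 1)
  | upper (Y : Matrix (Fin 2) (Fin 2) ℝ) (hY : NonnegEntries Y) (hP : P = upperTurn k b * Y)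
      (h10 : P 1 0 = 0) (h00 : P 0 0 = 1) (h11 : P 1 1 = turnWeight k b / turnWeight k b')
  | lower (Y : Matrix (Fin 2) (Fin 2) ℝ) (hY : NonnegEntries Y) (hP : P = lowerTurn k b * Y)
      (h01 : P 0 1 = 0) (h11 : P 1 1 = 1) (h00 : P 0 0 = turnWeight k b / turnWeight k b')
  | long (X A Y : Matrix (Fin 2) (Fin 2) ℝ) (hX : NonnegEntries X) (hA : IsLongBlock m A)
      (hY : NonnegEntries Y) (hP : P = X * A * Y)

variable {k m : ℝ}

theorem straight_nonneg (hk : 1 < k) (b : Bool) : NonnegEntries (straight k b) := by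
  have h1 : 0 < k ^ 2 - 1 := by nlinarith
  have h0 : 0 < k := by linarith
  cases b <;> apply nonnegEntries_of <;> positivity

theorem upperTurn_nonneg (hk : 1 < k) (b : Bool) : NonnegEntries (upperTurn k b) := by
  have h1 : 0 < k ^ 2 - 1 := by nlinarith
  have h0 : 0 < k := by linarith
  cases b <;> apply nonnegEntries_of <;> positivity

theorem lowerTurn_nonneg (hk : 1 < k) (b : Bool) : NonnegEntries (lowerTurn k b) := by
  have h1 : 0 < k ^ 2 - 1 := by nlinarith
  have h0 : 0 < k := by linarith
  cases b <;> apply nonnegEntries_of <;> positivity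

theorem turnWeight_pos (hk : 1 < k) (b : Bool) : 0 < turnWeight k b := by
  have h1 : 0 < k ^ 2 - 1 := by nlinarith
  have h0 : 0 < k := by linarith
  cases b <;> simp only [turnWeight] <;> positivity

theorem PathShape.nonneg (hk : 1 < k) {b b' : Bool} {P : Matrix (Fin 2) (Fin 2) ℝ}
    (h : PathShape k m b b' P) : NonnegEntries P := by
  rcases h with ⟨-, rfl⟩ | ⟨Y, hY, rfl, -⟩ | ⟨Y, hY, rfl, -⟩ | ⟨X, A, Y, hX, hA, hY, rfl⟩
  · exact NonnegEntries.one
  · exact (upperTurn_nonneg hk b).mul hY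
  · exact (lowerTurn_nonneg hk b).mul hY
  · exact (hX.mul hA.nonneg).mul hY

/-- The two bounds on `m` are the squared half traces of the generators, and these are also the
diagonal products of the two straight crossings. -/
theorem isLongBlock_straight (hk : 1 < k) (hm₁ : m ≤ ((k ^ 2 + 1) / (k ^ 2 - 1)) ^ 2)
    (hm₂ : m ≤ ((k ^ 2 + 1) / (2 * k)) ^ 2) (b : Bool) : IsLongBlock m (straight k b) := by
  have h1 : 0 < k ^ 2 - 1 := by nlinarith
  have h0 : 0 < k := by linarith
  have hdet : (straight k b).det = 1 := by
    cases b <;> simp only [straight, Matrix.det_fin_two_of] <;> field_simp <;> ring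
  refine ⟨straight_nonneg hk b, by rw [hdet]; norm_num, ?_⟩
  rw [hdet, mul_one]
  cases b
  · simpa [straight, sq] using hm₁
  · simpa [straight, sq] using hm₂

/-- A zigzag of opposite turns has determinant one, and its diagonal product exceeds the squared
half trace of the corresponding generator by exactly one. -/
theorem isLongBlock_upper_lower (hk : 1 < k) (hm₁ : m ≤ ((k ^ 2 + 1) / (k ^ 2 - 1)) ^ 2)
    (hm₂ : m ≤ ((k ^ 2 + 1) / (2 * k)) ^ 2) (b : Bool) :
    IsLongBlock m (upperTurn k b * lowerTurn k !b) := by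
  have h1 : 0 < k ^ 2 - 1 := by nlinarith
  have h0 : 0 < k := by linarith
  have hdet : (upperTurn k b * lowerTurn k !b).det = 1 := by
    rw [Matrix.det_mul]
    cases b <;> simp only [upperTurn, lowerTurn, Matrix.det_fin_two_of, Bool.not_false,
      Bool.not_true] <;> field_simp <;> ring
  refine ⟨(upperTurn_nonneg hk b).mul (lowerTurn_nonneg hk _), by rw [hdet]; norm_num, ?_⟩
  rw [hdet, mul_one]
  cases b
  · refine hm₁.trans ?_
    simp only [upperTurn, lowerTurn, Bool.not_false, Matrix.mul_fin_two, Matrix.of_apply,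
      Matrix.cons_val', Matrix.cons_val_zero, Matrix.cons_val_one]
    rw [← sub_nonneg]
    have : (1 * ((k ^ 2 - 1) / (2 * k)) + (k ^ 2 + 1) / (k ^ 2 - 1) * ((k ^ 2 + 1) / (2 * k))) *
        (0 * 0 + 2 * k / (k ^ 2 - 1) * 1) - ((k ^ 2 + 1) / (k ^ 2 - 1)) ^ 2 = 1 := by
      field_simp; ring
    simp at this ⊢
    linarith
  · refine hm₂.trans ?_
    simp only [upperTurn, lowerTurn, Bool.not_true, Matrix.mul_fin_two, Matrix.of_apply,
      Matrix.cons_val', Matrix.cons_val_zero, Matrix.cons_val_one]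
    have : (1 * (2 * k / (k ^ 2 - 1)) + (k ^ 2 + 1) / (2 * k) * ((k ^ 2 + 1) / (k ^ 2 - 1))) *
        (0 * 0 + (k ^ 2 - 1) / (2 * k) * 1) - ((k ^ 2 + 1) / (2 * k)) ^ 2 = 1 := by
      field_simp; ring
    simp at this ⊢
    linarith

theorem isLongBlock_lower_upper (hk : 1 < k) (hm₁ : m ≤ ((k ^ 2 + 1) / (k ^ 2 - 1)) ^ 2)
    (hm₂ : m ≤ ((k ^ 2 + 1) / (2 * k)) ^ 2) (b : Bool) :
    IsLongBlock m (lowerTurn k b * upperTurn k !b) := by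
  have h1 : 0 < k ^ 2 - 1 := by nlinarith
  have h0 : 0 < k := by linarith
  have hdet : (lowerTurn k b * upperTurn k !b).det = 1 := by
    rw [Matrix.det_mul]
    cases b <;> simp only [upperTurn, lowerTurn, Matrix.det_fin_two_of, Bool.not_false,
      Bool.not_true] <;> field_simp <;> ring
  refine ⟨(lowerTurn_nonneg hk b).mul (upperTurn_nonneg hk _), by rw [hdet]; norm_num, ?_⟩
  rw [hdet, mul_one]
  cases b
  · refine hm₁.trans ?_
    simp only [upperTurn, lowerTurn, Bool.not_false, Matrix.mul_fin_two, Matrix.of_apply,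
      Matrix.cons_val', Matrix.cons_val_zero, Matrix.cons_val_one]
    have : (2 * k / (k ^ 2 - 1) * 1 + 0 * 0) * ((k ^ 2 + 1) / (k ^ 2 - 1) * ((k ^ 2 + 1) / (2 * k)) +
        1 * ((k ^ 2 - 1) / (2 * k))) - ((k ^ 2 + 1) / (k ^ 2 - 1)) ^ 2 = 1 := by
      field_simp; ring
    simp at this ⊢
    linarith
  · refine hm₂.trans ?_
    simp only [upperTurn, lowerTurn, Bool.not_true, Matrix.mul_fin_two, Matrix.of_apply,
      Matrix.cons_val', Matrix.cons_val_zero, Matrix.cons_val_one]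
    have : ((k ^ 2 - 1) / (2 * k) * 1 + 0 * 0) * ((k ^ 2 + 1) / (2 * k) * ((k ^ 2 + 1) / (k ^ 2 - 1)) +
        1 * (2 * k / (k ^ 2 - 1))) - ((k ^ 2 + 1) / (2 * k)) ^ 2 = 1 := by
      field_simp; ring
    simp at this ⊢
    linarith

/-- Writing the diagonal entry as a quotient of weights makes it telescope along consecutive turns
to the same side. -/
theorem upperTurn_diag (hk : 1 < k) (b : Bool) : upperTurn k b 1 0 = 0 ∧ upperTurn k b 0 0 = 1 ∧
    upperTurn k b 1 1 = turnWeight k b / turnWeight k !b := by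
  have h1 : 0 < k ^ 2 - 1 := by nlinarith
  have h0 : 0 < k := by linarith
  cases b <;> simp [upperTurn, turnWeight]

theorem lowerTurn_diag (hk : 1 < k) (b : Bool) : lowerTurn k b 0 1 = 0 ∧ lowerTurn k b 1 1 = 1 ∧
    lowerTurn k b 0 0 = turnWeight k b / turnWeight k !b := by
  have h1 : 0 < k ^ 2 - 1 := by nlinarith
  have h0 : 0 < k := by linarith
  cases b <;> simp [lowerTurn, turnWeight]

theorem PathShape.straight_mul (hk : 1 < k) (hm₁ : m ≤ ((k ^ 2 + 1) / (k ^ 2 - 1)) ^ 2)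
    (hm₂ : m ≤ ((k ^ 2 + 1) / (2 * k)) ^ 2) {b b' : Bool} {P : Matrix (Fin 2) (Fin 2) ℝ}
    (h : PathShape k m b b' P) : PathShape k m b b' (straight k b * P) :=
  .long 1 _ P .one (isLongBlock_straight hk hm₁ hm₂ b) (h.nonneg hk) (by rw [one_mul])

theorem PathShape.upper_mul (hk : 1 < k) (hm₁ : m ≤ ((k ^ 2 + 1) / (k ^ 2 - 1)) ^ 2)
    (hm₂ : m ≤ ((k ^ 2 + 1) / (2 * k)) ^ 2) {b b' : Bool} {P : Matrix (Fin 2) (Fin 2) ℝ}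
    (h : PathShape k m (!b) b' P) : PathShape k m b b' (upperTurn k b * P) := by
  obtain ⟨d10, d00, d11⟩ := upperTurn_diag hk b
  have hw := (turnWeight_pos hk !b).ne'
  have hn := h.nonneg hk
  rcases h with ⟨rfl, rfl⟩ | ⟨Y, hY, hP, h10, h00, h11⟩ | ⟨Y, hY, hP, -⟩ |
    ⟨X, A, Y, hX, hA, hY, hP⟩
  · exact .upper 1 .one rfl (by rw [mul_one, d10]) (by rw [mul_one, d00]) (by rw [mul_one, d11])
  · refine .upper P hn rfl ?_ ?_ ?_ <;> rw [Matrix.mul_apply, Fin.sum_univ_two]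
    · rw [d10, h10]; ring
    · rw [d00, h00, h10]; ring
    · rw [d10, d11, h11]; field_simp; ring
  · refine .long 1 _ Y .one (isLongBlock_upper_lower hk hm₁ hm₂ b) hY ?_
    rw [one_mul, hP, Matrix.mul_assoc]
  · refine .long _ A Y ((upperTurn_nonneg hk b).mul hX) hA hY ?_
    rw [hP]; simp only [Matrix.mul_assoc]

theorem PathShape.lower_mul (hk : 1 < k) (hm₁ : m ≤ ((k ^ 2 + 1) / (k ^ 2 - 1)) ^ 2)
    (hm₂ : m ≤ ((k ^ 2 + 1) / (2 * k)) ^ 2) {b b' : Bool} {P : Matrix (Fin 2) (Fin 2) ℝ}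
    (h : PathShape k m (!b) b' P) : PathShape k m b b' (lowerTurn k b * P) := by
  obtain ⟨d01, d11, d00⟩ := lowerTurn_diag hk b
  have hw := (turnWeight_pos hk !b).ne'
  have hn := h.nonneg hk
  rcases h with ⟨rfl, rfl⟩ | ⟨Y, hY, hP, -⟩ | ⟨Y, hY, hP, h01, h11, h00⟩ |
    ⟨X, A, Y, hX, hA, hY, hP⟩
  · exact .lower 1 .one rfl (by rw [mul_one, d01]) (by rw [mul_one, d11]) (by rw [mul_one, d00])
  · refine .long 1 _ Y .one (isLongBlock_lower_upper hk hm₁ hm₂ b) hY ?_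
    rw [one_mul, hP, Matrix.mul_assoc]
  · refine .lower P hn rfl ?_ ?_ ?_ <;> rw [Matrix.mul_apply, Fin.sum_univ_two]
    · rw [d01, h01]; ring
    · rw [d11, h11, h01]; ring
    · rw [d01, d00, h00]; field_simp; ring
  · refine .long _ A Y ((lowerTurn_nonneg hk b).mul hX) hA hY ?_
    rw [hP]; simp only [Matrix.mul_assoc]

/-- On a closed path both ends have the same parity, so the telescoped weight is one: a path turning
always to the same side is unipotent, the loop around the puncture. -/
theorem PathShape.trace_sq (hk : 1 < k) {b : Bool} {P : Matrix (Fin 2) (Fin 2) ℝ}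
    (h : PathShape k m b b P) (hdet : P.det = 1) : P.trace ^ 2 = 4 ∨ 4 * m ≤ P.trace ^ 2 := by
  have hw := (turnWeight_pos hk b).ne'
  rcases h with ⟨-, rfl⟩ | ⟨Y, hY, hP, h10, h00, h11⟩ | ⟨Y, hY, hP, h01, h11, h00⟩ |
    ⟨X, A, Y, hX, hA, hY, rfl⟩
  · left; simp; norm_num
  · left; rw [Matrix.trace_fin_two, h00, h11, div_self hw]; norm_num
  · left; rw [Matrix.trace_fin_two, h00, h11, div_self hw]; norm_num
  · exact Or.inr (hA.four_mul_le_trace_sq hX hY hdet)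

/-- The monodromy along a reduced word. -/
theorem exists_pathShape (hk : 1 < k) (hm₁ : m ≤ ((k ^ 2 + 1) / (k ^ 2 - 1)) ^ 2)
    (hm₂ : m ≤ ((k ^ 2 + 1) / (2 * k)) ^ 2) (l : List (Fin 4)) (i : Fin 4)
    (hl : (i :: l).IsChain (fun a b => b ≠ a + 2)) :
    ∃ P, PathShape k m (sideParity i) (sideParity ((i :: l).getLast (by simp))) P ∧
      ((l.map (letter k)).prod * sideFrame k ((i :: l).getLast (by simp)) = sideFrame k i * P ∨
      (l.map (letter k)).prod * sideFrame k ((i :: l).getLast (by simp)) =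
        -(sideFrame k i * P)) := by
  induction l generalizing i with
  | nil => exact ⟨1, .nil rfl rfl, Or.inl (by simp)⟩
  | cons j l ih =>
    rw [List.isChain_cons_cons] at hl
    obtain ⟨P, hP, hprod⟩ := ih j hl.2
    obtain ⟨T, hT, hT'⟩ := letter_mul_sideFrame hk hl.1
    refine ⟨T * P, ?_, ?_⟩
    · rw [List.getLast_cons (by simp)]
      rcases hT' with ⟨rfl, h⟩ | ⟨rfl, h⟩ | ⟨rfl, h⟩ <;> rw [h] at hP
      · exact hP.straight_mul hk hm₁ hm₂
      · exact hP.upper_mul hk hm₁ hm₂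
      · exact hP.lower_mul hk hm₁ hm₂
    · rw [List.getLast_cons (by simp), List.map_cons, List.prod_cons, Matrix.mul_assoc,
        ← Matrix.mul_assoc (sideFrame k i)]
      rcases hprod with h | h <;> rcases hT with h' | h' <;> rw [h]
      · left; rw [← Matrix.mul_assoc, h']
      · right; rw [← Matrix.mul_assoc, h', Matrix.neg_mul]
      · right; rw [Matrix.mul_neg, ← Matrix.mul_assoc, h']
      · left; rw [Matrix.mul_neg, ← Matrix.mul_assoc, h', Matrix.neg_mul, neg_neg]

theorem exists_not_of_not_isChain {α : Type*} {R : α → α → Prop} {l : List α}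
    (h : ¬ l.IsChain R) : ∃ u a b v, l = u ++ a :: b :: v ∧ ¬ R a b := by
  induction l with
  | nil => simp at h
  | cons a l ih =>
    cases l with
    | nil => simp at h
    | cons b l =>
      rw [List.isChain_cons_cons, not_and_or] at h
      rcases h with h | h
      · exact ⟨[], a, b, l, rfl, h⟩
      · obtain ⟨u, c, d, v, hl, hcd⟩ := ih h
        exact ⟨a :: u, c, d, v, by rw [hl]; rfl, hcd⟩

theorem letter_mul_letter (hk : 1 < k) (i : Fin 4) : letter k i * letter k (i + 2) = 1 := by
  have h1 : k ^ 2 - 1 ≠ 0 := by nlinarith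
  have h0 : k ≠ 0 := by linarith
  have e : ((k ^ 2 + 1) / (k ^ 2 - 1)) * ((k ^ 2 + 1) / (k ^ 2 - 1)) -
      (2 * k / (k ^ 2 - 1)) * (2 * k / (k ^ 2 - 1)) = 1 := by field_simp; ring
  fin_cases i <;> simp [letter, Matrix.one_fin_two, h0] <;>
    refine ⟨⟨?_, ?_⟩, ?_, ?_⟩ <;> first | linear_combination e | ring

theorem det_letter (hk : 1 < k) (i : Fin 4) : (letter k i).det = 1 := by
  have h1 : k ^ 2 - 1 ≠ 0 := by nlinarith
  have h0 : k ≠ 0 := by linarith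
  have e : ((k ^ 2 + 1) / (k ^ 2 - 1)) * ((k ^ 2 + 1) / (k ^ 2 - 1)) -
      (2 * k / (k ^ 2 - 1)) * (2 * k / (k ^ 2 - 1)) = 1 := by field_simp; ring
  fin_cases i <;> simp [letter, Matrix.det_fin_two_of, h0] <;> linear_combination e

theorem det_prod_letter (hk : 1 < k) (l : List (Fin 4)) : (l.map (letter k)).prod.det = 1 := by
  induction l with
  | nil => simp
  | cons i l ih => rw [List.map_cons, List.prod_cons, Matrix.det_mul, ih, det_letter hk, one_mul]

theorem det_sideFrame_ne_zero (hk : 1 < k) (i : Fin 4) : (sideFrame k i).det ≠ 0 := by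
  have h1 : k ^ 2 - 1 ≠ 0 := by nlinarith
  have h0 : k ≠ 0 := by linarith
  fin_cases i <;> simp [sideFrame, Matrix.det_fin_two_of]
  · intro h; apply h1; linear_combination h
  · intro h; apply h0; linarith
  · intro h; apply h1; linear_combination h
  · intro h; apply h0; linarith

/-- Traces in the group of the rectangular torus are those of parabolic elements or at least those
of the generators. -/
theorem trace_sq_prod_letter (hk : 1 < k)
    (hm₁ : m ≤ ((k ^ 2 + 1) / (k ^ 2 - 1)) ^ 2) (hm₂ : m ≤ ((k ^ 2 + 1) / (2 * k)) ^ 2)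
    (l : List (Fin 4)) : (l.map (letter k)).prod.trace ^ 2 = 4 ∨
      4 * m ≤ (l.map (letter k)).prod.trace ^ 2 := by
  induction hn : l.length using Nat.strong_induction_on generalizing l with
  | _ n ih =>
  rcases eq_or_ne l [] with rfl | hl0
  · left; simp; norm_num
  -- Prefixing the last letter tests the junction between the end and the beginning too: the chain
  -- condition is cyclic reducedness, and the path starts and ends in the same frame.
  by_cases hch : (l.getLast hl0 :: l).IsChain (fun a b => b ≠ a + 2)
  · obtain ⟨P, hP, hprod⟩ := exists_pathShape hk hm₁ hm₂ l _ hch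
    have hlast : (l.getLast hl0 :: l).getLast (by simp) = l.getLast hl0 :=
      List.getLast_cons hl0
    rw [hlast] at hP hprod
    set E := sideFrame k (l.getLast hl0)
    set W := (l.map (letter k)).prod with hW
    have hE : IsUnit E.det := (det_sideFrame_ne_zero hk _).isUnit
    have key : W.trace ^ 2 = P.trace ^ 2 ∧ P.det = 1 := by
      have hWd : W.det = 1 := det_prod_letter hk l
      rcases hprod with h | h
      · have : W = E * P * E⁻¹ := by rw [← h, Matrix.mul_nonsing_inv_cancel_right _ _ hE]
        refine ⟨by rw [this, Matrix.trace_mul_comm, ← Matrix.mul_assoc,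
          Matrix.nonsing_inv_mul _ hE, Matrix.one_mul], ?_⟩
        have h2 := congrArg Matrix.det h
        rw [Matrix.det_mul, Matrix.det_mul, hWd, one_mul] at h2
        exact (mul_eq_left₀ hE.ne_zero).1 h2.symm
      · have : W = -(E * P * E⁻¹) := by
          rw [← Matrix.neg_mul, ← h, Matrix.mul_nonsing_inv_cancel_right _ _ hE]
        refine ⟨by rw [this, Matrix.trace_neg, neg_sq, Matrix.trace_mul_comm, ← Matrix.mul_assoc,
          Matrix.nonsing_inv_mul _ hE, Matrix.one_mul], ?_⟩
        have h2 := congrArg Matrix.det h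
        rw [Matrix.det_neg, Fintype.card_fin, neg_one_sq, one_mul, Matrix.det_mul, Matrix.det_mul,
          hWd, one_mul] at h2
        exact (mul_eq_left₀ hE.ne_zero).1 h2.symm
    rw [key.1]
    exact hP.trace_sq hk key.2
  · obtain ⟨u, a, b, v, huv, hab⟩ := exists_not_of_not_isChain hch
    rw [not_not] at hab
    subst hab
    -- A cancelling pair at the very front sits at the cyclic junction and is removed by
    -- conjugation; any other one lies inside the word. Either way the trace is unchanged and the
    -- word gets shorter.
    cases u with
    | nil =>
      rw [List.nil_append, List.cons.injEq] at huv
      obtain ⟨ha, hv⟩ := huv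
      -- A one-letter word cannot cancel with itself, as no letter is its own inverse.
      have hv0 : v ≠ [] := by
        rintro rfl
        have h1 : l.getLast hl0 = a + 2 := by simp [hv]
        rw [ha] at h1
        have h2 : ∀ a : Fin 4, a ≠ a + 2 := by decide
        exact h2 a h1
      have hlast : v.getLast hv0 = a := by
        rw [← ha]; simp [hv, List.getLast_cons hv0]
      have hsplit : v = v.dropLast ++ [a] := by
        rw [← hlast]; exact (List.dropLast_append_getLast hv0).symm
      obtain ⟨w, rfl⟩ : ∃ w, v = w ++ [a] := ⟨_, hsplit⟩
      have htr : (l.map (letter k)).prod.trace = (w.map (letter k)).prod.trace := by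
        rw [hv]
        simp only [List.map_cons, List.map_append, List.map_nil, List.prod_cons,
          List.prod_append, List.prod_nil, mul_one]
        rw [← Matrix.mul_assoc, Matrix.trace_mul_comm, ← Matrix.mul_assoc, letter_mul_letter hk,
          Matrix.one_mul]
      rw [htr]
      refine ih _ ?_ _ rfl
      rw [← hn, hv]
      simp
    | cons c u =>
      rw [List.cons_append, List.cons.injEq] at huv
      obtain ⟨-, hl⟩ := huv
      have hprod : (l.map (letter k)).prod = ((u ++ v).map (letter k)).prod := by
        rw [hl]
        simp only [List.map_cons, List.map_append, List.prod_cons, List.prod_append]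
        rw [← Matrix.mul_assoc (letter k a), letter_mul_letter hk, Matrix.one_mul]
      rw [hprod]
      refine ih _ ?_ _ rfl
      rw [← hn, hl]
      simp

end RandomTorus

/-! ### From a general quadrilateral to words in the letters. -/

namespace RandomTorus

variable {k m : ℝ}

theorem pairsSides_conj_iff {f h : SL(2, ℝ)} {p q p' q' P Q P' Q' : ℝ}
    (hp : (h : GL (Fin 2) ℝ) • (p : OnePoint ℝ) = (P : OnePoint ℝ))
    (hq : (h : GL (Fin 2) ℝ) • (q : OnePoint ℝ) = (Q : OnePoint ℝ))
    (hp' : (h : GL (Fin 2) ℝ) • (p' : OnePoint ℝ) = (P' : OnePoint ℝ))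
    (hq' : (h : GL (Fin 2) ℝ) • (q' : OnePoint ℝ) = (Q' : OnePoint ℝ)) :
    PairsSides f p q p' q' ↔ PairsSides (h * f * h⁻¹) P Q P' Q' := by
  refine ⟨PairsSides.conj hp hq hp' hq', fun H => ?_⟩
  have := PairsSides.conj (h := h⁻¹) (p := P) (q := Q) (p' := P') (q' := Q') (P := p) (Q := q)
    (P' := p') (Q' := q') (by rw [map_inv, ← hp, inv_smul_smul])
    (by rw [map_inv, ← hq, inv_smul_smul]) (by rw [map_inv, ← hp', inv_smul_smul])
    (by rw [map_inv, ← hq', inv_smul_smul]) H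
  rwa [show h⁻¹ * (h * f * h⁻¹) * h⁻¹⁻¹ = f by group] at this

/-- The dual parameter of a rectangle. -/
noncomputable def dualParam (k : ℝ) : ℝ := (k + 1) / (k - 1)

theorem one_lt_dualParam (hk : 1 < k) : 1 < dualParam k := by
  rw [dualParam, lt_div_iff₀ (by linarith)]; linarith

/-- The side pairings of an ideal quadrilateral, up to an isometry. -/
theorem exists_pairing_normalForm {p₀ p₁ p₂ p₃ : ℝ} (h₀ : PosTriple p₀ p₁ p₂)
    (h₃ : PosTriple p₁ p₂ p₃) (hcr : 0 < (p₁ - p₀) * (p₂ - p₁) * (p₃ - p₂) * (p₃ - p₀)) :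
    ∃ (k : ℝ) (hk : 1 < k) (h : SL(2, ℝ)),
      4 * ((p₂ - p₀) * (p₃ - p₁)) = (k + k⁻¹) ^ 2 * ((p₂ - p₁) * (p₃ - p₀)) ∧
      (∀ g, PairsSides g p₁ p₂ p₀ p₃ ↔ h * g * h⁻¹ = diagSL k (by positivity) ∨
        h * g * h⁻¹ = -diagSL k (by positivity)) ∧
      ∀ f, PairsSides f p₀ p₁ p₃ p₂ ↔
        (quarterTurn * h) * f * (quarterTurn * h)⁻¹ =
          diagSL (dualParam k) (zero_lt_one.trans (one_lt_dualParam hk)).ne' ∨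
        (quarterTurn * h) * f * (quarterTurn * h)⁻¹ =
          -diagSL (dualParam k) (zero_lt_one.trans (one_lt_dualParam hk)).ne' := by
  obtain ⟨k, hk, h, e0, e1, e2, e3, hX⟩ := exists_normalization h₀ h₃ hcr
  have hk0 : 0 < k := by linarith
  have hk1 : k - 1 ≠ 0 := by linarith
  have hk2 : k + 1 ≠ 0 := by linarith
  refine ⟨k, hk, h, hX, fun g => ?_, fun f => ?_⟩
  · rw [pairsSides_conj_iff e1 e2 e0 e3, pairsSides_concentric_iff hk]
  -- The quarter turn `x ↦ (1 + x)/(1 - x)` carries `-k, -1/k, 1/k, k` to `-1/k', 1/k', k', -k'`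
  -- with `k' = dualParam k`, so the other two sides become concentric.
  · have q0 : ((quarterTurn * h : SL(2, ℝ)) : GL (Fin 2) ℝ) • (p₀ : OnePoint ℝ) =
        ((-(dualParam k)⁻¹ : ℝ) : OnePoint ℝ) := by
      rw [map_mul, mul_smul, e0]
      apply quarterTurn_smul_coe
      rw [dualParam]; field_simp; ring
    have q1 : ((quarterTurn * h : SL(2, ℝ)) : GL (Fin 2) ℝ) • (p₁ : OnePoint ℝ) =
        (((dualParam k)⁻¹ : ℝ) : OnePoint ℝ) := by
      rw [map_mul, mul_smul, e1]
      apply quarterTurn_smul_coe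
      rw [dualParam]; field_simp; ring
    have q2 : ((quarterTurn * h : SL(2, ℝ)) : GL (Fin 2) ℝ) • (p₂ : OnePoint ℝ) =
        ((dualParam k : ℝ) : OnePoint ℝ) := by
      rw [map_mul, mul_smul, e2]
      apply quarterTurn_smul_coe
      rw [dualParam]; field_simp; ring
    have q3 : ((quarterTurn * h : SL(2, ℝ)) : GL (Fin 2) ℝ) • (p₃ : OnePoint ℝ) =
        ((-dualParam k : ℝ) : OnePoint ℝ) := by
      rw [map_mul, mul_smul, e3]
      apply quarterTurn_smul_coe
      rw [dualParam]; field_simp; ring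
    rw [pairsSides_conj_iff q0 q1 q3 q2, pairsSides_concentric_iff (one_lt_dualParam hk)]

theorem coe_conj_diagSL_eq_letter (hk : 1 < k) (hk' : dualParam k ≠ 0) :
    ((quarterTurn⁻¹ * diagSL (dualParam k) hk' * quarterTurn : SL(2, ℝ)) :
      Matrix (Fin 2) (Fin 2) ℝ) = letter k 0 := by
  have h1 : k - 1 ≠ 0 := by linarith
  have h2 : k + 1 ≠ 0 := by linarith
  have h3 : k ^ 2 - 1 ≠ 0 := by nlinarith
  have h4 : (√2)⁻¹ * (√2)⁻¹ = (1 / 2 : ℝ) := by rw [← mul_inv]; norm_num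
  have e1 : dualParam k + (dualParam k)⁻¹ = 2 * ((k ^ 2 + 1) / (k ^ 2 - 1)) := by
    rw [dualParam]; field_simp; ring
  have e2 : dualParam k - (dualParam k)⁻¹ = 2 * (2 * k / (k ^ 2 - 1)) := by
    rw [dualParam]; field_simp; ring
  rw [Matrix.SpecialLinearGroup.coe_mul, Matrix.SpecialLinearGroup.coe_mul,
    Matrix.SpecialLinearGroup.coe_inv]
  have hq : (quarterTurn : Matrix (Fin 2) (Fin 2) ℝ) =
    !![1 / √2, 1 / √2; -(1 / √2), 1 / √2] := rfl
  have hd : (diagSL (dualParam k) hk' : Matrix (Fin 2) (Fin 2) ℝ) =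
    !![dualParam k, 0; 0, (dualParam k)⁻¹] := rfl
  rw [hq, hd, Matrix.adjugate_fin_two_of, Matrix.mul_fin_two, Matrix.mul_fin_two]
  ext i j
  fin_cases i <;> fin_cases j <;> simp [letter]
  · linear_combination (dualParam k + (dualParam k)⁻¹) * h4 + e1 / 2
  · linear_combination (dualParam k - (dualParam k)⁻¹) * h4 + e2 / 2
  · linear_combination (dualParam k - (dualParam k)⁻¹) * h4 + e2 / 2
  · linear_combination (dualParam k + (dualParam k)⁻¹) * h4 + e1 / 2

/-- Side pairings determine their matrices only up to sign, so group elements are words only up to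
sign. Inversion is the shift of the letter index by two. -/
theorem exists_word_of_mem_closure (hk : 1 < k) {f g h : SL(2, ℝ)}
    (hf : ((h * f * h⁻¹ : SL(2, ℝ)) : Matrix (Fin 2) (Fin 2) ℝ) = letter k 0 ∨
      ((h * f * h⁻¹ : SL(2, ℝ)) : Matrix (Fin 2) (Fin 2) ℝ) = -letter k 0)
    (hg : ((h * g * h⁻¹ : SL(2, ℝ)) : Matrix (Fin 2) (Fin 2) ℝ) = letter k 1 ∨
      ((h * g * h⁻¹ : SL(2, ℝ)) : Matrix (Fin 2) (Fin 2) ℝ) = -letter k 1)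
    {γ : SL(2, ℝ)} (hγ : γ ∈ Subgroup.closure {f, g}) :
    ∃ l : List (Fin 4),
      ((h * γ * h⁻¹ : SL(2, ℝ)) : Matrix (Fin 2) (Fin 2) ℝ) = (l.map (letter k)).prod ∨
      ((h * γ * h⁻¹ : SL(2, ℝ)) : Matrix (Fin 2) (Fin 2) ℝ) = -(l.map (letter k)).prod := by
  have hinv : ∀ (x : SL(2, ℝ)) (i : Fin 4),
      ((h * x * h⁻¹ : SL(2, ℝ)) : Matrix (Fin 2) (Fin 2) ℝ) = letter k i ∨
        ((h * x * h⁻¹ : SL(2, ℝ)) : Matrix (Fin 2) (Fin 2) ℝ) = -letter k i →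
      ((h * x⁻¹ * h⁻¹ : SL(2, ℝ)) : Matrix (Fin 2) (Fin 2) ℝ) = letter k (i + 2) ∨
        ((h * x⁻¹ * h⁻¹ : SL(2, ℝ)) : Matrix (Fin 2) (Fin 2) ℝ) = -letter k (i + 2) := by
    intro x i hx
    have h1 : ((h * x⁻¹ * h⁻¹ : SL(2, ℝ)) : Matrix (Fin 2) (Fin 2) ℝ) *
        ((h * x * h⁻¹ : SL(2, ℝ)) : Matrix (Fin 2) (Fin 2) ℝ) = 1 := by
      rw [← Matrix.SpecialLinearGroup.coe_mul,
        show h * x⁻¹ * h⁻¹ * (h * x * h⁻¹) = 1 by group, Matrix.SpecialLinearGroup.coe_one]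
    have h2 := letter_mul_letter hk i
    rcases hx with hx | hx <;> rw [hx] at h1
    · left
      calc _ = ((h * x⁻¹ * h⁻¹ : SL(2, ℝ)) : Matrix (Fin 2) (Fin 2) ℝ) *
            (letter k i * letter k (i + 2)) := by rw [h2, Matrix.mul_one]
        _ = _ := by rw [← Matrix.mul_assoc, h1, Matrix.one_mul]
    · right
      rw [Matrix.mul_neg] at h1
      have h1' := neg_eq_iff_eq_neg.1 h1
      calc _ = ((h * x⁻¹ * h⁻¹ : SL(2, ℝ)) : Matrix (Fin 2) (Fin 2) ℝ) *
            (letter k i * letter k (i + 2)) := by rw [h2, Matrix.mul_one]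
        _ = _ := by rw [← Matrix.mul_assoc, h1', Matrix.neg_mul, Matrix.one_mul]
  have hmul : ∀ (x y : SL(2, ℝ)) (i : Fin 4),
      (((h * x * h⁻¹ : SL(2, ℝ)) : Matrix (Fin 2) (Fin 2) ℝ) = letter k i ∨
        ((h * x * h⁻¹ : SL(2, ℝ)) : Matrix (Fin 2) (Fin 2) ℝ) = -letter k i) →
      (∃ l : List (Fin 4),
        ((h * y * h⁻¹ : SL(2, ℝ)) : Matrix (Fin 2) (Fin 2) ℝ) = (l.map (letter k)).prod ∨
        ((h * y * h⁻¹ : SL(2, ℝ)) : Matrix (Fin 2) (Fin 2) ℝ) = -(l.map (letter k)).prod) →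
      ∃ l : List (Fin 4),
        ((h * (x * y) * h⁻¹ : SL(2, ℝ)) : Matrix (Fin 2) (Fin 2) ℝ) = (l.map (letter k)).prod ∨
        ((h * (x * y) * h⁻¹ : SL(2, ℝ)) : Matrix (Fin 2) (Fin 2) ℝ) =
          -(l.map (letter k)).prod := by
    rintro x y i hx ⟨l, hl⟩
    refine ⟨i :: l, ?_⟩
    rw [show h * (x * y) * h⁻¹ = (h * x * h⁻¹) * (h * y * h⁻¹) by group,
      Matrix.SpecialLinearGroup.coe_mul, List.map_cons, List.prod_cons]
    rcases hx with hx | hx <;> rcases hl with hl | hl <;> rw [hx, hl]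
    · exact Or.inl rfl
    · right; rw [Matrix.mul_neg]
    · right; rw [Matrix.neg_mul]
    · left; rw [Matrix.neg_mul, Matrix.mul_neg, neg_neg]
  induction hγ using Subgroup.closure_induction_left with
  | one => exact ⟨[], Or.inl (by simp)⟩
  | mul_left x hx y hy ih =>
    rcases hx with rfl | rfl
    · exact hmul _ _ _ hf ih
    · exact hmul _ _ _ hg ih
  | inv_mul_cancel x hx y hy ih =>
    rcases hx with rfl | rfl
    · exact hmul _ _ _ (hinv _ _ hf) ih
    · exact hmul _ _ _ (hinv _ _ hg) ih

theorem trace_sq_of_mem_closure (hk : 1 < k) {f g h : SL(2, ℝ)}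
    (hf : ((h * f * h⁻¹ : SL(2, ℝ)) : Matrix (Fin 2) (Fin 2) ℝ) = letter k 0 ∨
      ((h * f * h⁻¹ : SL(2, ℝ)) : Matrix (Fin 2) (Fin 2) ℝ) = -letter k 0)
    (hg : ((h * g * h⁻¹ : SL(2, ℝ)) : Matrix (Fin 2) (Fin 2) ℝ) = letter k 1 ∨
      ((h * g * h⁻¹ : SL(2, ℝ)) : Matrix (Fin 2) (Fin 2) ℝ) = -letter k 1)
    (hm₁ : m ≤ ((k ^ 2 + 1) / (k ^ 2 - 1)) ^ 2) (hm₂ : m ≤ ((k ^ 2 + 1) / (2 * k)) ^ 2)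
    {γ : SL(2, ℝ)} (hγ : γ ∈ Subgroup.closure {f, g}) :
    (γ : Matrix (Fin 2) (Fin 2) ℝ).trace ^ 2 = 4 ∨
      4 * m ≤ (γ : Matrix (Fin 2) (Fin 2) ℝ).trace ^ 2 := by
  obtain ⟨l, hl⟩ := exists_word_of_mem_closure hk hf hg hγ
  have htr : (γ : Matrix (Fin 2) (Fin 2) ℝ).trace =
      ((h * γ * h⁻¹ : SL(2, ℝ)) : Matrix (Fin 2) (Fin 2) ℝ).trace := by
    rw [Matrix.SpecialLinearGroup.coe_mul, Matrix.trace_mul_comm,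
      ← Matrix.SpecialLinearGroup.coe_mul, show h⁻¹ * (h * γ) = γ by group]
  have := trace_sq_prod_letter hk hm₁ hm₂ l
  rw [htr]
  rcases hl with hl | hl <;> rw [hl]
  · exact this
  · rwa [Matrix.trace_neg, neg_sq]

end RandomTorus

/-! ### Closed geodesics and translation lengths. -/

namespace RandomTorus

variable {k m : ℝ}

/-- The squared expression is the equation of the line through the fixed points of `g`. The
displacement thus splits into a part read off from the trace and a nonnegative part, which for a
hyperbolic element vanishes on its axis. -/
theorem cosh_dist_smul (g : SL(2, ℝ)) (z : ℍ) :
    Real.cosh (dist z (g • z)) = 1 + (((g : Matrix (Fin 2) (Fin 2) ℝ).trace ^ 2 - 4) * z.im ^ 2 +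
      (g 1 0 * (z.re ^ 2 + z.im ^ 2) + (g 1 1 - g 0 0) * z.re - g 0 1) ^ 2) /
        (2 * z.im ^ 2) := by
  have hdet := g.det_coe
  rw [Matrix.det_fin_two] at hdet
  have hD := sl_smul_denom_pos g z
  have hy := z.im_pos
  rw [cosh_dist_eq, sl_smul_re, sl_smul_im, Matrix.trace_fin_two]
  change _ = 1 + (((g 0 0 + g 1 1) ^ 2 - 4) * z.im ^ 2 + _) / _
  set a := g 0 0
  set b := g 0 1
  set c := g 1 0
  set d := g 1 1
  set x := z.re
  set y := z.im
  set D := (c * x + d) ^ 2 + (c * y) ^ 2 with hDdef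
  set X := (a * x + b) * (c * x + d) + a * c * y ^ 2 with hX
  have key : (x * D - X) ^ 2 + (y * D - y) ^ 2 =
      D * (((a + d) ^ 2 - 4) * y ^ 2 + (c * (x ^ 2 + y ^ 2) + (d - a) * x - b) ^ 2) := by
    have h1 : (y * D - y) ^ 2 = (y * D - y * (a * d - b * c)) ^ 2 := by rw [hdet]; ring
    have h2 : ((a + d) ^ 2 - 4) * y ^ 2 = ((a + d) ^ 2 - 4 * (a * d - b * c)) * y ^ 2 := by
      rw [hdet]; ring
    rw [h1, h2, hX, hDdef]
    ring
  congr 1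
  rw [div_eq_div_iff (by positivity) (by positivity)]
  have hD0 := hD.ne'
  field_simp
  linear_combination key

theorem trace_sq_le_cosh_dist_smul (g : SL(2, ℝ)) (z : ℍ) :
    (g : Matrix (Fin 2) (Fin 2) ℝ).trace ^ 2 / 2 - 1 ≤ Real.cosh (dist z (g • z)) := by
  have hy := z.im_pos
  rw [cosh_dist_smul, ← sub_nonneg]
  have : 1 + (((g : Matrix (Fin 2) (Fin 2) ℝ).trace ^ 2 - 4) * z.im ^ 2 +
      (g 1 0 * (z.re ^ 2 + z.im ^ 2) + (g 1 1 - g 0 0) * z.re - g 0 1) ^ 2) /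
        (2 * z.im ^ 2) - ((g : Matrix (Fin 2) (Fin 2) ℝ).trace ^ 2 / 2 - 1) =
      (g 1 0 * (z.re ^ 2 + z.im ^ 2) + (g 1 1 - g 0 0) * z.re - g 0 1) ^ 2 / (2 * z.im ^ 2) := by
    field_simp; ring
  rw [this]
  positivity

/-- A horocycle contains no three points of a geodesic. -/
theorem not_collinear_of_im_eq {z₁ z₂ z₃ : ℍ} (h₁₂ : z₁.im = z₂.im) (h₂₃ : z₂.im = z₃.im)
    (hd₁ : 0 < dist z₁ z₂) (hd₂ : 0 < dist z₂ z₃) : dist z₁ z₃ ≠ dist z₁ z₂ + dist z₂ z₃ := by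
  intro h
  have hy := z₃.im_pos
  -- At constant height `sinh (d/2)` is proportional to the horizontal distance, hence subadditive
  -- along the three points, whereas `sinh (α + β) > sinh α + sinh β` for positive `α, β`.
  have hs : ∀ z w : ℍ, z.im = z₃.im → w.im = z₃.im →
      Real.sinh (dist z w / 2) = |z.re - w.re| / (2 * z₃.im) := by
    intro z w hz hw
    rw [UpperHalfPlane.sinh_half_dist, hz, hw, Real.sqrt_mul_self hy.le, Complex.dist_eq]
    congr 1
    have : (z : ℂ) - w = ((z.re - w.re : ℝ) : ℂ) := by
      apply Complex.ext <;> simp [hz, hw]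
    rw [this, Complex.norm_real, Real.norm_eq_abs]
  have e1 := hs z₁ z₂ (h₁₂.trans h₂₃) h₂₃
  have e2 := hs z₂ z₃ h₂₃ rfl
  have e3 := hs z₁ z₃ (h₁₂.trans h₂₃) rfl
  rw [h, add_div, Real.sinh_add] at e3
  have habs : |z₁.re - z₃.re| / (2 * z₃.im) ≤
      |z₁.re - z₂.re| / (2 * z₃.im) + |z₂.re - z₃.re| / (2 * z₃.im) := by
    rw [← add_div]
    exact div_le_div_of_nonneg_right (abs_sub_le _ _ _) (by positivity)
  have c1 : 1 < Real.cosh (dist z₁ z₂ / 2) := Real.one_lt_cosh.2 (by positivity)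
  have c2 : 1 < Real.cosh (dist z₂ z₃ / 2) := Real.one_lt_cosh.2 (by positivity)
  have s1 : 0 < Real.sinh (dist z₁ z₂ / 2) := Real.sinh_pos_iff.2 (by positivity)
  have s2 : 0 < Real.sinh (dist z₂ z₃ / 2) := Real.sinh_pos_iff.2 (by positivity)
  nlinarith

/-- A parabolic isometry translates no geodesic. -/
theorem false_of_parabolic_translation {g : SL(2, ℝ)}
    (hg : (g : Matrix (Fin 2) (Fin 2) ℝ).trace ^ 2 = 4) {c : ℝ → ℍ} (hc : Isometry c) {L : ℝ}
    (hL : 0 < L) {t : Fin 3 → ℝ} (ht : StrictMono t) (hgt : ∀ i, g • c (t i) = c (t i + L)) :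
    False := by
  have hdet := g.det_coe
  rw [Matrix.det_fin_two] at hdet
  set κ := 2 * (Real.cosh L - 1) with hκ
  have hκ0 : 0 < κ := by
    have := Real.one_lt_cosh.2 hL.ne'
    rw [hκ]; linarith
  -- With squared trace 4 only the square survives in the displacement formula. Equal displacements
  -- at the three points then mean equal heights as seen from the fixed point.
  have hq : ∀ i, (g 1 0 * ((c (t i)).re ^ 2 + (c (t i)).im ^ 2) + (g 1 1 - g 0 0) * (c (t i)).re -
      g 0 1) ^ 2 = κ * (c (t i)).im ^ 2 := by
    intro i
    have h1 := cosh_dist_smul g (c (t i))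
    have hy := (c (t i)).im_pos
    rw [hgt, hc.dist_eq, Real.dist_eq, hg, show |t i - (t i + L)| = L by
      rw [sub_add_cancel_left, abs_neg, abs_of_pos hL]] at h1
    rw [hκ, h1]
    field_simp
    ring
  have h01 : t 0 < t 1 := ht (by decide)
  have h12 : t 1 < t 2 := ht (by decide)
  have hline : ∀ h : SL(2, ℝ), (∀ i j, (h • c (t i)).im = (h • c (t j)).im) → False := by
    intro h him
    refine not_collinear_of_im_eq (him 0 1) (him 1 2) ?_ ?_ ?_ <;>
      simp only [dist_smul, hc.dist_eq, Real.dist_eq]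
    · exact abs_pos.2 (by linarith)
    · exact abs_pos.2 (by linarith)
    · rw [abs_of_neg (by linarith), abs_of_neg (by linarith), abs_of_neg (by linarith)]
      ring
  have htr : (g 0 0 + g 1 1) ^ 2 = 4 := by rw [← hg, Matrix.trace_fin_two]
  have hconst : ∀ v : Fin 3 → ℝ, (∀ i, 0 < v i) → ∀ C : ℝ, (∀ i, C = κ * v i ^ 2) →
      ∀ i j, v i = v j := by
    intro v hv C hC i j
    have h1 : κ * v i ^ 2 = κ * v j ^ 2 := (hC i).symm.trans (hC j)
    have h2 := mul_left_cancel₀ hκ0.ne' h1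
    exact (pow_left_inj₀ (hv i).le (hv j).le two_ne_zero).1 h2
  rcases eq_or_ne (g 1 0) 0 with h0 | h0
  · refine hline 1 ?_
    simp only [one_smul]
    refine hconst (fun i => (c (t i)).im) (fun i => (c (t i)).im_pos) (g 0 1 ^ 2) fun i => ?_
    have had : g 1 1 = g 0 0 := by
      rw [h0] at hdet
      have : (g 0 0 - g 1 1) ^ 2 = 0 := by linear_combination htr - 4 * hdet
      have := pow_eq_zero_iff two_ne_zero |>.1 this
      linarith
    rw [← hq i, h0, had]
    ring
  -- The double fixed point; `h` below sends it to `∞`, turning its horocycles into horizontal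
  -- lines.
  · set p := (g 0 0 - g 1 1) / (2 * g 1 0) with hp
    have hp1 : g 1 1 - g 0 0 = -2 * g 1 0 * p := by rw [hp]; field_simp; ring
    have hp2 : -g 0 1 = g 1 0 * p ^ 2 := by
      have : 4 * g 1 0 * (-g 0 1) = 4 * g 1 0 * (g 1 0 * p ^ 2) := by
        have h2 : (g 1 1 - g 0 0) ^ 2 = (-2 * g 1 0 * p) ^ 2 := by rw [hp1]
        linear_combination h2 - htr + 4 * hdet
      exact mul_left_cancel₀ (by positivity) this
    obtain ⟨h, e00, e01, e10, e11⟩ := exists_sl_of_det (a := 0) (b := 1) (c := -1) (d := p)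
      (by ring)
    refine hline h (hconst _ (fun i => (h • c (t i)).im_pos) (g 1 0 ^ 2) fun i => ?_)
    have hy := (c (t i)).im_pos
    have hE : 0 < (-1 * (c (t i)).re + p) ^ 2 + (-1 * (c (t i)).im) ^ 2 := by
      have := sl_smul_denom_pos h (c (t i))
      rwa [e10, e11] at this
    rw [sl_smul_im, e10, e11, div_pow, mul_div_assoc', ← hq i, hp1, sub_eq_add_neg, hp2]
    field_simp
    ring

theorem countable_closure_pair (f g : SL(2, ℝ)) : Countable (Subgroup.closure {f, g}) := by
  refine Set.Countable.mono (s₂ := Set.range fun l : List (Fin 4) =>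
    (l.map ![f, g, f⁻¹, g⁻¹]).prod) ?_ (Set.countable_range _)
  intro x hx
  induction hx using Subgroup.closure_induction_left with
  | one => exact ⟨[], rfl⟩
  | mul_left x hx y hy ih =>
    obtain ⟨l, rfl⟩ := ih
    rcases hx with rfl | rfl
    · exact ⟨0 :: l, by simp⟩
    · exact ⟨1 :: l, by simp⟩
  | inv_mul_cancel x hx y hy ih =>
    obtain ⟨l, rfl⟩ := ih
    rcases hx with rfl | rfl
    · exact ⟨2 :: l, by simp⟩
    · exact ⟨3 :: l, by simp⟩

/-- Closed geodesics are at least as long as the trace bound predicts. -/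
theorem le_cosh_of_mem_closedGeodesicLengths {Γ : Subgroup SL(2, ℝ)} [Countable Γ]
    (hΓ : ∀ γ ∈ Γ, (γ : Matrix (Fin 2) (Fin 2) ℝ).trace ^ 2 = 4 ∨
      4 * m ≤ (γ : Matrix (Fin 2) (Fin 2) ℝ).trace ^ 2) {L : ℝ}
    (hL : L ∈ closedGeodesicLengths Γ) : 2 * m - 1 ≤ Real.cosh L := by
  obtain ⟨hL0, c, hc, hper⟩ := hL
  have hex : ∀ t, ∃ γ : Γ, γ • c t = c (t + L) := by
    intro t
    have : c (t + L) ∈ MulAction.orbit Γ (c t) := Quotient.exact (hper t)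
    exact this
  have hcov : (⋃ γ : Γ, {t | γ • c t = c (t + L)}) = Set.univ := by
    ext t; simpa using hex t
  -- The element realising the period may depend on the time, but countably many sets of times cover
  -- the line, so one of them is infinite. Three times are enough.
  obtain ⟨γ, hγ⟩ : ∃ γ : Γ, ({t | γ • c t = c (t + L)} : Set ℝ).Infinite := by
    by_contra! h
    have : (Set.univ : Set ℝ).Countable := by
      rw [← hcov]
      exact Set.countable_iUnion fun γ => (h γ).countable
    exact Cardinal.not_countable_real this
  obtain ⟨s, hs, hcard⟩ := hγ.exists_subset_card_eq 3
  have hst : ∀ i, (γ : SL(2, ℝ)) • c (s.orderEmbOfFin hcard i) =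
      c (s.orderEmbOfFin hcard i + L) := fun i => hs (s.orderEmbOfFin_mem hcard i)
  rcases hΓ γ γ.2 with h | h
  · exact (false_of_parabolic_translation h hc hL0 (s.orderEmbOfFin hcard).strictMono hst).elim
  · have h1 := trace_sq_le_cosh_dist_smul (γ : SL(2, ℝ)) (c (s.orderEmbOfFin hcard 0))
    rw [hst, hc.dist_eq, Real.dist_eq, sub_add_cancel_left, abs_neg, Real.cosh_abs] at h1
    linarith

/-- The axis of a hyperbolic element projects to a closed geodesic. -/
theorem mem_closedGeodesicLengths_of_conj_diagSL {Γ : Subgroup SL(2, ℝ)} (hk : 1 < k)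
    {g h : SL(2, ℝ)} (hg : g ∈ Γ) (hgk : h * g * h⁻¹ = diagSL k (by positivity) ∨
      h * g * h⁻¹ = -diagSL k (by positivity)) :
    2 * Real.log k ∈ closedGeodesicLengths Γ := by
  have hk0 : 0 < k := by linarith
  refine ⟨mul_pos two_pos (Real.log_pos hk), fun t => h⁻¹ • imPoint (Real.exp t) (Real.exp_pos t),
    ?_, fun t => ?_⟩
  · exact (isometry_smul ℍ h⁻¹).comp (UpperHalfPlane.isometry_vertical_line 0)
  · apply Quotient.sound
    refine ⟨⟨g, hg⟩, ?_⟩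
    change g • (h⁻¹ • imPoint (Real.exp t) (Real.exp_pos t)) =
      h⁻¹ • imPoint (Real.exp (t + 2 * Real.log k)) (Real.exp_pos _)
    have h1 : (h * g * h⁻¹) • imPoint (Real.exp t) (Real.exp_pos t) =
        imPoint (Real.exp (t + 2 * Real.log k)) (Real.exp_pos _) := by
      have h2 : diagSL k hk0.ne' • imPoint (Real.exp t) (Real.exp_pos t) =
          imPoint (Real.exp (t + 2 * Real.log k)) (Real.exp_pos _) := by
        apply UpperHalfPlane.ext_re_im
        · rw [diagSL_smul_re]; simp
        · rw [diagSL_smul_im, imPoint_im, imPoint_im, Real.exp_add, two_mul (Real.log k),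
            Real.exp_add, Real.exp_log hk0]
          ring
      rcases hgk with h | h <;> rw [h]
      · exact h2
      · rw [sl_neg_smul, h2]
    rw [← h1, ← mul_smul, ← mul_smul]
    congr 1; group

theorem cosh_log_eq (hk : 0 < k) : Real.cosh (Real.log k) = (k ^ 2 + 1) / (2 * k) := by
  rw [Real.cosh_log hk]; field_simp

/-- The group generated by the side pairings of a rectangle has a shortest closed geodesic, the axis
of one of the side pairings. -/
theorem isLeast_closedGeodesicLengths (hk : 1 < k) {f g h : SL(2, ℝ)}
    (hg : h * g * h⁻¹ = diagSL k (by positivity) ∨ h * g * h⁻¹ = -diagSL k (by positivity))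
    (hf : (quarterTurn * h) * f * (quarterTurn * h)⁻¹ =
          diagSL (dualParam k) (zero_lt_one.trans (one_lt_dualParam hk)).ne' ∨
        (quarterTurn * h) * f * (quarterTurn * h)⁻¹ =
          -diagSL (dualParam k) (zero_lt_one.trans (one_lt_dualParam hk)).ne') :
    IsLeast (closedGeodesicLengths (Subgroup.closure {f, g}))
      (2 * Real.log (min k (dualParam k))) := by
  have hk' := one_lt_dualParam hk
  have hmin : 1 < min k (dualParam k) := lt_min hk hk'
  constructor
  · rcases min_choice k (dualParam k) with hm | hm <;> rw [hm]
    · exact mem_closedGeodesicLengths_of_conj_diagSL hk (Subgroup.subset_closure (by simp)) hg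
    · exact mem_closedGeodesicLengths_of_conj_diagSL hk' (Subgroup.subset_closure (by simp)) hf
  · intro L hL
    have := countable_closure_pair f g
    -- The squared half trace of the shorter generator; `2 * m - 1` is then `cosh` of its
    -- translation length.
    set m := Real.cosh (Real.log (min k (dualParam k))) ^ 2 with hm
    have hlog : 0 < Real.log (min k (dualParam k)) := Real.log_pos hmin
    have hcosh : ∀ x, min k (dualParam k) ≤ x → m ≤ Real.cosh (Real.log x) ^ 2 := by
      intro x hx
      rw [hm]
      refine pow_le_pow_left₀ (Real.cosh_pos _).le ?_ 2
      rw [Real.cosh_le_cosh, abs_of_pos hlog, abs_of_pos (Real.log_pos (hmin.trans_le hx))]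
      exact Real.log_le_log (by linarith) hx
    have hm₂ : m ≤ ((k ^ 2 + 1) / (2 * k)) ^ 2 := by
      rw [← cosh_log_eq (by linarith)]
      exact hcosh k (min_le_left _ _)
    have hm₁ : m ≤ ((k ^ 2 + 1) / (k ^ 2 - 1)) ^ 2 := by
      have h1 : k - 1 ≠ 0 := by linarith
      have h2 : k + 1 ≠ 0 := by linarith
      have h3 : k ^ 2 - 1 ≠ 0 := by nlinarith
      have : (k ^ 2 + 1) / (k ^ 2 - 1) = (dualParam k ^ 2 + 1) / (2 * dualParam k) := by
        rw [dualParam]; field_simp; ring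
      rw [this, ← cosh_log_eq (by linarith)]
      exact hcosh _ (min_le_right _ _)
    -- Undoing the quarter turn expresses both generators in one frame.
    have hf' : ((h * f * h⁻¹ : SL(2, ℝ)) : Matrix (Fin 2) (Fin 2) ℝ) = letter k 0 ∨
        ((h * f * h⁻¹ : SL(2, ℝ)) : Matrix (Fin 2) (Fin 2) ℝ) = -letter k 0 := by
      have e : h * f * h⁻¹ = quarterTurn⁻¹ * ((quarterTurn * h) * f * (quarterTurn * h)⁻¹) *
        quarterTurn := by group
      have e' := coe_conj_diagSL_eq_letter hk (zero_lt_one.trans hk').ne'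
      rcases hf with hf | hf <;> rw [e, hf]
      · exact Or.inl e'
      · right
        rw [← e', mul_neg, neg_mul, Matrix.SpecialLinearGroup.coe_neg]
    have hg' : ((h * g * h⁻¹ : SL(2, ℝ)) : Matrix (Fin 2) (Fin 2) ℝ) = letter k 1 ∨
        ((h * g * h⁻¹ : SL(2, ℝ)) : Matrix (Fin 2) (Fin 2) ℝ) = -letter k 1 := by
      rcases hg with hg | hg <;> rw [hg]
      · exact Or.inl rfl
      · right
        rw [Matrix.SpecialLinearGroup.coe_neg]; rfl
    have h1 := le_cosh_of_mem_closedGeodesicLengths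
      (fun γ hγ => trace_sq_of_mem_closure hk hf' hg' hm₁ hm₂ hγ) hL
    have h2 : Real.cosh (2 * Real.log (min k (dualParam k))) ≤ Real.cosh L := by
      rw [Real.cosh_two_mul, Real.sinh_sq]
      rw [hm] at h1
      linarith
    rwa [Real.cosh_le_cosh, abs_of_pos (by positivity), abs_of_pos hL.1] at h2

end RandomTorus

/-! ### The shortest length as a function of the cross ratio. -/

namespace RandomTorus

/-- The smallest of three numbers divided by the largest. -/
noncomputable def minMaxRatio (a b c : ℝ) : ℝ := min a (min b c) / max a (max b c)

theorem minMaxRatio_swap₁₂ (a b c : ℝ) : minMaxRatio a b c = minMaxRatio b a c := by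
  rw [minMaxRatio, minMaxRatio, min_left_comm, max_left_comm]

theorem minMaxRatio_swap₂₃ (a b c : ℝ) : minMaxRatio a b c = minMaxRatio a c b := by
  rw [minMaxRatio, minMaxRatio, min_comm b, max_comm b]

theorem minMaxRatio_mul {r : ℝ} (hr : 0 < r) (a b c : ℝ) :
    minMaxRatio (r * a) (r * b) (r * c) = minMaxRatio a b c := by
  rw [minMaxRatio, minMaxRatio, ← mul_min_of_nonneg _ _ hr.le, ← mul_min_of_nonneg _ _ hr.le,
    ← mul_max_of_nonneg _ _ hr.le, ← mul_max_of_nonneg _ _ hr.le, mul_div_mul_left _ _ hr.ne']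

theorem minMaxRatio_add {a c : ℝ} (ha : 0 ≤ a) (hc : 0 ≤ c) :
    minMaxRatio a (a + c) c = min a c / (a + c) := by
  rw [minMaxRatio, min_eq_right (by linarith : c ≤ a + c), max_eq_left (by linarith : c ≤ a + c),
    max_eq_right (by linarith : a ≤ a + c)]

/-- Half the chord between two points of the circle. -/
noncomputable def halfChord (α β : ℝ) : ℝ := |Real.sin ((α - β) / 2)|

theorem halfChord_comm (α β : ℝ) : halfChord α β = halfChord β α := by
  rw [halfChord, halfChord, ← abs_neg, ← Real.sin_neg]; congr 2; ring

/-- The modulus of the ideal quadrilateral with the given vertices (in any order): the cross ratio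
in `[0, 1/2]`. -/
noncomputable def quadModulus (θ : Fin 4 → ℝ) : ℝ :=
  minMaxRatio (halfChord (θ 0) (θ 1) * halfChord (θ 2) (θ 3))
    (halfChord (θ 0) (θ 2) * halfChord (θ 1) (θ 3))
    (halfChord (θ 0) (θ 3) * halfChord (θ 1) (θ 2))

/-- Adjacent transpositions generate the group, and each merely exchanges two of the three chord
products. -/
theorem quadModulus_comp_perm (θ : Fin 4 → ℝ) (σ : Equiv.Perm (Fin 4)) :
    quadModulus (θ ∘ σ) = quadModulus θ := by
  have hσ : σ ∈ Submonoid.closure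
      (Set.range fun i : Fin 3 => Equiv.swap i.castSucc i.succ) := by
    rw [Equiv.Perm.mclosure_swap_castSucc_succ]; trivial
  induction hσ using Submonoid.closure_induction generalizing θ with
  | mem x hx =>
    obtain ⟨i, rfl⟩ := hx
    fin_cases i
    · have e0 : Equiv.swap (0 : Fin 4) 1 0 = 1 := by decide
      have e1 : Equiv.swap (0 : Fin 4) 1 1 = 0 := by decide
      have e2 : Equiv.swap (0 : Fin 4) 1 2 = 2 := by decide
      have e3 : Equiv.swap (0 : Fin 4) 1 3 = 3 := by decide
      change quadModulus (θ ∘ Equiv.swap (0 : Fin 4) 1) = _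
      simp only [quadModulus, Function.comp_apply, e0, e1, e2, e3]
      rw [minMaxRatio_swap₂₃, halfChord_comm (θ 1) (θ 0), mul_comm (halfChord (θ 1) (θ 3)),
        mul_comm (halfChord (θ 1) (θ 2))]
    · have e0 : Equiv.swap (1 : Fin 4) 2 0 = 0 := by decide
      have e1 : Equiv.swap (1 : Fin 4) 2 1 = 2 := by decide
      have e2 : Equiv.swap (1 : Fin 4) 2 2 = 1 := by decide
      have e3 : Equiv.swap (1 : Fin 4) 2 3 = 3 := by decide
      change quadModulus (θ ∘ Equiv.swap (1 : Fin 4) 2) = _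
      simp only [quadModulus, Function.comp_apply, e0, e1, e2, e3]
      rw [minMaxRatio_swap₁₂, halfChord_comm (θ 2) (θ 1)]
    · have e0 : Equiv.swap (2 : Fin 4) 3 0 = 0 := by decide
      have e1 : Equiv.swap (2 : Fin 4) 3 1 = 1 := by decide
      have e2 : Equiv.swap (2 : Fin 4) 3 2 = 3 := by decide
      have e3 : Equiv.swap (2 : Fin 4) 3 3 = 2 := by decide
      change quadModulus (θ ∘ Equiv.swap (2 : Fin 4) 3) = _
      simp only [quadModulus, Function.comp_apply, e0, e1, e2, e3]
      rw [minMaxRatio_swap₂₃, halfChord_comm (θ 3) (θ 2)]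
  | one => rfl
  | mul x y _ _ hx hy =>
    rw [Equiv.Perm.coe_mul, ← Function.comp_assoc, hy, hx]

/-- The length of the shortest closed geodesic in terms of the modulus of the quadrilateral. -/
noncomputable def lengthOfModulus (u : ℝ) : ℝ := 2 * Real.artanh √u

/-- The ideal point of the point of the circle with angle `t`. -/
noncomputable def realPoint (t : ℝ) : ℝ := -(Real.cos (t / 2) / Real.sin (t / 2))

theorem circleExp_ne_one_of_sin {t : ℝ} (h : Real.sin (t / 2) ≠ 0) : Circle.exp t ≠ 1 := by
  intro h1
  apply h
  have h2 := congrArg (fun w : Circle => (w : ℂ).re) h1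
  simp only [Circle.coe_exp, Circle.coe_one, Complex.one_re, Complex.exp_ofReal_mul_I_re] at h2
  have h3 := Real.cos_sq (t / 2)
  rw [mul_div_cancel₀ _ (two_ne_zero' ℝ), h2] at h3
  have h4 := Real.sin_sq_add_cos_sq (t / 2)
  have : Real.sin (t / 2) ^ 2 = 0 := by linarith
  exact pow_eq_zero_iff two_ne_zero |>.1 this

theorem sin_ne_zero_of_circleExp_ne_one {t : ℝ} (h : Circle.exp t ≠ 1) :
    Real.sin (t / 2) ≠ 0 := by
  intro h1
  apply h
  obtain ⟨n, hn⟩ := Real.sin_eq_zero_iff.1 h1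
  rw [Circle.exp_eq_one]
  exact ⟨n, by linarith⟩

theorem idealPoint_circleExp {t : ℝ} (h : Real.sin (t / 2) ≠ 0) :
    idealPoint (Circle.exp t) = (realPoint t : OnePoint ℝ) := by
  rw [idealPoint, if_neg (circleExp_ne_one_of_sin h)]
  congr 1
  rw [Circle.coe_exp, Complex.div_re, realPoint]
  simp only [Complex.mul_re, Complex.mul_im, Complex.add_re, Complex.add_im, Complex.sub_re,
    Complex.sub_im, Complex.I_re, Complex.I_im, Complex.one_re, Complex.one_im,
    Complex.normSq_apply, Complex.exp_ofReal_mul_I_re, Complex.exp_ofReal_mul_I_im]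
  have hc : Real.cos t = 1 - 2 * Real.sin (t / 2) ^ 2 := by
    have := Real.cos_two_mul (t / 2)
    rw [mul_div_cancel₀ _ (two_ne_zero' ℝ)] at this
    linarith [Real.sin_sq_add_cos_sq (t / 2)]
  have hs : Real.sin t = 2 * Real.sin (t / 2) * Real.cos (t / 2) := by
    have := Real.sin_two_mul (t / 2)
    rwa [mul_div_cancel₀ _ (two_ne_zero' ℝ)] at this
  have hN : (1 - Real.cos t) * (1 - Real.cos t) + (0 - Real.sin t) * (0 - Real.sin t) =
      4 * Real.sin (t / 2) ^ 2 := by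
    rw [hc, hs]
    linear_combination 4 * Real.sin (t / 2) ^ 2 * Real.sin_sq_add_cos_sq (t / 2)
  rw [hN, ← add_div, ← neg_div, div_eq_div_iff (by positivity) h, hc, hs]
  ring

theorem realPoint_sub {s t : ℝ} (hs : Real.sin (s / 2) ≠ 0) (ht : Real.sin (t / 2) ≠ 0) :
    realPoint s - realPoint t =
      Real.sin ((s - t) / 2) / (Real.sin (s / 2) * Real.sin (t / 2)) := by
  rw [realPoint, realPoint, sub_div, Real.sin_sub]
  field_simp
  ring

/-- Each vertex occurs in two differences, so the half-angle sines in the denominators form a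
square; only the sines of half gaps decide the sign, and these lie in `(0, π)`. Hence it does not
matter where the point `∞` falls in the cyclic order. -/
theorem posTriple_realPoint {a b c : ℝ} (hab : a < b) (hbc : b < c) (hca : c < a + 2 * Real.pi)
    (ha : Real.sin (a / 2) ≠ 0) (hb : Real.sin (b / 2) ≠ 0) (hc : Real.sin (c / 2) ≠ 0) :
    PosTriple (realPoint a) (realPoint b) (realPoint c) := by
  rw [PosTriple, realPoint_sub hb ha, realPoint_sub hc hb, realPoint_sub hc ha]
  have h1 : 0 < Real.sin ((b - a) / 2) := Real.sin_pos_of_pos_of_lt_pi (by linarith) (by linarith)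
  have h2 : 0 < Real.sin ((c - b) / 2) := Real.sin_pos_of_pos_of_lt_pi (by linarith) (by linarith)
  have h3 : 0 < Real.sin ((c - a) / 2) := Real.sin_pos_of_pos_of_lt_pi (by linarith) (by linarith)
  have : Real.sin ((b - a) / 2) / (Real.sin (b / 2) * Real.sin (a / 2)) *
      (Real.sin ((c - b) / 2) / (Real.sin (c / 2) * Real.sin (b / 2))) *
      (Real.sin ((c - a) / 2) / (Real.sin (c / 2) * Real.sin (a / 2))) =
      Real.sin ((b - a) / 2) * Real.sin ((c - b) / 2) * Real.sin ((c - a) / 2) /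
        (Real.sin (a / 2) * Real.sin (b / 2) * Real.sin (c / 2)) ^ 2 := by
    field_simp
  rw [this]
  positivity

theorem pos_realPoint_cyclic {a b c d : ℝ} (hab : a < b) (hbc : b < c) (hcd : c < d)
    (hda : d < a + 2 * Real.pi) (ha : Real.sin (a / 2) ≠ 0) (hb : Real.sin (b / 2) ≠ 0)
    (hc : Real.sin (c / 2) ≠ 0) (hd : Real.sin (d / 2) ≠ 0) :
    0 < (realPoint b - realPoint a) * (realPoint c - realPoint b) * (realPoint d - realPoint c) *
      (realPoint d - realPoint a) := by
  rw [realPoint_sub hb ha, realPoint_sub hc hb, realPoint_sub hd hc, realPoint_sub hd ha]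
  have h1 : 0 < Real.sin ((b - a) / 2) := Real.sin_pos_of_pos_of_lt_pi (by linarith) (by linarith)
  have h2 : 0 < Real.sin ((c - b) / 2) := Real.sin_pos_of_pos_of_lt_pi (by linarith) (by linarith)
  have h3 : 0 < Real.sin ((d - c) / 2) := Real.sin_pos_of_pos_of_lt_pi (by linarith) (by linarith)
  have h4 : 0 < Real.sin ((d - a) / 2) := Real.sin_pos_of_pos_of_lt_pi (by linarith) (by linarith)
  have : Real.sin ((b - a) / 2) / (Real.sin (b / 2) * Real.sin (a / 2)) *
      (Real.sin ((c - b) / 2) / (Real.sin (c / 2) * Real.sin (b / 2))) *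
      (Real.sin ((d - c) / 2) / (Real.sin (d / 2) * Real.sin (c / 2))) *
      (Real.sin ((d - a) / 2) / (Real.sin (d / 2) * Real.sin (a / 2))) =
      Real.sin ((b - a) / 2) * Real.sin ((c - b) / 2) * Real.sin ((d - c) / 2) *
        Real.sin ((d - a) / 2) /
        (Real.sin (a / 2) * Real.sin (b / 2) * Real.sin (c / 2) * Real.sin (d / 2)) ^ 2 := by
    field_simp
  rw [this]
  positivity

/-- Passing from chords to real differences divides all three products by the same product of four
sines, which cancels in the ratio. -/
theorem quadModulus_eq_realPoint {θ : Fin 4 → ℝ} (h : ∀ j, Real.sin (θ j / 2) ≠ 0) :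
    quadModulus θ = minMaxRatio
      |(realPoint (θ 1) - realPoint (θ 0)) * (realPoint (θ 3) - realPoint (θ 2))|
      |(realPoint (θ 2) - realPoint (θ 0)) * (realPoint (θ 3) - realPoint (θ 1))|
      |(realPoint (θ 2) - realPoint (θ 1)) * (realPoint (θ 3) - realPoint (θ 0))| := by
  set K := |Real.sin (θ 0 / 2) * Real.sin (θ 1 / 2) * Real.sin (θ 2 / 2) * Real.sin (θ 3 / 2)|
  have hK : 0 < K⁻¹ := inv_pos.2 (abs_pos.2 (by simp [h]))
  have key : ∀ i j k l, |(realPoint (θ j) - realPoint (θ i)) *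
      (realPoint (θ l) - realPoint (θ k))| =
      |Real.sin (θ i / 2) * Real.sin (θ j / 2) * Real.sin (θ k / 2) * Real.sin (θ l / 2)|⁻¹ *
        (halfChord (θ i) (θ j) * halfChord (θ k) (θ l)) := by
    intro i j k l
    rw [halfChord_comm (θ i), halfChord_comm (θ k), halfChord, halfChord, ← abs_mul, ← abs_inv,
      ← abs_mul, realPoint_sub (h j) (h i), realPoint_sub (h l) (h k)]
    have hi := h i
    have hj := h j
    have hk := h k
    have hl := h l
    congr 1
    field_simp
  have p1 : Real.sin (θ 0 / 2) * Real.sin (θ 2 / 2) * Real.sin (θ 1 / 2) * Real.sin (θ 3 / 2) =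
    Real.sin (θ 0 / 2) * Real.sin (θ 1 / 2) * Real.sin (θ 2 / 2) * Real.sin (θ 3 / 2) := by ring
  have p2 : Real.sin (θ 1 / 2) * Real.sin (θ 2 / 2) * Real.sin (θ 0 / 2) * Real.sin (θ 3 / 2) =
    Real.sin (θ 0 / 2) * Real.sin (θ 1 / 2) * Real.sin (θ 2 / 2) * Real.sin (θ 3 / 2) := by ring
  rw [key, key, key, p1, p2, minMaxRatio_mul hK, quadModulus,
    mul_comm (halfChord (θ 0) (θ 3))]

theorem tanh_log_eq {k : ℝ} (hk : 0 < k) :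
    Real.tanh (Real.log k) = (k ^ 2 - 1) / (k ^ 2 + 1) := by
  rw [Real.tanh_eq_sinh_div_cosh, Real.sinh_log hk, Real.cosh_log hk]
  field_simp

/-- Here `b = a + c` is Ptolemy's relation between the diagonals and the two pairs of sides, so
`|b|` is the largest. The ratios `|a|/|b|` and `|c|/|b|` are `tanh²` of `log k` and `log (dualParam
k)`, and monotonicity matches the smaller ratio with the smaller parameter. -/
theorem lengthOfModulus_eq {a b c k : ℝ} (hk : 1 < k) (hb : b = a + c) (hac : 0 < a * c)
    (h : 4 * b = (k + k⁻¹) ^ 2 * c) :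
    lengthOfModulus (minMaxRatio |a| |b| |c|) = 2 * Real.log (min k (dualParam k)) := by
  have hk' := one_lt_dualParam hk
  have hk0 : 0 < k := by linarith
  have hmin : 1 < min k (dualParam k) := lt_min hk hk'
  have ha0 : a ≠ 0 := left_ne_zero_of_mul hac.ne'
  have hc0 : c ≠ 0 := right_ne_zero_of_mul hac.ne'
  have hk1 : k - 1 ≠ 0 := by linarith
  have hk2 : k + 1 ≠ 0 := by linarith
  have hcb : 4 * k ^ 2 * (|a| + |c|) = (k ^ 2 + 1) ^ 2 * |c| := by
    have h1 : 4 * k ^ 2 * b = (k ^ 2 + 1) ^ 2 * c := by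
      have : (k ^ 2 + 1) ^ 2 = k ^ 2 * (k + k⁻¹) ^ 2 := by field_simp
      rw [this]; linear_combination k ^ 2 * h
    have h2 : |a| + |c| = |b| := by
      rw [hb]
      rcases pos_and_pos_or_neg_and_neg_of_mul_pos hac with ⟨h1, h2⟩ | ⟨h1, h2⟩
      · rw [abs_of_pos h1, abs_of_pos h2, abs_of_pos (by linarith)]
      · rw [abs_of_neg h1, abs_of_neg h2, abs_of_neg (by linarith)]; ring
    have h3 := congrArg abs h1
    rwa [abs_mul (4 * k ^ 2), abs_mul ((k ^ 2 + 1) ^ 2),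
      abs_of_pos (by positivity : 0 < 4 * k ^ 2),
      abs_of_pos (by positivity : 0 < (k ^ 2 + 1) ^ 2), ← h2] at h3
  have hsum : |b| = |a| + |c| := by
    rw [hb]
    rcases pos_and_pos_or_neg_and_neg_of_mul_pos hac with ⟨h1, h2⟩ | ⟨h1, h2⟩
    · rw [abs_of_pos h1, abs_of_pos h2, abs_of_pos (by linarith)]
    · rw [abs_of_neg h1, abs_of_neg h2, abs_of_neg (by linarith)]; ring
  have hA : 0 < |a| := abs_pos.2 ha0
  have hC : 0 < |c| := abs_pos.2 hc0
  have hta : |a| / (|a| + |c|) = Real.tanh (Real.log k) ^ 2 := by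
    rw [tanh_log_eq hk0, div_pow, div_eq_div_iff (by positivity) (by positivity)]
    linear_combination hcb
  have htc : |c| / (|a| + |c|) = Real.tanh (Real.log (dualParam k)) ^ 2 := by
    have e : (dualParam k ^ 2 - 1) / (dualParam k ^ 2 + 1) = 2 * k / (k ^ 2 + 1) := by
      have : dualParam k ^ 2 + 1 ≠ 0 := by positivity
      rw [div_eq_div_iff this (by positivity), dualParam]
      field_simp
      ring
    rw [tanh_log_eq (by linarith), e, div_pow, div_eq_div_iff (by positivity) (by positivity)]
    linear_combination -hcb
  have hmono : ∀ x y : ℝ, 1 < x → x ≤ y →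
      Real.tanh (Real.log x) ^ 2 ≤ Real.tanh (Real.log y) ^ 2 := by
    intro x y hx hxy
    rw [tanh_log_eq (by linarith), tanh_log_eq (by linarith)]
    refine pow_le_pow_left₀ (div_nonneg (by nlinarith) (by positivity)) ?_ 2
    rw [div_le_div_iff₀ (by positivity) (by positivity)]
    nlinarith [mul_self_le_mul_self (by linarith : (0 : ℝ) ≤ x) hxy]
  have hratio : minMaxRatio |a| |b| |c| = Real.tanh (Real.log (min k (dualParam k))) ^ 2 := by
    rw [hsum, minMaxRatio_add hA.le hC.le, ← min_div_div_right (by positivity) |a| |c|, hta, htc]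
    rcases le_total k (dualParam k) with hle | hle
    · rw [min_eq_left hle, min_eq_left (hmono _ _ hk hle)]
    · rw [min_eq_right hle, min_eq_right (hmono _ _ hk' hle)]
  have hpos : 0 ≤ Real.tanh (Real.log (min k (dualParam k))) := by
    rw [tanh_log_eq (by linarith)]
    exact div_nonneg (by nlinarith) (by positivity)
  rw [lengthOfModulus, hratio, Real.sqrt_sq hpos, Real.artanh_tanh]

/-- The shortest closed geodesic of a rectangular punctured torus. -/
theorem isLeast_of_isRectangularTorusGroup {θ : Fin 4 → ℝ} (hθ : ∀ j, Real.sin (θ j / 2) ≠ 0)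
    {Γ : Subgroup SL(2, ℝ)}
    (hΓ : IsRectangularTorusGroup (fun j => Circle.exp (θ j)) Γ) :
    IsLeast (closedGeodesicLengths Γ) (lengthOfModulus (quadModulus θ)) := by
  obtain ⟨σ, ⟨t, t01, t12, t23, t30, ht⟩, f, g, hf, hg, rfl⟩ := hΓ
  have hts : ∀ j, Real.sin (t j / 2) ≠ 0 := fun j =>
    sin_ne_zero_of_circleExp_ne_one (by rw [← ht]; exact circleExp_ne_one_of_sin (hθ _))
  -- The ordered lifts `t` may differ from the given angles by multiples of `2π`; the ideal points
  -- agree.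
  have hp : ∀ j, realPoint (θ (σ j)) = realPoint (t j) := by
    intro j
    have h1 := idealPoint_circleExp (hθ (σ j))
    have h2 := idealPoint_circleExp (hts j)
    rw [← ht j, h1] at h2
    exact OnePoint.coe_injective h2
  have h₀ := posTriple_realPoint t01 t12 (by linarith) (hts 0) (hts 1) (hts 2)
  have h₃ := posTriple_realPoint t12 t23 (by linarith) (hts 1) (hts 2) (hts 3)
  have hcr := pos_realPoint_cyclic t01 t12 t23 t30 (hts 0) (hts 1) (hts 2) (hts 3)
  simp only [idealPoint_circleExp (hθ _), hp] at hf hg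
  obtain ⟨k, hk, h, hX, hG, hF⟩ := exists_pairing_normalForm h₀ h₃ hcr
  rw [← quadModulus_comp_perm θ σ, quadModulus_eq_realPoint (θ := θ ∘ σ) fun j => hθ (σ j)]
  simp only [Function.comp_apply, hp]
  rw [lengthOfModulus_eq hk (by ring) (hcr.trans_eq (by ring)) hX]
  exact isLeast_closedGeodesicLengths hk ((hG g).1 hg) ((hF f).1 hf)

/-- Sorting the angles gives the counterclockwise order, and conjugating the two dilations back from
the normal forms gives the pairings. -/
theorem exists_isRectangularTorusGroup {θ : Fin 4 → ℝ} (hθ : ∀ j, θ j ∈ Set.Ioo 0 (2 * Real.pi))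
    (hinj : Function.Injective θ) :
    ∃ Γ, IsRectangularTorusGroup (fun j => Circle.exp (θ j)) Γ := by
  have hs : ∀ j, Real.sin (θ j / 2) ≠ 0 := fun j =>
    (Real.sin_pos_of_pos_of_lt_pi (by linarith [(hθ j).1]) (by linarith [(hθ j).2])).ne'
  set σ := Tuple.sort θ
  have hmono : StrictMono (θ ∘ σ) :=
    (Tuple.monotone_sort θ).strictMono_of_injective (hinj.comp σ.injective)
  have t01 : θ (σ 0) < θ (σ 1) := hmono (by decide)
  have t12 : θ (σ 1) < θ (σ 2) := hmono (by decide)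
  have t23 : θ (σ 2) < θ (σ 3) := hmono (by decide)
  have t30 : θ (σ 3) < θ (σ 0) + 2 * Real.pi := by linarith [(hθ (σ 3)).2, (hθ (σ 0)).1]
  obtain ⟨k, hk, h, hX, hG, hF⟩ := exists_pairing_normalForm
    (posTriple_realPoint t01 t12 (by linarith) (hs _) (hs _) (hs _))
    (posTriple_realPoint t12 t23 (by linarith) (hs _) (hs _) (hs _))
    (pos_realPoint_cyclic t01 t12 t23 t30 (hs _) (hs _) (hs _) (hs _))
  refine ⟨_, σ, ⟨fun j => θ (σ j), t01, t12, t23, t30, fun _ => rfl⟩,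
    (quarterTurn * h)⁻¹ * diagSL (dualParam k) (zero_lt_one.trans (one_lt_dualParam hk)).ne' *
      (quarterTurn * h), h⁻¹ * diagSL k (by positivity) * h, ?_, ?_, rfl⟩
  · simp only [idealPoint_circleExp (hs _)]
    exact (hF _).2 (Or.inl (by group))
  · simp only [idealPoint_circleExp (hs _)]
    exact (hG _).2 (Or.inl (by group))

end RandomTorus

/-! ### From uniform angles to Cauchy variables. -/

namespace RandomTorus

open scoped ENNReal

theorem setLIntegral_periodic_add {f : ℝ → ℝ≥0∞} {T : ℝ} (hT : 0 < T)
    (hf : Function.Periodic f T) (a : ℝ) :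
    ∫⁻ x in Set.Ioc 0 T, f (x + a) = ∫⁻ x in Set.Ioc 0 T, f x := by
  have h1 : ∫⁻ x in Set.Ioc 0 T, f (x + a) = ∫⁻ x in Set.Ioc a (a + T), f x := by
    have := (measurePreserving_add_right volume a).setLIntegral_comp_emb
      (measurableEmbedding_addRight a) f (Set.Ioc 0 T)
    refine this.trans ?_
    rw [Set.image_add_const_Ioc, zero_add, add_comm T a]
  rw [h1]
  have : VAddInvariantMeasure (AddSubgroup.zmultiples T) ℝ volume :=
    ⟨fun c s _ => measure_preimage_add _ _ _⟩
  have h2 := IsAddFundamentalDomain.setLIntegral_eq (G := AddSubgroup.zmultiples T)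
    (isAddFundamentalDomain_Ioc hT a volume) (isAddFundamentalDomain_Ioc hT 0 volume) f
    hf.map_vadd_zmultiples
  rwa [zero_add] at h2

theorem lintegral_pi_succ {n : ℕ} (μ : Measure ℝ) [SigmaFinite μ] {f : (Fin (n + 1) → ℝ) → ℝ≥0∞}
    (hf : Measurable f) :
    ∫⁻ x, f x ∂(Measure.pi fun _ => μ) =
      ∫⁻ a, ∫⁻ y, f (Fin.cons a y) ∂(Measure.pi fun _ => μ) ∂μ := by
  have h := (measurePreserving_piFinSuccAbove (fun _ : Fin (n + 1) => μ) 0).symm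
  rw [← h.lintegral_comp hf, lintegral_prod]
  · refine lintegral_congr fun a => lintegral_congr fun y => ?_
    change f (Fin.insertNth 0 a y) = _
    rw [Fin.insertNth_zero']
  · exact (hf.comp (MeasurableEquiv.measurable _)).aemeasurable

theorem lintegral_pi_four (μ : Measure ℝ) [SigmaFinite μ] {f : (Fin 4 → ℝ) → ℝ≥0∞}
    (hf : Measurable f) :
    ∫⁻ x, f x ∂(Measure.pi fun _ => μ) =
      ∫⁻ a, ∫⁻ b, ∫⁻ c, ∫⁻ d, f ![a, b, c, d] ∂μ ∂μ ∂μ ∂μ := by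
  rw [lintegral_pi_succ μ hf]
  refine lintegral_congr fun a => ?_
  have h1 : Measurable fun y : Fin 3 → ℝ => f (Fin.cons a y) := hf.comp (by fun_prop)
  rw [lintegral_pi_succ μ h1]
  refine lintegral_congr fun b => ?_
  have h2 : Measurable fun y : Fin 2 → ℝ => f (Fin.cons a (Fin.cons b y)) := h1.comp (by fun_prop)
  rw [lintegral_pi_succ μ h2]
  refine lintegral_congr fun c => ?_
  have h3 : Measurable fun y : Fin 1 → ℝ => f (Fin.cons a (Fin.cons b (Fin.cons c y))) :=
    h2.comp (by fun_prop)
  rw [lintegral_pi_succ μ h3]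
  refine lintegral_congr fun d => ?_
  rw [lintegral_unique]
  simp
  rfl

/-- The density of the Cauchy distribution. -/
noncomputable def cauchyWeight (x : ℝ) : ℝ≥0∞ := ENNReal.ofReal (1 / (Real.pi * (1 + x ^ 2)))

theorem measurable_cauchyWeight : Measurable cauchyWeight := by
  unfold cauchyWeight; fun_prop

/-- The angle corresponding to a real ideal point. -/
noncomputable def pointAngle (x : ℝ) : ℝ := Real.pi + 2 * Real.arctan x

/-- The substitution `t = π + 2 arctan x` has derivative `2/(1 + x²)`, which is `2π` times the
Cauchy density. -/
theorem lintegral_uniform_eq_cauchy (f : ℝ → ℝ≥0∞) :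
    ∫⁻ t in Set.Ioc 0 (2 * Real.pi), f t =
      ENNReal.ofReal (2 * Real.pi) * ∫⁻ x, cauchyWeight x * f (pointAngle x) := by
  have himg : pointAngle '' Set.univ = Set.Ioo 0 (2 * Real.pi) := by
    have hp := Real.pi_pos
    ext t
    simp only [Set.image_univ, Set.mem_range, Set.mem_Ioo, pointAngle]
    constructor
    · rintro ⟨x, rfl⟩
      constructor
      · linarith [Real.neg_pi_div_two_lt_arctan x]
      · linarith [Real.arctan_lt_pi_div_two x]
    · rintro ⟨h1, h2⟩
      refine ⟨Real.tan ((t - Real.pi) / 2), ?_⟩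
      rw [Real.arctan_tan (by linarith) (by linarith)]
      ring
  have hder : ∀ x ∈ Set.univ, HasDerivWithinAt pointAngle (2 * (1 / (1 + x ^ 2))) Set.univ x :=
    fun x _ => (((Real.hasDerivAt_arctan x).const_mul 2).const_add Real.pi).hasDerivWithinAt
  have hinj : Set.InjOn pointAngle Set.univ := by
    intro x _ y _ h
    have : Real.arctan x = Real.arctan y := by simp only [pointAngle] at h; linarith
    exact Real.arctan_injective this
  rw [Measure.restrict_congr_set (Ioo_ae_eq_Ioc (a := (0 : ℝ)) (b := 2 * Real.pi)).symm, ← himg,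
    lintegral_image_eq_lintegral_abs_deriv_mul MeasurableSet.univ hder hinj, Measure.restrict_univ,
    ← lintegral_const_mul' _ _ ENNReal.ofReal_ne_top]
  refine lintegral_congr fun x => ?_
  rw [← mul_assoc, cauchyWeight, ← ENNReal.ofReal_mul (by positivity)]
  congr 2
  rw [abs_of_pos (by positivity)]
  have := Real.pi_pos
  field_simp

theorem measurable_halfChord_fun {α : Type*} [MeasurableSpace α] {f g : α → ℝ} (hf : Measurable f)
    (hg : Measurable g) : Measurable fun x => halfChord (f x) (g x) := by
  unfold halfChord
  simp only [← Real.norm_eq_abs]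
  fun_prop

theorem measurable_minMaxRatio_fun {α : Type*} [MeasurableSpace α] {f g h : α → ℝ}
    (hf : Measurable f) (hg : Measurable g) (hh : Measurable h) :
    Measurable fun x => minMaxRatio (f x) (g x) (h x) := by
  unfold minMaxRatio
  fun_prop

theorem measurable_quadModulus : Measurable quadModulus := by
  unfold quadModulus
  apply measurable_minMaxRatio_fun <;> apply Measurable.mul <;> apply measurable_halfChord_fun <;>
    fun_prop

theorem halfChord_add_two_pi (α β : ℝ) : halfChord (α + 2 * Real.pi) β = halfChord α β := by
  rw [halfChord, halfChord, show (α + 2 * Real.pi - β) / 2 = (α - β) / 2 + Real.pi by ring,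
    Real.sin_add_pi, abs_neg]

theorem halfChord_add_two_pi' (α β : ℝ) : halfChord α (β + 2 * Real.pi) = halfChord α β := by
  rw [halfChord_comm, halfChord_add_two_pi, halfChord_comm]

theorem halfChord_add_add (α β t : ℝ) : halfChord (α + t) (β + t) = halfChord α β := by
  rw [halfChord, halfChord, add_sub_add_right_eq_sub]

theorem halfChord_pointAngle (x y : ℝ) : halfChord (pointAngle x) (pointAngle y) =
    (√(1 + x ^ 2) * √(1 + y ^ 2))⁻¹ * |x - y| := by
  have hx : 0 < √(1 + x ^ 2) := Real.sqrt_pos.2 (by positivity)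
  have hy : 0 < √(1 + y ^ 2) := Real.sqrt_pos.2 (by positivity)
  rw [halfChord, show (pointAngle x - pointAngle y) / 2 = Real.arctan x - Real.arctan y by
    simp only [pointAngle]; ring, Real.sin_sub, Real.sin_arctan, Real.cos_arctan, Real.sin_arctan,
    Real.cos_arctan, ← abs_of_pos (inv_pos.2 (mul_pos hx hy)), ← abs_mul]
  congr 1
  field_simp

theorem halfChord_zero_pointAngle (x : ℝ) : halfChord 0 (pointAngle x) = (√(1 + x ^ 2))⁻¹ := by
  have hx : 0 < √(1 + x ^ 2) := Real.sqrt_pos.2 (by positivity)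
  rw [halfChord, show (0 - pointAngle x) / 2 = -(Real.arctan x + Real.pi / 2) by
    simp only [pointAngle]; ring, Real.sin_neg, abs_neg, Real.sin_add_pi_div_two, Real.cos_arctan,
    one_div, abs_of_pos (inv_pos.2 hx)]

/-- The angle `0` is the point `∞`. All three chord products carry the same factor `((1 + x²)(1 +
y²)(1 + z²))^(-1/2)`, leaving the distances of three real points. -/
theorem quadModulus_pointAngle (x y z : ℝ) :
    quadModulus ![0, pointAngle x, pointAngle y, pointAngle z] =
      minMaxRatio |y - z| |x - z| |x - y| := by
  have hx : 0 < √(1 + x ^ 2) := Real.sqrt_pos.2 (by positivity)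
  have hy : 0 < √(1 + y ^ 2) := Real.sqrt_pos.2 (by positivity)
  have hz : 0 < √(1 + z ^ 2) := Real.sqrt_pos.2 (by positivity)
  change minMaxRatio (halfChord 0 (pointAngle x) * halfChord (pointAngle y) (pointAngle z))
    (halfChord 0 (pointAngle y) * halfChord (pointAngle x) (pointAngle z))
    (halfChord 0 (pointAngle z) * halfChord (pointAngle x) (pointAngle y)) = _
  simp only [halfChord_pointAngle, halfChord_zero_pointAngle]
  rw [← minMaxRatio_mul (r := (√(1 + x ^ 2) * √(1 + y ^ 2) * √(1 + z ^ 2))⁻¹) (by positivity)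
    |y - z| |x - z| |x - y|]
  congr 1 <;> field_simp

theorem quadModulus_add (a : ℝ) (θ : Fin 4 → ℝ) :
    quadModulus (fun j => θ j + a) = quadModulus θ := by
  simp only [quadModulus, halfChord_add_add]

/-- A function of the modulus of four random points, in terms of three Cauchy variables. -/
theorem lintegral_quadModulus_uniform {Φ : ℝ → ℝ≥0∞} (hΦ : Measurable Φ) :
    ∫⁻ θ, Φ (quadModulus θ)
      ∂(Measure.pi fun _ : Fin 4 => cond volume (Set.Icc 0 (2 * Real.pi))) =
    ∫⁻ x, ∫⁻ y, ∫⁻ z, cauchyWeight x * (cauchyWeight y * (cauchyWeight z *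
      Φ (minMaxRatio |y - z| |x - z| |x - y|))) := by
  have hp := Real.two_pi_pos
  set ν : Measure ℝ := cond volume (Set.Icc 0 (2 * Real.pi)) with hν
  have hνp : IsProbabilityMeasure ν := cond_isProbabilityMeasure_of_finite
    (by rw [Real.volume_Icc]; simpa using Real.pi_pos)
    (by rw [Real.volume_Icc]; exact ENNReal.ofReal_ne_top)
  have hνint : ∀ f : ℝ → ℝ≥0∞, ∫⁻ t, f t ∂ν =
      (ENNReal.ofReal (2 * Real.pi))⁻¹ * ∫⁻ t in Set.Ioc 0 (2 * Real.pi), f t := by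
    intro f
    rw [hν, ProbabilityTheory.cond, lintegral_smul_measure, Real.volume_Icc, sub_zero, smul_eq_mul,
      Measure.restrict_congr_set (Ioc_ae_eq_Icc (a := (0 : ℝ)) (b := 2 * Real.pi)).symm]
  have hνper : ∀ (f : ℝ → ℝ≥0∞) (a : ℝ), Function.Periodic f (2 * Real.pi) →
      ∫⁻ t, f t ∂ν = ∫⁻ t, f (t + a) ∂ν := by
    intro f a hf
    rw [hνint, hνint, setLIntegral_periodic_add hp hf]
  have hνc : ∀ f : ℝ → ℝ≥0∞, ∫⁻ t, f t ∂ν = ∫⁻ x, cauchyWeight x * f (pointAngle x) := by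
    intro f
    rw [hνint, lintegral_uniform_eq_cauchy, ← mul_assoc,
      ENNReal.inv_mul_cancel (by simpa using hp) ENNReal.ofReal_ne_top, one_mul]
  have hm : Measurable fun θ => Φ (quadModulus θ) := hΦ.comp measurable_quadModulus
  rw [lintegral_pi_four ν hm]
  -- The modulus is invariant under rotation and periodic in each angle, so translating the other
  -- three angles by `a` moves the first one to `0`.
  have hconst : ∀ a, ∫⁻ b, ∫⁻ c, ∫⁻ d, Φ (quadModulus ![a, b, c, d]) ∂ν ∂ν ∂ν =
      ∫⁻ b, ∫⁻ c, ∫⁻ d, Φ (quadModulus ![0, b, c, d]) ∂ν ∂ν ∂ν := by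
    intro a
    have hq1 : ∀ a b c d, quadModulus ![a, b + 2 * Real.pi, c, d] = quadModulus ![a, b, c, d] := by
      intro a b c d
      simp [quadModulus, halfChord_add_two_pi, halfChord_add_two_pi']
    have hq2 : ∀ a b c d, quadModulus ![a, b, c + 2 * Real.pi, d] = quadModulus ![a, b, c, d] := by
      intro a b c d
      simp [quadModulus, halfChord_add_two_pi, halfChord_add_two_pi']
    have hq3 : ∀ a b c d, quadModulus ![a, b, c, d + 2 * Real.pi] = quadModulus ![a, b, c, d] := by
      intro a b c d
      simp [quadModulus, halfChord_add_two_pi']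
    have hq : ∀ b c d, quadModulus ![a, b + a, c + a, d + a] = quadModulus ![0, b, c, d] := by
      intro b c d
      rw [← quadModulus_add a ![0, b, c, d]]
      congr 1
      ext j; fin_cases j <;> simp
    rw [hνper _ a (fun b => by simp only [hq1])]
    refine lintegral_congr fun b => ?_
    rw [hνper _ a (fun c => by simp only [hq2])]
    refine lintegral_congr fun c => ?_
    rw [hνper _ a (fun d => by simp only [hq3])]
    refine lintegral_congr fun d => ?_
    rw [hq]
  simp only [hconst]
  rw [lintegral_const, measure_univ, mul_one, hνc]
  refine lintegral_congr fun x => ?_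
  rw [hνc, ← lintegral_const_mul' (cauchyWeight x) _ ENNReal.ofReal_ne_top]
  refine lintegral_congr fun y => ?_
  rw [hνc, ← mul_assoc, ← lintegral_const_mul' (cauchyWeight x * cauchyWeight y) _ (ENNReal.mul_ne_top ENNReal.ofReal_ne_top
    ENNReal.ofReal_ne_top)]
  refine lintegral_congr fun z => ?_
  rw [quadModulus_pointAngle, mul_assoc]

end RandomTorus

/-! ### The density of the cross ratio. -/

namespace RandomTorus

open scoped ENNReal
open Filter Topology

/-- Partial fractions for the product of three Cauchy densities. -/
theorem cauchy_partial_fractions {s t : ℝ} (hs : s ≠ 0) (ht : t ≠ 0) (hst : t - s ≠ 0) (x : ℝ) :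
    1 / ((1 + x ^ 2) * (1 + (x + s) ^ 2) * (1 + (x + t) ^ 2)) =
      (s * t * (t - s) * (s ^ 2 + 4) * (t ^ 2 + 4) * ((t - s) ^ 2 + 4))⁻¹ *
      ((t - s) * ((t - s) ^ 2 + 4) * (-2 * (s + t) * x + (s * t - 4)) / (1 + x ^ 2) +
        -t * (t ^ 2 + 4) * (-2 * (t - 2 * s) * (x + s) + (-s * (t - s) - 4)) / (1 + (x + s) ^ 2) +
        s * (s ^ 2 + 4) * (-2 * (s - 2 * t) * (x + t) + (t * (t - s) - 4)) /
          (1 + (x + t) ^ 2)) := by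
  have h0 : 1 + x ^ 2 ≠ 0 := by positivity
  have h1 : 1 + (x + s) ^ 2 ≠ 0 := by positivity
  have h2 : 1 + (x + t) ^ 2 ≠ 0 := by positivity
  have hD : s * t * (t - s) * (s ^ 2 + 4) * (t ^ 2 + 4) * ((t - s) ^ 2 + 4) ≠ 0 := by
    refine mul_ne_zero (mul_ne_zero (mul_ne_zero (mul_ne_zero (mul_ne_zero hs ht) hst) ?_) ?_) ?_ <;>
      positivity
  rw [div_add_div _ _ h0 h1, div_add_div _ _ (mul_ne_zero h0 h1) h2, inv_mul_eq_div, div_div,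
    div_eq_div_iff (mul_ne_zero (mul_ne_zero h0 h1) h2)
      (mul_ne_zero (mul_ne_zero (mul_ne_zero h0 h1) h2) hD)]
  ring

theorem tendsto_one_add_sq_div {l : Filter ℝ} (hl : Tendsto (fun x : ℝ => x⁻¹) l (𝓝 0))
    (hl0 : ∀ᶠ x in l, x ≠ 0) (s : ℝ) :
    Tendsto (fun x => (1 + (x + s) ^ 2) / (1 + x ^ 2)) l (𝓝 1) := by
  have h1 : Tendsto (fun x : ℝ => ((x⁻¹) ^ 2 + (1 + s * x⁻¹) ^ 2) / ((x⁻¹) ^ 2 + 1)) l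
      (𝓝 (((0 : ℝ) ^ 2 + (1 + s * 0) ^ 2) / ((0 : ℝ) ^ 2 + 1))) :=
    ((hl.pow 2).add (((hl.const_mul s).const_add 1).pow 2)).div ((hl.pow 2).add_const 1) (by norm_num)
  norm_num at h1
  refine h1.congr' ?_
  filter_upwards [hl0] with x hx
  field_simp

/-- The antiderivative from partial fractions is a combination of logarithms and arctangents. The
logarithm coefficients sum to zero, so the logarithms cancel at both ends, and each arctangent
contributes `π` times its coefficient. -/
theorem integral_three_cauchy {s t : ℝ} (hs : s ≠ 0) (ht : t ≠ 0) (hst : t - s ≠ 0) :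
    Integrable (fun x : ℝ => 1 / ((1 + x ^ 2) * (1 + (x + s) ^ 2) * (1 + (x + t) ^ 2))) ∧
    ∫ x : ℝ, 1 / ((1 + x ^ 2) * (1 + (x + s) ^ 2) * (1 + (x + t) ^ 2)) =
      Real.pi * (24 + s ^ 2 + t ^ 2 + (t - s) ^ 2) /
        ((s ^ 2 + 4) * (t ^ 2 + 4) * ((t - s) ^ 2 + 4)) := by
  have hint : Integrable
      (fun x : ℝ => 1 / ((1 + x ^ 2) * (1 + (x + s) ^ 2) * (1 + (x + t) ^ 2))) := by
    refine integrable_inv_one_add_sq.mono' ?_ (Eventually.of_forall fun x => ?_)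
    · refine Continuous.aestronglyMeasurable ?_
      exact continuous_const.div (by fun_prop) fun x => by positivity
    · rw [Real.norm_of_nonneg (by positivity), one_div]
      refine inv_anti₀ (by positivity) ?_
      have h1 : 0 < 1 + x ^ 2 := by positivity
      have h2 : 1 ≤ (1 + (x + s) ^ 2) * (1 + (x + t) ^ 2) := by
        have := sq_nonneg (x + s)
        have := sq_nonneg (x + t)
        nlinarith [mul_nonneg (sq_nonneg (x + s)) (sq_nonneg (x + t))]
      nlinarith
  refine ⟨hint, ?_⟩
  set D := s * t * (t - s) * (s ^ 2 + 4) * (t ^ 2 + 4) * ((t - s) ^ 2 + 4) with hD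
  have hD0 : D ≠ 0 := by
    refine mul_ne_zero (mul_ne_zero (mul_ne_zero (mul_ne_zero (mul_ne_zero hs ht) hst) ?_) ?_) ?_ <;>
      positivity
  set a₀ := (t - s) * ((t - s) ^ 2 + 4) * (-(s + t)) with ha₀
  set a₁ := -t * (t ^ 2 + 4) * (-(t - 2 * s)) with ha₁
  set a₂ := s * (s ^ 2 + 4) * (-(s - 2 * t)) with ha₂
  set b₀ := (t - s) * ((t - s) ^ 2 + 4) * (s * t - 4) with hb₀
  set b₁ := -t * (t ^ 2 + 4) * (-s * (t - s) - 4) with hb₁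
  set b₂ := s * (s ^ 2 + 4) * (t * (t - s) - 4) with hb₂
  have hasum : a₀ + a₁ + a₂ = 0 := by rw [ha₀, ha₁, ha₂]; ring
  set H : ℝ → ℝ := fun x => D⁻¹ *
    ((a₀ * Real.log (1 + x ^ 2) + b₀ * Real.arctan x) +
      (a₁ * Real.log (1 + (x + s) ^ 2) + b₁ * Real.arctan (x + s)) +
      (a₂ * Real.log (1 + (x + t) ^ 2) + b₂ * Real.arctan (x + t))) with hH
  have hderiv : ∀ x, HasDerivAt H (1 / ((1 + x ^ 2) * (1 + (x + s) ^ 2) * (1 + (x + t) ^ 2))) x := by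
    intro x
    have hl : ∀ r : ℝ, HasDerivAt (fun x : ℝ => Real.log (1 + (x + r) ^ 2))
        (2 * (x + r) / (1 + (x + r) ^ 2)) x := by
      intro r
      have h1 : HasDerivAt (fun x : ℝ => 1 + (x + r) ^ 2) (2 * (x + r)) x := by
        simpa using (((hasDerivAt_id x).add_const r).pow 2).const_add 1
      exact h1.log (by positivity)
    have ha : ∀ r : ℝ, HasDerivAt (fun x : ℝ => Real.arctan (x + r)) (1 / (1 + (x + r) ^ 2)) x := by
      intro r
      simpa using ((hasDerivAt_id x).add_const r).arctan
    have hl0 := hl 0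
    have ha0 := ha 0
    simp only [add_zero] at hl0 ha0
    have := ((((hl0.const_mul a₀).add (ha0.const_mul b₀)).add
      (((hl s).const_mul a₁).add ((ha s).const_mul b₁))).add
      (((hl t).const_mul a₂).add ((ha t).const_mul b₂))).const_mul D⁻¹
    refine this.congr_deriv ?_
    rw [cauchy_partial_fractions hs ht hst]
    congr 1
    rw [ha₀, ha₁, ha₂, hb₀, hb₁, hb₂]
    ring
  have hlim : ∀ (l : Filter ℝ) (θ : ℝ), Tendsto (fun x : ℝ => x⁻¹) l (𝓝 0) → (∀ᶠ x in l, x ≠ 0) →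
      (∀ r : ℝ, Tendsto (fun x => Real.arctan (x + r)) l (𝓝 θ)) →
      Tendsto H l (𝓝 (D⁻¹ * ((a₀ * 0 + b₀ * θ) + (a₁ * 0 + b₁ * θ) + (a₂ * 0 + b₂ * θ)))) := by
    intro l θ hl hl0 hat
    have hlog : ∀ r : ℝ, Tendsto (fun x => Real.log ((1 + (x + r) ^ 2) / (1 + x ^ 2))) l (𝓝 0) := by
      intro r
      have := (tendsto_one_add_sq_div hl hl0 r).log one_ne_zero
      rwa [Real.log_one] at this
    have hat0 := hat 0
    simp only [add_zero] at hat0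
    have h0 : Tendsto (fun x : ℝ => Real.log ((1 + x ^ 2) / (1 + x ^ 2))) l (𝓝 0) := by
      simpa using hlog 0
    have := ((((h0.const_mul a₀).add (hat0.const_mul b₀)).add
      (((hlog s).const_mul a₁).add ((hat s).const_mul b₁))).add
      (((hlog t).const_mul a₂).add ((hat t).const_mul b₂))).const_mul D⁻¹
    -- Subtracting `log (1 + x²)` from every logarithm changes nothing, because the coefficients sum
    -- to zero, and makes each of them tend to zero.
    refine this.congr fun x => ?_
    rw [hH]
    simp only
    congr 1
    have p0 : 1 + x ^ 2 ≠ 0 := by positivity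
    rw [Real.log_div p0 p0, Real.log_div (by positivity) p0, Real.log_div (by positivity) p0]
    linear_combination -Real.log (1 + x ^ 2) * hasum
  have htop := hlim atTop (Real.pi / 2) tendsto_inv_atTop_zero (eventually_ne_atTop 0)
    fun r => (Real.tendsto_arctan_atTop.mono_right nhdsWithin_le_nhds).comp
      (tendsto_atTop_add_const_right _ r tendsto_id)
  have hbot := hlim atBot (-(Real.pi / 2)) tendsto_inv_atBot_zero (eventually_ne_atBot 0)
    fun r => (Real.tendsto_arctan_atBot.mono_right nhdsWithin_le_nhds).comp
      (tendsto_atBot_add_const_right _ r tendsto_id)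
  rw [integral_of_hasDerivAt_of_tendsto hderiv hint hbot htop]
  have hq : (s ^ 2 + 4) * (t ^ 2 + 4) * ((t - s) ^ 2 + 4) ≠ 0 := by positivity
  rw [eq_div_iff hq]
  have hbsum : b₀ + b₁ + b₂ = s * t * (t - s) * (24 + s ^ 2 + t ^ 2 + (t - s) ^ 2) := by
    rw [hb₀, hb₁, hb₂]; ring
  have hDinv : D⁻¹ * ((s * t * (t - s)) * ((s ^ 2 + 4) * (t ^ 2 + 4) * ((t - s) ^ 2 + 4))) = 1 := by
    rw [show (s * t * (t - s)) * ((s ^ 2 + 4) * (t ^ 2 + 4) * ((t - s) ^ 2 + 4)) = D by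
      rw [hD]; ring, inv_mul_cancel₀ hD0]
  linear_combination Real.pi * D⁻¹ * ((s ^ 2 + 4) * (t ^ 2 + 4) * ((t - s) ^ 2 + 4)) * hbsum +
    Real.pi * (24 + s ^ 2 + t ^ 2 + (t - s) ^ 2) * hDinv

theorem lintegral_three_cauchy {s t : ℝ} (hs : s ≠ 0) (ht : t ≠ 0) (hst : t - s ≠ 0) :
    ∫⁻ x, cauchyWeight x * (cauchyWeight (x + s) * cauchyWeight (x + t)) =
      ENNReal.ofReal ((Real.pi ^ 2)⁻¹ * ((24 + s ^ 2 + t ^ 2 + (t - s) ^ 2) /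
        ((s ^ 2 + 4) * (t ^ 2 + 4) * ((t - s) ^ 2 + 4)))) := by
  obtain ⟨hint, hval⟩ := integral_three_cauchy hs ht hst
  have hp := Real.pi_pos
  have h1 : ∀ x : ℝ, cauchyWeight x * (cauchyWeight (x + s) * cauchyWeight (x + t)) =
      ENNReal.ofReal ((Real.pi ^ 3)⁻¹ *
        (1 / ((1 + x ^ 2) * (1 + (x + s) ^ 2) * (1 + (x + t) ^ 2)))) := by
    intro x
    rw [cauchyWeight, cauchyWeight, cauchyWeight, ← ENNReal.ofReal_mul (by positivity),
      ← ENNReal.ofReal_mul (by positivity)]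
    congr 1
    field_simp
  simp only [h1]
  rw [← ofReal_integral_eq_lintegral_ofReal (hint.const_mul _)
    (Eventually.of_forall fun x => by positivity), integral_const_mul, hval]
  congr 1
  field_simp

/-- The density of the cross ratio of four uniform random points of the circle. -/
noncomputable def crossDensity (l : ℝ) : ℝ :=
  (Real.pi ^ 2)⁻¹ * (Real.log l / (l - 1) - Real.log (1 - l) / l)

/-- Partial fractions in `v²` give an antiderivative made of `log (r² v² + 4)` for `r = 1, l, l -
1`. Again the coefficients sum to zero: the divergent `log v²` cancels at infinity, and so does `log
4` at the origin. -/
theorem integral_radial {l : ℝ} (h0 : l ≠ 0) (h1 : l ≠ 1) :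
    IntegrableOn (fun v : ℝ => v * ((24 + v ^ 2 + (l * v) ^ 2 + (l * v - v) ^ 2) /
      ((v ^ 2 + 4) * ((l * v) ^ 2 + 4) * ((l * v - v) ^ 2 + 4)))) (Set.Ioi 0) ∧
    ∫ v in Set.Ioi (0 : ℝ), v * ((24 + v ^ 2 + (l * v) ^ 2 + (l * v - v) ^ 2) /
      ((v ^ 2 + 4) * ((l * v) ^ 2 + 4) * ((l * v - v) ^ 2 + 4))) =
      (Real.log l / (l - 1) - Real.log (1 - l) / l) / 2 := by
  have h1' : l - 1 ≠ 0 := sub_ne_zero.2 h1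
  set G : ℝ → ℝ := fun v => (1 / (2 * l * (1 - l)) * Real.log (1 ^ 2 * v ^ 2 + 4) +
    1 / (2 * (l - 1)) * Real.log (l ^ 2 * v ^ 2 + 4) -
    1 / (2 * l) * Real.log ((l - 1) ^ 2 * v ^ 2 + 4)) / 2 with hG
  have h1'' : 1 - l ≠ 0 := by rw [← neg_sub]; exact neg_ne_zero.2 h1'
  have hsum : 1 / (2 * l * (1 - l)) + 1 / (2 * (l - 1)) - 1 / (2 * l) = 0 := by
    rw [show l - 1 = -(1 - l) by ring]
    field_simp
    ring
  have hderiv : ∀ v ∈ Set.Ici (0 : ℝ), HasDerivAt G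
      (v * ((24 + v ^ 2 + (l * v) ^ 2 + (l * v - v) ^ 2) /
      ((v ^ 2 + 4) * ((l * v) ^ 2 + 4) * ((l * v - v) ^ 2 + 4)))) v := by
    intro v _
    have hl : ∀ r : ℝ, HasDerivAt (fun v : ℝ => Real.log (r ^ 2 * v ^ 2 + 4))
        (r ^ 2 * (2 * v) / (r ^ 2 * v ^ 2 + 4)) v := by
      intro r
      have h1 : HasDerivAt (fun v : ℝ => r ^ 2 * v ^ 2 + 4) (r ^ 2 * (2 * v)) v := by
        simpa using (((hasDerivAt_id v).pow 2).const_mul (r ^ 2)).add_const 4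
      exact h1.log (by positivity)
    have := ((((hl 1).const_mul (1 / (2 * l * (1 - l)))).add
      ((hl l).const_mul (1 / (2 * (l - 1))))).sub
      ((hl (l - 1)).const_mul (1 / (2 * l)))).div_const 2
    refine this.congr_deriv ?_
    have p0 : v ^ 2 + 4 ≠ 0 := by positivity
    have p1 : l ^ 2 * v ^ 2 + 4 ≠ 0 := by positivity
    have p2 : (l - 1) ^ 2 * v ^ 2 + 4 ≠ 0 := by positivity
    rw [show (l * v) ^ 2 = l ^ 2 * v ^ 2 by ring,
      show (l * v - v) ^ 2 = (l - 1) ^ 2 * v ^ 2 by ring,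
      show (1 : ℝ) ^ 2 * v ^ 2 = v ^ 2 by ring,
      show 1 / (2 * (l - 1)) = -(1 / (2 * (1 - l))) by
        rw [show l - 1 = -(1 - l) by ring]; field_simp]
    field_simp
    ring
  have hlim : Tendsto G atTop (𝓝 ((1 / (2 * l * (1 - l)) * Real.log (1 ^ 2) +
    1 / (2 * (l - 1)) * Real.log (l ^ 2) - 1 / (2 * l) * Real.log ((l - 1) ^ 2)) / 2)) := by
    have hr : ∀ r : ℝ, r ≠ 0 →
        Tendsto (fun v : ℝ => Real.log (r ^ 2 + 4 * v⁻¹ ^ 2)) atTop (𝓝 (Real.log (r ^ 2))) := by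
      intro r hr
      have h := ((tendsto_inv_atTop_zero (𝕜 := ℝ)).pow 2).const_mul 4 |>.const_add (r ^ 2)
      rw [zero_pow two_ne_zero, mul_zero, add_zero] at h
      exact h.log (by positivity)
    have := ((((hr 1 one_ne_zero).const_mul (1 / (2 * l * (1 - l)))).add
      ((hr l h0).const_mul (1 / (2 * (l - 1))))).sub
      ((hr (l - 1) h1').const_mul (1 / (2 * l)))).div_const 2
    refine this.congr' ?_
    filter_upwards [eventually_gt_atTop 0] with v hv
    have e : ∀ r : ℝ, r ≠ 0 → Real.log (r ^ 2 + 4 * v⁻¹ ^ 2) =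
        Real.log (r ^ 2 * v ^ 2 + 4) - Real.log (v ^ 2) := by
      intro r hr
      rw [← Real.log_div (by positivity) (by positivity)]
      congr 1
      field_simp
    rw [hG, e 1 one_ne_zero, e l h0, e (l - 1) h1']
    simp only
    linear_combination -Real.log (v ^ 2) / 2 * hsum
  have hpos : ∀ v ∈ Set.Ioi (0 : ℝ), 0 ≤ v * ((24 + v ^ 2 + (l * v) ^ 2 + (l * v - v) ^ 2) /
      ((v ^ 2 + 4) * ((l * v) ^ 2 + 4) * ((l * v - v) ^ 2 + 4))) := by
    intro v hv
    have : (0 : ℝ) < v := hv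
    positivity
  refine ⟨integrableOn_Ioi_deriv_of_nonneg' hderiv hpos hlim, ?_⟩
  rw [integral_Ioi_of_hasDerivAt_of_nonneg' hderiv hpos hlim]
  have hG0 : G 0 = 0 := by
    simp only [hG, zero_pow two_ne_zero, mul_zero, zero_add]
    linear_combination Real.log 4 / 2 * hsum
  rw [hG0, one_pow, Real.log_one, Real.log_pow, Real.log_pow, ← Real.log_neg_eq_log (l - 1), neg_sub]
  push_cast
  field_simp
  ring

/-- After the integration over `x` the integrand is even in `v`, so the line contributes twice the
half-line integral. -/
theorem lintegral_radial {l : ℝ} (h0 : l ≠ 0) (h1 : l ≠ 1) :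
    ∫⁻ v : ℝ, ENNReal.ofReal |v| *
      ∫⁻ x, cauchyWeight x * (cauchyWeight (x + v) * cauchyWeight (x + l * v)) =
      ENNReal.ofReal (crossDensity l) := by
  set F : ℝ → ℝ := fun v => |v| * ((Real.pi ^ 2)⁻¹ * ((24 + v ^ 2 + (l * v) ^ 2 + (l * v - v) ^ 2) /
      ((v ^ 2 + 4) * ((l * v) ^ 2 + 4) * ((l * v - v) ^ 2 + 4)))) with hF
  have hpt : ∀ v : ℝ, v ≠ 0 → ENNReal.ofReal |v| *
      ∫⁻ x, cauchyWeight x * (cauchyWeight (x + v) * cauchyWeight (x + l * v)) =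
      ENNReal.ofReal (F v) := by
    intro v hv
    rw [lintegral_three_cauchy hv (mul_ne_zero h0 hv)
      (by rw [show l * v - v = (l - 1) * v by ring]; exact mul_ne_zero (sub_ne_zero.2 h1) hv),
      ← ENNReal.ofReal_mul (abs_nonneg v)]
  have hae : ∀ᵐ v : ℝ, v ≠ 0 := by
    simp [ae_iff]
  rw [lintegral_congr_ae (hae.mono hpt)]
  have heven : ∀ v, F (-v) = F v := by
    intro v
    simp only [hF, abs_neg]
    congr 3 <;> ring
  have hhalf : ∫⁻ v in Set.Iio 0, ENNReal.ofReal (F v) = ∫⁻ v in Set.Ioi 0, ENNReal.ofReal (F v) := by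
    have := (Measure.measurePreserving_neg (volume : Measure ℝ)).setLIntegral_comp_emb
      (MeasurableEquiv.neg ℝ).measurableEmbedding (fun v => ENNReal.ofReal (F v)) (Set.Iio 0)
    simp only [heven] at this
    refine this.trans ?_
    congr 2
    ext v; simp
  have hpos : ∫⁻ v in Set.Ioi 0, ENNReal.ofReal (F v) = ENNReal.ofReal (crossDensity l / 2) := by
    obtain ⟨hint, hval⟩ := integral_radial h0 h1
    have hcongr : ∀ v ∈ Set.Ioi (0 : ℝ), ENNReal.ofReal (F v) = ENNReal.ofReal ((Real.pi ^ 2)⁻¹ *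
        (v * ((24 + v ^ 2 + (l * v) ^ 2 + (l * v - v) ^ 2) /
      ((v ^ 2 + 4) * ((l * v) ^ 2 + 4) * ((l * v - v) ^ 2 + 4))))) := by
      intro v hv
      have hv' : (0 : ℝ) < v := hv
      simp only [hF, abs_of_pos hv']
      congr 1; ring
    rw [setLIntegral_congr_fun measurableSet_Ioi hcongr,
      ← ofReal_integral_eq_lintegral_ofReal (hint.const_mul _), integral_const_mul, hval, crossDensity]
    · congr 1; ring
    · refine (ae_restrict_mem measurableSet_Ioi).mono fun v hv => ?_
      have hv' : (0 : ℝ) < v := hv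
      simp only [Pi.zero_apply]
      positivity
  have hsplit : ∫⁻ v, ENNReal.ofReal (F v) =
      (∫⁻ v in Set.Iio 0, ENNReal.ofReal (F v)) + ∫⁻ v in Set.Ioi 0, ENNReal.ofReal (F v) := by
    rw [← lintegral_add_compl _ (measurableSet_Iio (a := (0 : ℝ))), Set.compl_Iio,
      Measure.restrict_congr_set Ioi_ae_eq_Ici.symm]
  rw [hsplit, hhalf, hpos, ← two_mul, ← ENNReal.ofReal_ofNat 2, ← ENNReal.ofReal_mul zero_le_two,
    mul_div_cancel₀ _ two_ne_zero]

/-- The law of the modulus in terms of the density of the cross ratio. -/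
theorem lintegral_three_cauchy_eq {Φ : ℝ → ℝ≥0∞} (hΦ : Measurable Φ) :
    ∫⁻ x, ∫⁻ y, ∫⁻ z, cauchyWeight x * (cauchyWeight y * (cauchyWeight z *
      Φ (minMaxRatio |y - z| |x - z| |x - y|))) =
    ∫⁻ l, Φ (minMaxRatio |1 - l| |l| 1) * ENNReal.ofReal (crossDensity l) := by
  -- The integrand after `y = x + v` and `z = x + l v`, with Jacobian `|v|`. By scaling and
  -- translation invariance the ratio depends on `l` only, so Tonelli can leave `l` as the outermost
  -- variable.
  set W : ℝ → ℝ → ℝ → ℝ≥0∞ := fun l v x =>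
    Φ (minMaxRatio |1 - l| |l| 1) * (ENNReal.ofReal |v| *
      (cauchyWeight x * (cauchyWeight (x + v) * cauchyWeight (x + l * v)))) with hW
  have hmW : Measurable fun p : ℝ × ℝ × ℝ => W p.1 p.2.1 p.2.2 := by
    have h1 := measurable_cauchyWeight
    have h2 : Measurable fun p : ℝ × ℝ × ℝ => Φ (minMaxRatio |1 - p.1| |p.1| 1) := by
      refine hΦ.comp (measurable_minMaxRatio_fun ?_ ?_ measurable_const) <;>
        simp only [← Real.norm_eq_abs] <;> fun_prop
    have h3 : Measurable fun p : ℝ × ℝ × ℝ => ENNReal.ofReal |p.2.1| := by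
      simp only [← Real.norm_eq_abs]; fun_prop
    have h4 : Measurable fun p : ℝ × ℝ × ℝ => cauchyWeight p.2.2 := h1.comp (by fun_prop)
    have h5 : Measurable fun p : ℝ × ℝ × ℝ => cauchyWeight (p.2.2 + p.2.1) := h1.comp (by fun_prop)
    have h6 : Measurable fun p : ℝ × ℝ × ℝ => cauchyWeight (p.2.2 + p.1 * p.2.1) :=
      h1.comp (by fun_prop)
    exact h2.mul (h3.mul (h4.mul (h5.mul h6)))
  have step1 : ∀ x v : ℝ, v ≠ 0 → ∫⁻ z, cauchyWeight x * (cauchyWeight (x + v) * (cauchyWeight z *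
      Φ (minMaxRatio |x + v - z| |x - z| |x - (x + v)|))) = ∫⁻ l, W l v x := by
    intro x v hv
    have himg : (fun l : ℝ => x + l * v) '' Set.univ = Set.univ := by
      rw [Set.image_univ, Set.range_eq_univ]
      intro z
      exact ⟨(z - x) / v, by field_simp; ring⟩
    have hder : ∀ l ∈ Set.univ, HasDerivWithinAt (fun l : ℝ => x + l * v) v Set.univ l := fun l _ =>
      ((hasDerivAt_mul_const v).const_add x).hasDerivWithinAt
    have hinj : Set.InjOn (fun l : ℝ => x + l * v) Set.univ := by
      intro a _ b _ h
      exact mul_right_cancel₀ hv (add_left_cancel h)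
    have h := lintegral_image_eq_lintegral_abs_deriv_mul MeasurableSet.univ hder hinj
      (fun z => cauchyWeight x * (cauchyWeight (x + v) * (cauchyWeight z *
        Φ (minMaxRatio |x + v - z| |x - z| |x - (x + v)|))))
    rw [himg, Measure.restrict_univ] at h
    rw [h]
    refine lintegral_congr fun l => ?_
    have e : minMaxRatio |x + v - (x + l * v)| |x - (x + l * v)| |x - (x + v)| =
        minMaxRatio |1 - l| |l| 1 := by
      rw [← minMaxRatio_mul (abs_pos.2 hv) |1 - l|, ← abs_mul, ← abs_mul, mul_one,
        show x + v - (x + l * v) = v * (1 - l) by ring, show x - (x + l * v) = -(v * l) by ring,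
        show x - (x + v) = -v by ring, abs_neg, abs_neg]
    rw [e, hW]
    ring
  calc _ = ∫⁻ x, ∫⁻ v, ∫⁻ l, W l v x := by
        refine lintegral_congr fun x => ?_
        rw [← lintegral_add_left_eq_self _ x]
        have hae : ∀ᵐ v : ℝ, v ≠ 0 := by simp [ae_iff]
        exact lintegral_congr_ae (hae.mono fun v hv => step1 x v hv)
    _ = ∫⁻ v, ∫⁻ x, ∫⁻ l, W l v x := by
        refine lintegral_lintegral_swap (Measurable.aemeasurable ?_)
        refine Measurable.lintegral_prod_right' (f := fun p : (ℝ × ℝ) × ℝ => W p.2 p.1.2 p.1.1) ?_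
        exact hmW.comp (f := fun p : (ℝ × ℝ) × ℝ => (p.2, p.1.2, p.1.1)) (by fun_prop)
    _ = ∫⁻ v, ∫⁻ l, ∫⁻ x, W l v x := by
        refine lintegral_congr fun v => lintegral_lintegral_swap (Measurable.aemeasurable ?_)
        exact hmW.comp (f := fun p : ℝ × ℝ => (p.2, v, p.1)) (by fun_prop)
    _ = ∫⁻ l, ∫⁻ v, ∫⁻ x, W l v x := by
        refine lintegral_lintegral_swap (Measurable.aemeasurable ?_)
        refine Measurable.lintegral_prod_right' (f := fun p : (ℝ × ℝ) × ℝ => W p.1.2 p.1.1 p.2) ?_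
        exact hmW.comp (f := fun p : (ℝ × ℝ) × ℝ => (p.1.2, p.1.1, p.2)) (by fun_prop)
    _ = ∫⁻ l, Φ (minMaxRatio |1 - l| |l| 1) * ENNReal.ofReal (crossDensity l) := by
        have h0 : ∀ᵐ l : ℝ, l ≠ 0 := by simp [ae_iff]
        have h1 : ∀ᵐ l : ℝ, l ≠ 1 := by simp [ae_iff]
        refine lintegral_congr_ae ?_
        filter_upwards [h0, h1] with l hl0 hl1
        rw [← lintegral_radial hl0 hl1]
        have hmc := measurable_cauchyWeight
        have hin : ∀ v : ℝ, Measurable fun x => cauchyWeight x * (cauchyWeight (x + v) *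
            cauchyWeight (x + l * v)) := fun v =>
          hmc.mul ((hmc.comp (by fun_prop)).mul (hmc.comp (by fun_prop)))
        have hin2 : Measurable fun v : ℝ => ∫⁻ x, cauchyWeight x * (cauchyWeight (x + v) *
            cauchyWeight (x + l * v)) := by
          refine Measurable.lintegral_prod_right' (f := fun p : ℝ × ℝ =>
            cauchyWeight p.2 * (cauchyWeight (p.2 + p.1) * cauchyWeight (p.2 + l * p.1))) ?_
          exact (hmc.comp (by fun_prop)).mul ((hmc.comp (by fun_prop)).mul (hmc.comp (by fun_prop)))
        have habs : Measurable fun v : ℝ => ENNReal.ofReal |v| := by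
          simp only [← Real.norm_eq_abs]; fun_prop
        have hout := lintegral_const_mul (μ := volume) (Φ (minMaxRatio |1 - l| |l| 1)) (habs.mul hin2)
        simp only [Pi.mul_apply] at hout
        rw [← hout]
        refine lintegral_congr fun v => ?_
        rw [← lintegral_const_mul _ (hin v), ← lintegral_const_mul _ ((hin v).const_mul _)]

end RandomTorus

/-! ### Anharmonic symmetry and the substitution `u = tanh² (x / 2)`. -/

namespace RandomTorus

open scoped ENNReal
open Filter Topology

/-- With `crossDensity_inv`, this is invariance under `u ↦ 1 - u` and `u ↦ 1/u`, which generate the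
six substitutions coming from reordering the points. -/
theorem crossDensity_one_sub (u : ℝ) : crossDensity (1 - u) = crossDensity u := by
  rw [crossDensity, crossDensity, sub_sub_cancel, show 1 - u - 1 = -u by ring,
    show u - 1 = -(1 - u) by ring, div_neg, div_neg]
  ring

theorem crossDensity_nonneg {u : ℝ} (hu : u ∈ Set.Ioo (0 : ℝ) 1) : 0 ≤ crossDensity u := by
  have h1 : Real.log u ≤ 0 := Real.log_nonpos hu.1.le hu.2.le
  have h2 : Real.log (1 - u) ≤ 0 := Real.log_nonpos (by linarith [hu.2]) (by linarith [hu.1])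
  have h3 : 0 ≤ Real.log u / (u - 1) := div_nonneg_of_nonpos h1 (by linarith [hu.2])
  have h4 : Real.log (1 - u) / u ≤ 0 := div_nonpos_of_nonpos_of_nonneg h2 hu.1.le
  rw [crossDensity]
  exact mul_nonneg (by positivity) (by linarith)

theorem crossDensity_inv {u : ℝ} (hu : u ∈ Set.Ioo (0 : ℝ) 1) :
    (u ^ 2)⁻¹ * crossDensity u⁻¹ = crossDensity u := by
  obtain ⟨h0, h1⟩ := hu
  -- Here `1 - u⁻¹` is negative; since `Real.log` is the logarithm of the absolute value, the single
  -- formula for the density holds on the whole line.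
  have hl : Real.log (1 - u⁻¹) = Real.log (1 - u) - Real.log u := by
    rw [← Real.log_div (by linarith) h0.ne', ← Real.log_neg_eq_log]
    congr 1
    field_simp
    ring
  have h1' : 1 - u ≠ 0 := by linarith
  rw [crossDensity, crossDensity, hl, Real.log_inv, show u⁻¹ - 1 = (1 - u) / u by field_simp,
    show u - 1 = -(1 - u) by ring]
  field_simp
  ring

theorem minMaxRatio_Ioo {u : ℝ} (hu : u ∈ Set.Ioo (0 : ℝ) 1) :
    minMaxRatio (1 - u) u 1 = min u (1 - u) := by
  obtain ⟨h0, h1⟩ := hu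
  rw [minMaxRatio_swap₂₃]
  have h := minMaxRatio_add (a := 1 - u) (c := u) (by linarith) h0.le
  rw [sub_add_cancel, div_one, min_comm] at h
  exact h

theorem lintegral_Ioi_crossDensity (Φ : ℝ → ℝ≥0∞) :
    ∫⁻ l in Set.Ioi 1, Φ (minMaxRatio |1 - l| |l| 1) * ENNReal.ofReal (crossDensity l) =
      ∫⁻ u in Set.Ioo 0 1, Φ (min u (1 - u)) * ENNReal.ofReal (crossDensity u) := by
  have himg : (fun u : ℝ => u⁻¹) '' Set.Ioo 0 1 = Set.Ioi 1 := by
    ext x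
    simp only [Set.mem_image, Set.mem_Ioo, Set.mem_Ioi]
    constructor
    · rintro ⟨u, ⟨h0, h1⟩, rfl⟩
      exact (one_lt_inv₀ h0).2 h1
    · intro hx
      exact ⟨x⁻¹, ⟨by positivity, inv_lt_one_of_one_lt₀ hx⟩, inv_inv x⟩
  rw [← himg, lintegral_image_eq_lintegral_abs_deriv_mul measurableSet_Ioo
    (fun u hu => (hasDerivAt_inv hu.1.ne').hasDerivWithinAt) inv_injective.injOn]
  refine setLIntegral_congr_fun measurableSet_Ioo fun u hu => ?_
  obtain ⟨h0, h1⟩ := hu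
  have e : minMaxRatio |1 - u⁻¹| |u⁻¹| 1 = min u (1 - u) := by
    rw [← minMaxRatio_mul h0, abs_of_neg (sub_neg.2 ((one_lt_inv₀ h0).2 h1)),
      abs_of_pos (inv_pos.2 h0), mul_inv_cancel₀ h0.ne', mul_neg, mul_sub, mul_inv_cancel₀ h0.ne',
      mul_one, neg_sub, minMaxRatio_swap₂₃, minMaxRatio_Ioo ⟨h0, h1⟩]
  rw [e, abs_neg, abs_of_nonneg (by positivity), mul_left_comm,
    ← ENNReal.ofReal_mul (by positivity), crossDensity_inv ⟨h0, h1⟩]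

theorem lintegral_Iio_crossDensity (Φ : ℝ → ℝ≥0∞) :
    ∫⁻ l in Set.Iio 0, Φ (minMaxRatio |1 - l| |l| 1) * ENNReal.ofReal (crossDensity l) =
      ∫⁻ u in Set.Ioo 0 1, Φ (min u (1 - u)) * ENNReal.ofReal (crossDensity u) := by
  rw [← lintegral_Ioi_crossDensity]
  have himg : (fun u : ℝ => 1 - u) '' Set.Ioi 1 = Set.Iio 0 := by
    rw [Set.image_const_sub_Ioi, sub_self]
  rw [← himg, lintegral_image_eq_lintegral_abs_deriv_mul measurableSet_Ioi
    (fun u _ => ((hasDerivAt_id' u).const_sub 1).hasDerivWithinAt) sub_right_injective.injOn]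
  refine setLIntegral_congr_fun measurableSet_Ioi fun u _ => ?_
  rw [sub_sub_cancel, minMaxRatio_swap₁₂, crossDensity_one_sub, abs_neg, abs_one, ENNReal.ofReal_one,
    one_mul]

theorem lintegral_Ioo_crossDensity (Φ : ℝ → ℝ≥0∞) :
    ∫⁻ l in Set.Ioo 0 1, Φ (minMaxRatio |1 - l| |l| 1) * ENNReal.ofReal (crossDensity l) =
      ∫⁻ u in Set.Ioo 0 1, Φ (min u (1 - u)) * ENNReal.ofReal (crossDensity u) := by
  refine setLIntegral_congr_fun measurableSet_Ioo fun u hu => ?_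
  rw [abs_of_pos hu.1, abs_of_pos (sub_pos.2 hu.2), minMaxRatio_Ioo hu]

theorem lintegral_min_crossDensity (Φ : ℝ → ℝ≥0∞) :
    ∫⁻ u in Set.Ioo 0 1, Φ (min u (1 - u)) * ENNReal.ofReal (crossDensity u) =
      2 * ∫⁻ u in Set.Ioo 0 (1 / 2), Φ u * ENNReal.ofReal (crossDensity u) := by
  have hsplit : (Set.Ioo 0 1 : Set ℝ) =ᵐ[volume] (Set.Ioo 0 (1 / 2) ∪ Set.Ioo (1 / 2) 1 : Set ℝ) := by
    have h : (Set.Ioo 0 1 : Set ℝ) = Set.Ioo 0 (1 / 2) ∪ Set.Ico (1 / 2) 1 :=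
      (Set.Ioo_union_Ico_eq_Ioo (by norm_num) (by norm_num)).symm
    rw [h]
    exact (ae_eq_refl _).union Ioo_ae_eq_Ico.symm
  have hdisj : Disjoint (Set.Ioo 0 (1 / 2) : Set ℝ) (Set.Ioo (1 / 2) 1) := by
    rw [Set.disjoint_left]
    intro x hx hx'
    exact lt_asymm hx.2 hx'.1
  have himg : (fun u : ℝ => 1 - u) '' Set.Ioo 0 (1 / 2) = Set.Ioo (1 / 2) 1 := by
    rw [Set.image_const_sub_Ioo]; norm_num
  rw [setLIntegral_congr hsplit, lintegral_union measurableSet_Ioo hdisj, two_mul]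
  congr 1
  · refine setLIntegral_congr_fun measurableSet_Ioo fun u hu => ?_
    rw [min_eq_left (by linarith [hu.2])]
  · rw [← himg, lintegral_image_eq_lintegral_abs_deriv_mul measurableSet_Ioo
      (fun u _ => ((hasDerivAt_id' u).const_sub 1).hasDerivWithinAt) sub_right_injective.injOn]
    refine setLIntegral_congr_fun measurableSet_Ioo fun u hu => ?_
    rw [sub_sub_cancel, min_eq_right (by linarith [hu.2]), crossDensity_one_sub, abs_neg, abs_one,
      ENNReal.ofReal_one, one_mul]

/-- The points `0` and `1` cut the line into three intervals, each carried onto `(0, 1)` by an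
anharmonic substitution, and folding at `1/2` doubles each of them. -/
theorem lintegral_minMaxRatio_crossDensity (Φ : ℝ → ℝ≥0∞) :
    ∫⁻ l, Φ (minMaxRatio |1 - l| |l| 1) * ENNReal.ofReal (crossDensity l) =
      6 * ∫⁻ u in Set.Ioo 0 (1 / 2), Φ u * ENNReal.ofReal (crossDensity u) := by
  rw [← lintegral_add_compl _ (measurableSet_Iio (a := (0 : ℝ))), Set.compl_Iio,
    Measure.restrict_congr_set Ioi_ae_eq_Ici.symm, ← Set.Ioc_union_Ioi_eq_Ioi zero_le_one,
    lintegral_union measurableSet_Ioi (Set.Ioc_disjoint_Ioi le_rfl),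
    Measure.restrict_congr_set Ioo_ae_eq_Ioc.symm, lintegral_Iio_crossDensity,
    lintegral_Ioo_crossDensity, lintegral_Ioi_crossDensity, lintegral_min_crossDensity]
  ring

theorem lengthOfModulus_half : lengthOfModulus (1 / 2) = maxLength := by
  have h2 : (0 : ℝ) < √2 := by positivity
  have h2' : (1 : ℝ) < √2 := Real.lt_sqrt_of_sq_lt (by norm_num)
  have hs : √(1 / 2 : ℝ) = 1 / √2 := by rw [Real.sqrt_div zero_le_one, Real.sqrt_one]
  have hle : 1 / √2 ≤ 1 := (div_le_one h2).2 h2'.le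
  rw [lengthOfModulus, hs, Real.artanh_eq_half_log ⟨by linarith [div_pos one_pos h2], hle⟩, maxLength,
    ← mul_assoc, mul_one_div_cancel two_ne_zero, one_mul]
  congr 1
  rw [div_eq_div_iff (by rw [sub_ne_zero]; exact ((div_lt_one h2).2 h2').ne') (by linarith)]
  field_simp

theorem tanh_lengthOfModulus {u : ℝ} (h0 : 0 ≤ u) (h1 : u < 1) :
    Real.tanh (lengthOfModulus u / 2) ^ 2 = u := by
  have hs : √u < 1 := (Real.sqrt_lt' one_pos).2 (by simpa using h1)
  rw [lengthOfModulus, mul_div_cancel_left₀ _ two_ne_zero,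
    Real.tanh_artanh ⟨by linarith [Real.sqrt_nonneg u], hs⟩, Real.sq_sqrt h0]

theorem lengthOfModulus_tanh {x : ℝ} (hx : 0 ≤ x) :
    lengthOfModulus (Real.tanh (x / 2) ^ 2) = x := by
  have h : 0 ≤ Real.tanh (x / 2) := by
    rw [Real.tanh_eq_sinh_div_cosh]
    exact div_nonneg (Real.sinh_nonneg_iff.2 (by linarith)) (Real.cosh_pos _).le
  rw [lengthOfModulus, Real.sqrt_sq h, Real.artanh_tanh]
  ring

theorem lengthOfModulus_lt {u v : ℝ} (h0 : 0 ≤ u) (huv : u < v) (h1 : v < 1) :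
    lengthOfModulus u < lengthOfModulus v := by
  have hs : √v < 1 := (Real.sqrt_lt' one_pos).2 (by simpa using h1)
  have := Real.artanh_lt_artanh (x := √u) (y := √v) (by linarith [Real.sqrt_nonneg u]) hs
    (Real.sqrt_lt_sqrt h0 huv)
  rw [lengthOfModulus, lengthOfModulus]
  linarith

theorem lengthOfModulus_zero : lengthOfModulus 0 = 0 := by
  rw [lengthOfModulus, Real.sqrt_zero, Real.artanh_zero, mul_zero]

theorem maxLength_pos : 0 < maxLength := by
  rw [← lengthOfModulus_half, ← lengthOfModulus_zero]
  exact lengthOfModulus_lt le_rfl (by norm_num) (by norm_num)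

theorem tanh_sq_strictMonoOn : StrictMonoOn (fun x : ℝ => Real.tanh (x / 2) ^ 2) (Set.Ici 0) := by
  intro x hx y hy hxy
  by_contra! h
  rcases h.lt_or_eq with h | h
  · have := lengthOfModulus_lt (sq_nonneg _) h (Real.tanh_sq_lt_one _)
    rw [lengthOfModulus_tanh hx, lengthOfModulus_tanh hy] at this
    linarith
  · have := congrArg lengthOfModulus h
    rw [lengthOfModulus_tanh hx, lengthOfModulus_tanh hy] at this
    linarith

theorem image_tanh_sq {a : ℝ} (ha : 0 ≤ a) : (fun x : ℝ => Real.tanh (x / 2) ^ 2) '' Set.Ioo 0 a =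
    Set.Ioo 0 (Real.tanh (a / 2) ^ 2) := by
  ext u
  constructor
  · rintro ⟨x, ⟨h0, h1⟩, rfl⟩
    refine ⟨?_, tanh_sq_strictMonoOn h0.le ha h1⟩
    simpa using tanh_sq_strictMonoOn (Set.mem_Ici.2 le_rfl) h0.le h0
  · rintro ⟨h0, h1⟩
    have h1' : u < 1 := h1.trans (Real.tanh_sq_lt_one _)
    refine ⟨lengthOfModulus u, ⟨?_, ?_⟩, tanh_lengthOfModulus h0.le h1'⟩
    · rw [← lengthOfModulus_zero]
      exact lengthOfModulus_lt le_rfl h0 h1'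
    · have := lengthOfModulus_lt h0.le h1 (Real.tanh_sq_lt_one _)
      rwa [lengthOfModulus_tanh ha] at this

theorem tanh_maxLength : Real.tanh (maxLength / 2) ^ 2 = 1 / 2 := by
  rw [← lengthOfModulus_half, tanh_lengthOfModulus (by norm_num) (by norm_num)]

theorem hasDerivAt_tanh_half (x : ℝ) : HasDerivAt (fun x : ℝ => Real.tanh (x / 2))
    (1 / (2 * Real.cosh (x / 2) ^ 2)) x := by
  have hc := (Real.cosh_pos (x / 2)).ne'
  have hd : HasDerivAt (fun x : ℝ => x / 2) (1 / 2) x := (hasDerivAt_id x).div_const 2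
  have h := hd.sinh.div hd.cosh hc
  simp only [Real.tanh_eq_sinh_div_cosh]
  refine h.congr_deriv ?_
  have := Real.cosh_sq (x / 2)
  field_simp
  linarith

theorem hasDerivAt_tanh_sq (x : ℝ) : HasDerivAt (fun x : ℝ => Real.tanh (x / 2) ^ 2)
    (Real.sinh (x / 2) / Real.cosh (x / 2) ^ 3) x := by
  have hc := (Real.cosh_pos (x / 2)).ne'
  refine ((hasDerivAt_tanh_half x).pow 2).congr_deriv ?_
  rw [Real.tanh_eq_sinh_div_cosh]
  norm_num
  field_simp

/-- The factor `sinh / cosh³` is the derivative of `tanh² (x / 2)`, and `1 - tanh² = cosh⁻²`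
simplifies the logarithms. -/
theorem lengthFormula_eq_crossDensity {x : ℝ} (hx : 0 < x) : lengthFormula x =
    6 * (Real.sinh (x / 2) / Real.cosh (x / 2) ^ 3 * crossDensity (Real.tanh (x / 2) ^ 2)) := by
  have hc := (Real.cosh_pos (x / 2)).ne'
  have hs := (Real.sinh_pos_iff.2 (half_pos hx)).ne'
  have hcs := Real.cosh_sq (x / 2)
  have e1 : Real.sinh x = 2 * Real.sinh (x / 2) * Real.cosh (x / 2) := by
    rw [← Real.sinh_two_mul, mul_div_cancel₀ _ two_ne_zero]
  have e2 : Real.cosh x - 1 = 2 * Real.sinh (x / 2) ^ 2 := by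
    have := Real.cosh_two_mul (x / 2)
    rw [mul_div_cancel₀ _ two_ne_zero] at this
    linarith
  have e3 : 1 - Real.tanh (x / 2) ^ 2 = (Real.cosh (x / 2) ^ 2)⁻¹ := by
    rw [Real.tanh_eq_sinh_div_cosh]
    field_simp
    linarith
  have e4 : Real.tanh (x / 2) ^ 2 - 1 = -(Real.cosh (x / 2) ^ 2)⁻¹ := by rw [← e3]; ring
  rw [lengthFormula, crossDensity, e3, e4, Real.log_inv, Real.log_pow, Real.log_pow,
    Real.tanh_eq_sinh_div_cosh, Real.log_div hs hc, Real.log_div hc hs, e1, e2]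
  push_cast
  have hp := Real.pi_ne_zero
  field_simp
  ring

theorem lengthFormula_nonneg {x : ℝ} (hx : 0 < x) : 0 ≤ lengthFormula x := by
  rw [lengthFormula_eq_crossDensity hx]
  have hs := Real.sinh_pos_iff.2 (half_pos hx)
  have hc := Real.cosh_pos (x / 2)
  have h0 : 0 < Real.tanh (x / 2) ^ 2 := by rw [Real.tanh_eq_sinh_div_cosh]; positivity
  have := crossDensity_nonneg ⟨h0, Real.tanh_sq_lt_one _⟩
  positivity

/-- The substitution `u = tanh² (x / 2)` turns the density of the modulus into that of the length. -/
theorem lintegral_crossDensity_tanh (Φ : ℝ → ℝ≥0∞) {a : ℝ} (ha : 0 ≤ a) :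
    6 * ∫⁻ u in Set.Ioo 0 (Real.tanh (a / 2) ^ 2), Φ u * ENNReal.ofReal (crossDensity u) =
      ∫⁻ x in Set.Ioo 0 a, Φ (Real.tanh (x / 2) ^ 2) * ENNReal.ofReal (lengthFormula x) := by
  rw [← image_tanh_sq ha, lintegral_image_eq_lintegral_abs_deriv_mul measurableSet_Ioo
    (fun x _ => (hasDerivAt_tanh_sq x).hasDerivWithinAt)
    (tanh_sq_strictMonoOn.injOn.mono (Set.Ioo_subset_Ioi_self.trans Set.Ioi_subset_Ici_self)),
    ← lintegral_const_mul' _ _ (by simp)]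
  refine setLIntegral_congr_fun measurableSet_Ioo fun x hx => ?_
  have hs := Real.sinh_pos_iff.2 (half_pos hx.1)
  have hc := Real.cosh_pos (x / 2)
  rw [lengthFormula_eq_crossDensity hx.1, ENNReal.ofReal_mul (by norm_num),
    ENNReal.ofReal_mul (by positivity), abs_of_pos (by positivity), ENNReal.ofReal_ofNat]
  ring

/-- The law of the length of the shortest geodesic of the torus of a random quadrilateral. -/
theorem lintegral_lengthOfModulus_quadModulus {ψ : ℝ → ℝ≥0∞} (hψ : Measurable ψ) :
    ∫⁻ θ, ψ (lengthOfModulus (quadModulus θ))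
      ∂(Measure.pi fun _ : Fin 4 => cond volume (Set.Icc 0 (2 * Real.pi))) =
      ∫⁻ x in Set.Ioo 0 maxLength, ψ x * ENNReal.ofReal (lengthFormula x) := by
  have hm : Measurable lengthOfModulus := by
    have : Measurable fun u : ℝ => 2 * Real.log √((1 + √u) / (1 - √u)) := by fun_prop
    exact this
  have h := lintegral_quadModulus_uniform (hψ.comp hm)
  simp only [Function.comp_def] at h
  have h' := lintegral_three_cauchy_eq (hψ.comp hm)
  simp only [Function.comp_def] at h'
  rw [h, h', lintegral_minMaxRatio_crossDensity fun u => ψ (lengthOfModulus u), ← tanh_maxLength, lintegral_crossDensity_tanh _ maxLength_pos.le]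
  refine setLIntegral_congr_fun measurableSet_Ioo fun x hx => ?_
  rw [lengthOfModulus_tanh hx.1.le]

end RandomTorus

/-! ### The law of the length, almost sure statements and medians. -/

namespace RandomTorus

open scoped ENNReal
open Filter Topology

theorem measurable_lengthFormula : Measurable lengthFormula := by
  unfold lengthFormula
  have := Real.measurable_sinh
  have := Real.measurable_cosh
  fun_prop

theorem measurable_lengthDensity : Measurable lengthDensity :=
  measurable_lengthFormula.indicator measurableSet_Ioc

theorem lengthDensity_nonneg (x : ℝ) : 0 ≤ lengthDensity x :=
  Set.indicator_nonneg (fun _ hx => lengthFormula_nonneg hx.1) x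

/-- The probability measure on the line with density `lengthDensity`. -/
noncomputable def lengthLaw : Measure ℝ :=
  volume.withDensity fun x => ENNReal.ofReal (lengthDensity x)

theorem lintegral_lengthLaw {ψ : ℝ → ℝ≥0∞} (hψ : Measurable ψ) :
    ∫⁻ x, ψ x ∂lengthLaw = ∫⁻ x in Set.Ioo 0 maxLength, ψ x * ENNReal.ofReal (lengthFormula x) := by
  rw [lengthLaw, lintegral_withDensity_eq_lintegral_mul _ measurable_lengthDensity.ennreal_ofReal hψ,
    Measure.restrict_congr_set Ioo_ae_eq_Ioc, ← lintegral_indicator measurableSet_Ioc]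
  refine lintegral_congr fun x => ?_
  by_cases hx : x ∈ Set.Ioc 0 maxLength
  · simp [lengthDensity, hx, mul_comm]
  · simp [lengthDensity, hx]

/-- The joint law of the four angles. -/
noncomputable def angleLaw : Measure (Fin 4 → ℝ) :=
  Measure.pi fun _ : Fin 4 => cond volume (Set.Icc 0 (2 * Real.pi))

theorem isProbabilityMeasure_cond_Icc :
    IsProbabilityMeasure (cond (volume : Measure ℝ) (Set.Icc 0 (2 * Real.pi))) := by
  refine cond_isProbabilityMeasure_of_finite ?_ ?_ <;> rw [Real.volume_Icc, sub_zero]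
  · simp [Real.pi_pos]
  · exact ENNReal.ofReal_ne_top

theorem isProbabilityMeasure_angleLaw : IsProbabilityMeasure angleLaw := by
  have := isProbabilityMeasure_cond_Icc
  unfold angleLaw
  infer_instance

theorem measurable_lengthOfModulus : Measurable lengthOfModulus := by
  have : Measurable fun u : ℝ => 2 * Real.log √((1 + √u) / (1 - √u)) := by fun_prop
  exact this

theorem measurable_lengthOfModulus_quadModulus :
    Measurable fun θ => lengthOfModulus (quadModulus θ) :=
  measurable_lengthOfModulus.comp measurable_quadModulus

theorem map_angleLaw : angleLaw.map (fun θ => lengthOfModulus (quadModulus θ)) = lengthLaw := by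
  refine Measure.ext fun s hs => ?_
  have hind : Measurable (s.indicator (1 : ℝ → ℝ≥0∞)) := measurable_one.indicator hs
  rw [← lintegral_indicator_one hs, ← lintegral_indicator_one hs,
    lintegral_map hind measurable_lengthOfModulus_quadModulus, lintegral_lengthLaw hind]
  exact lintegral_lengthOfModulus_quadModulus hind

instance isProbabilityMeasure_lengthLaw : IsProbabilityMeasure lengthLaw := by
  have := isProbabilityMeasure_angleLaw
  rw [← map_angleLaw]
  exact Measure.isProbabilityMeasure_map measurable_lengthOfModulus_quadModulus.aemeasurable

theorem integrable_lengthDensity : Integrable lengthDensity := by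
  refine ⟨measurable_lengthDensity.aestronglyMeasurable, ?_⟩
  rw [hasFiniteIntegral_iff_ofReal (Eventually.of_forall lengthDensity_nonneg)]
  have : lengthLaw Set.univ < ⊤ := measure_lt_top _ _
  rwa [lengthLaw, withDensity_apply _ MeasurableSet.univ, Measure.restrict_univ] at this

theorem ae_lengthLaw_mem_Ioc : ∀ᵐ x ∂lengthLaw, x ∈ Set.Ioc 0 maxLength := by
  rw [lengthLaw, ae_withDensity_iff measurable_lengthDensity.ennreal_ofReal]
  refine Eventually.of_forall fun x hx => ?_
  by_contra h
  exact hx (by simp [lengthDensity, h])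

theorem integrable_id_lengthLaw : Integrable (fun x => x) lengthLaw := by
  refine Integrable.of_bound measurable_id.aestronglyMeasurable maxLength ?_
  filter_upwards [ae_lengthLaw_mem_Ioc] with x hx
  rw [Real.norm_of_nonneg hx.1.le]
  exact hx.2

theorem integral_id_lengthLaw :
    ∫ x, x ∂lengthLaw = ∫ x in (0 : ℝ)..maxLength, lengthFormula x * x := by
  rw [lengthLaw, integral_withDensity_eq_integral_toReal_smul measurable_lengthDensity.ennreal_ofReal
    (Eventually.of_forall fun _ => ENNReal.ofReal_lt_top), intervalIntegral.integral_of_le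
    maxLength_pos.le, ← integral_indicator measurableSet_Ioc]
  refine integral_congr_ae (Eventually.of_forall fun x => ?_)
  simp only
  rw [ENNReal.toReal_ofReal (lengthDensity_nonneg x), smul_eq_mul]
  by_cases hx : x ∈ Set.Ioc 0 maxLength
  · simp [lengthDensity, hx]
  · simp [lengthDensity, hx]

theorem map_angles {Ω : Type*} [MeasurableSpace Ω] {P : Measure Ω} [IsProbabilityMeasure P]
    {θ : Fin 4 → Ω → ℝ} (hmeas : ∀ j, Measurable (θ j)) (hindep : iIndepFun θ P)
    (hunif : ∀ j, pdf.IsUniform (θ j) (Set.Icc 0 (2 * Real.pi)) P volume) :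
    P.map (fun ω j => θ j ω) = angleLaw := by
  rw [(iIndepFun_iff_map_fun_eq_pi_map fun j => (hmeas j).aemeasurable).1 hindep, angleLaw]
  congr 1
  ext1 j
  exact hunif j

theorem ae_angles_ne {Ω : Type*} [MeasurableSpace Ω] {P : Measure Ω} [IsProbabilityMeasure P]
    {X Y : Ω → ℝ} (hX : Measurable X) (hY : Measurable Y) (h : IndepFun X Y P)
    (hac : P.map Y ≪ volume) : ∀ᵐ ω ∂P, X ω ≠ Y ω := by
  have hXY := (indepFun_iff_map_prod_eq_prod_map_map hX.aemeasurable hY.aemeasurable).1 h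
  have := Measure.isProbabilityMeasure_map (μ := P) hY.aemeasurable
  have h0 : P.map (fun ω => (X ω, Y ω)) (Set.diagonal ℝ) = 0 := by
    rw [hXY, Measure.measure_prod_null measurableSet_diagonal]
    refine Eventually.of_forall fun x => ?_
    refine hac ?_
    have : Prod.mk x ⁻¹' Set.diagonal ℝ = {x} := by ext y; simp [eq_comm]
    rw [this, Real.volume_singleton]
  rw [Measure.map_apply (hX.prodMk hY) measurableSet_diagonal] at h0
  simp only [ae_iff, ne_eq, not_not]
  exact h0

theorem ae_angles {Ω : Type*} [MeasurableSpace Ω] {P : Measure Ω} [IsProbabilityMeasure P]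
    {θ : Fin 4 → Ω → ℝ} (hmeas : ∀ j, Measurable (θ j)) (hindep : iIndepFun θ P)
    (hunif : ∀ j, pdf.IsUniform (θ j) (Set.Icc 0 (2 * Real.pi)) P volume) :
    ∀ᵐ ω ∂P, (∀ j, θ j ω ∈ Set.Ioo 0 (2 * Real.pi)) ∧ Function.Injective fun j => θ j ω := by
  have h1 : ∀ j, ∀ᵐ ω ∂P, θ j ω ∈ Set.Ioo 0 (2 * Real.pi) := by
    intro j
    refine ae_of_ae_map (hmeas j).aemeasurable (p := fun x => x ∈ Set.Ioo 0 (2 * Real.pi)) ?_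
    rw [show P.map (θ j) = _ from hunif j, ProbabilityTheory.cond,
      Measure.restrict_congr_set Ioo_ae_eq_Icc.symm]
    exact Measure.ae_smul_measure (ae_restrict_mem measurableSet_Ioo) _
  have h2 : ∀ i j, i ≠ j → ∀ᵐ ω ∂P, θ i ω ≠ θ j ω := fun i j hij =>
    ae_angles_ne (hmeas i) (hmeas j) (hindep.indepFun hij) (hunif j).absolutelyContinuous
  have h2' : ∀ᵐ ω ∂P, ∀ i j, i ≠ j → θ i ω ≠ θ j ω := by
    rw [ae_all_iff]
    intro i
    rw [ae_all_iff]
    intro j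
    by_cases hij : i = j
    · exact Eventually.of_forall fun ω h => absurd hij h
    · exact (h2 i j hij).mono fun ω h _ => h
  filter_upwards [ae_all_iff.2 h1, h2'] with ω hω hω'
  exact ⟨hω, fun i j hij => by_contra fun h => hω' i j h hij⟩

theorem sin_half_ne_zero {t : ℝ} (ht : t ∈ Set.Ioo 0 (2 * Real.pi)) : Real.sin (t / 2) ≠ 0 :=
  (Real.sin_pos_of_pos_of_lt_pi (half_pos ht.1) (by linarith [ht.2])).ne'

theorem ae_isLeast_shortestLength {Ω : Type*} [MeasurableSpace Ω] {P : Measure Ω}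
    [IsProbabilityMeasure P] {θ : Fin 4 → Ω → ℝ} (hmeas : ∀ j, Measurable (θ j))
    (hindep : iIndepFun θ P) (hunif : ∀ j, pdf.IsUniform (θ j) (Set.Icc 0 (2 * Real.pi)) P volume)
    {Γ : Ω → Subgroup SL(2, ℝ)}
    (hΓ : ∀ᵐ ω ∂P, IsRectangularTorusGroup (fun j => Circle.exp (θ j ω)) (Γ ω)) :
    ∀ᵐ ω ∂P, IsLeast (closedGeodesicLengths (Γ ω)) (shortestLength (Γ ω)) ∧
      shortestLength (Γ ω) = lengthOfModulus (quadModulus fun j => θ j ω) := by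
  filter_upwards [hΓ, ae_angles hmeas hindep hunif] with ω hω hθ
  have h := isLeast_of_isRectangularTorusGroup (θ := fun j => θ j ω)
    (fun j => sin_half_ne_zero (hθ.1 j)) hω
  have e : shortestLength (Γ ω) = _ := h.csInf_eq
  exact ⟨e ▸ h, e⟩

/-- The law has no atoms, so the two tails at `x` have total mass one and can both be at least `1/2`
only when both equal `1/2`. -/
theorem isMedian_iff {Ω : Type*} [MeasurableSpace Ω] {P : Measure Ω} {X : Ω → ℝ}
    (hX : AEMeasurable X P) (hlaw : P.map X = lengthLaw) (x : ℝ) :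
    IsMedian P X x ↔ lengthLaw (Set.Iic x) = 1 / 2 := by
  have h1 : P {ω | X ω ≤ x} = lengthLaw (Set.Iic x) := by
    rw [← hlaw, Measure.map_apply_of_aemeasurable hX measurableSet_Iic]; rfl
  have h2 : P {ω | x ≤ X ω} = 1 - lengthLaw (Set.Iic x) := by
    rw [← prob_compl_eq_one_sub measurableSet_Iic, Set.compl_Iic]
    have hac : lengthLaw ≪ volume := withDensity_absolutelyContinuous _ _
    rw [measure_congr (hac.ae_eq Ioi_ae_eq_Ici), ← hlaw,
      Measure.map_apply_of_aemeasurable hX measurableSet_Ici]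
    rfl
  have hle : lengthLaw (Set.Iic x) ≤ 1 := prob_le_one
  rw [IsMedian, h1, h2]
  generalize lengthLaw (Set.Iic x) = p at hle
  lift p to NNReal using ne_top_of_le_ne_top ENNReal.one_ne_top hle
  have hhalf : (1 / 2 : ℝ≥0∞) = ((1 / 2 : NNReal) : ℝ≥0∞) := by simp
  have hle' : p ≤ 1 := by exact_mod_cast hle
  rw [hhalf, ← ENNReal.coe_one, ← ENNReal.coe_sub, ENNReal.coe_le_coe, ENNReal.coe_le_coe,
    ENNReal.coe_inj, le_tsub_iff_right hle', ← NNReal.coe_le_coe, ← NNReal.coe_le_coe,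
    ← NNReal.coe_inj]
  push_cast
  constructor
  · rintro ⟨ha, hb⟩
    linarith
  · intro h
    constructor <;> linarith

end RandomTorus

/-! ### Series with logarithms bounding the density of the modulus. -/

namespace RandomTorus

open scoped ENNReal
open Filter Topology

theorem hasDerivAt_pow_mul_log (k : ℕ) {x : ℝ} (hx : 0 < x) :
    HasDerivAt (fun x : ℝ => x ^ (k + 1) * (1 / (k + 1) ^ 2 - Real.log x / (k + 1)))
      (x ^ k * -Real.log x) x := by
  have hk : (k : ℝ) + 1 ≠ 0 := by positivity
  have h := (hasDerivAt_pow (k + 1) x).mul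
    (((Real.hasDerivAt_log hx.ne').div_const ((k : ℝ) + 1)).const_sub (1 / ((k : ℝ) + 1) ^ 2))
  refine h.congr_deriv ?_
  rw [Nat.add_sub_cancel, pow_succ]
  push_cast
  field_simp
  ring

theorem continuous_pow_mul_log (k : ℕ) :
    Continuous fun x : ℝ => x ^ (k + 1) * (1 / (k + 1) ^ 2 - Real.log x / (k + 1)) := by
  have h : (fun x : ℝ => x ^ (k + 1) * (1 / (k + 1) ^ 2 - Real.log x / (k + 1))) =
      fun x : ℝ => x ^ (k + 1) / (k + 1) ^ 2 - x ^ k * (x * Real.log x) / (k + 1) := by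
    funext x
    rw [pow_succ]
    ring
  rw [h]
  have := Real.continuous_mul_log
  fun_prop

/-- The antiderivative is continuous at the singular endpoint `0` because `x log x` is, and
nonnegativity of the integrand (hence `W ≤ 1`) then yields integrability. The truncations used for
the median and for the mean both have this form. -/
theorem setLIntegral_sum_pow_log {s : Finset ℕ} {e : ℕ → ℕ} {α β : ℕ → ℝ} (hα : ∀ n, 0 ≤ α n)
    (hβ : ∀ n, 0 ≤ β n) {W : ℝ} (h0 : 0 ≤ W) (h1 : W ≤ 1) :
    ∫⁻ w in Set.Ioo 0 W,
      ENNReal.ofReal (∑ n ∈ s, (α n * w ^ e n + β n * (w ^ e n * -Real.log w))) =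
    ENNReal.ofReal (∑ n ∈ s, (α n * (W ^ (e n + 1) / (e n + 1)) +
      β n * (W ^ (e n + 1) * (1 / (e n + 1) ^ 2 - Real.log W / (e n + 1))))) := by
  set G : ℝ → ℝ := fun x => ∑ n ∈ s, (α n * (x ^ (e n + 1) / (e n + 1)) +
      β n * (x ^ (e n + 1) * (1 / (e n + 1) ^ 2 - Real.log x / (e n + 1)))) with hG
  set g : ℝ → ℝ := fun w => ∑ n ∈ s, (α n * w ^ e n + β n * (w ^ e n * -Real.log w)) with hg
  have hcont : Continuous G := by
    refine continuous_finsetSum _ fun n _ => ?_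
    exact ((((continuous_id.pow _).div_const _).const_mul _)).add
      ((continuous_pow_mul_log (e n)).const_mul _)
  have hderiv : ∀ x ∈ Set.Ioo 0 W, HasDerivAt G (g x) x := by
    intro x hx
    refine HasDerivAt.fun_sum fun n _ => ?_
    refine HasDerivAt.add (HasDerivAt.const_mul _ ?_)
      ((hasDerivAt_pow_mul_log (e n) hx.1).const_mul _)
    have hk : (e n : ℝ) + 1 ≠ 0 := by positivity
    refine ((hasDerivAt_pow (e n + 1) x).div_const ((e n : ℝ) + 1)).congr_deriv ?_
    rw [Nat.add_sub_cancel]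
    push_cast
    field_simp
  have hpos : ∀ x ∈ Set.Ioo 0 W, 0 ≤ g x := by
    intro x hx
    have hl : 0 ≤ -Real.log x := by
      linarith [Real.log_nonpos hx.1.le (hx.2.le.trans h1)]
    have hx0 := hx.1.le
    exact Finset.sum_nonneg fun n _ => add_nonneg (mul_nonneg (hα n) (by positivity))
      (mul_nonneg (hβ n) (by positivity))
  have hint := intervalIntegral.integrableOn_deriv_of_nonneg hcont.continuousOn hderiv hpos
  have hval := intervalIntegral.integral_eq_sub_of_hasDerivAt_of_le h0 hcont.continuousOn hderiv
    ((intervalIntegrable_iff_integrableOn_Ioc_of_le h0).2 hint)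
  have hG0 : G 0 = 0 := by simp [hG]
  rw [intervalIntegral.integral_of_le h0, hG0, sub_zero] at hval
  change _ = ENNReal.ofReal (G W)
  rw [← hval, ofReal_integral_eq_lintegral_ofReal hint] <;>
    rw [← Measure.restrict_congr_set Ioo_ae_eq_Ioc]
  exact (ae_restrict_mem measurableSet_Ioo).mono hpos

/-- The distribution function of the length. -/
theorem lengthLaw_Iic {a : ℝ} (h0 : 0 ≤ a) (ha : a ≤ maxLength) : lengthLaw (Set.Iic a) =
    6 * ∫⁻ u in Set.Ioo 0 (Real.tanh (a / 2) ^ 2), ENNReal.ofReal (crossDensity u) := by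
  have h := lintegral_crossDensity_tanh 1 h0
  simp only [Pi.one_apply, one_mul] at h
  rw [h, lengthLaw, withDensity_apply _ measurableSet_Iic, ← lintegral_indicator measurableSet_Iic,
    Measure.restrict_congr_set Ioo_ae_eq_Ioc, ← lintegral_indicator measurableSet_Ioc]
  refine lintegral_congr fun x => ?_
  by_cases hx : x ∈ Set.Ioc 0 a
  · have hx' : x ∈ Set.Ioc 0 maxLength := ⟨hx.1, hx.2.trans ha⟩
    simp [hx, lengthDensity, hx', hx.2]
  · by_cases hxa : x ≤ a
    · have hx' : x ∉ Set.Ioc 0 maxLength := fun h => hx ⟨h.1, hxa⟩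
      simp [hx, lengthDensity, hx']
    · simp [hx, hxa]

theorem one_div_one_sub_le {u : ℝ} (N : ℕ) (h0 : 0 ≤ u) (h1 : u < 1) :
    ∑ n ∈ Finset.range N, u ^ n ≤ 1 / (1 - u) := by
  rw [geom_sum_eq h1.ne, ← neg_div_neg_eq, neg_sub, neg_sub]
  have := pow_nonneg h0 N
  exact div_le_div_of_nonneg_right (by linarith) (by linarith)

theorem one_div_one_sub_eq {u : ℝ} (N : ℕ) (h1 : u < 1) :
    1 / (1 - u) = ∑ n ∈ Finset.range N, u ^ n + u ^ N / (1 - u) := by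
  rw [geom_sum_eq h1.ne, ← neg_div_neg_eq (u ^ N - 1), neg_sub, neg_sub, ← add_div]
  ring

theorem sum_le_neg_log_one_sub {u : ℝ} (N : ℕ) (h0 : 0 ≤ u) (h1 : u < 1) :
    ∑ n ∈ Finset.range N, u ^ (n + 1) / (n + 1) ≤ -Real.log (1 - u) :=
  sum_le_hasSum _ (fun n _ => by positivity)
    (Real.hasSum_pow_div_log_of_abs_lt_one (by rwa [abs_of_nonneg h0]))

theorem neg_log_one_sub_le {u : ℝ} (N : ℕ) (h0 : 0 ≤ u) (h1 : u < 1) :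
    -Real.log (1 - u) ≤ ∑ n ∈ Finset.range N, u ^ (n + 1) / (n + 1) + u ^ (N + 1) / (1 - u) := by
  have h := Real.abs_log_sub_add_sum_range_le (x := u) (by rwa [abs_of_nonneg h0]) N
  rw [abs_of_nonneg h0] at h
  linarith [neg_abs_le (∑ i ∈ Finset.range N, u ^ (i + 1) / ((i : ℝ) + 1) + Real.log (1 - u))]

theorem crossDensity_eq (u : ℝ) : crossDensity u =
    (Real.pi ^ 2)⁻¹ * (-Real.log (1 - u) / u + 1 / (1 - u) * -Real.log u) := by
  rw [crossDensity, show u - 1 = -(1 - u) by ring, div_neg]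
  ring

theorem crossDensity_lower (N : ℕ) {u : ℝ} (hu : u ∈ Set.Ioo (0 : ℝ) 1) :
    (Real.pi ^ 2)⁻¹ * ∑ n ∈ Finset.range N,
      (1 / (n + 1) * u ^ n + 1 * (u ^ n * -Real.log u)) ≤ crossDensity u := by
  obtain ⟨h0, h1⟩ := hu
  rw [crossDensity_eq]
  refine mul_le_mul_of_nonneg_left ?_ (by positivity)
  rw [Finset.sum_add_distrib]
  refine add_le_add ?_ ?_
  · rw [le_div_iff₀ h0, Finset.sum_mul]
    refine le_trans (le_of_eq ?_) (sum_le_neg_log_one_sub N h0.le h1)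
    exact Finset.sum_congr rfl fun n _ => by rw [pow_succ]; ring
  · simp only [one_mul]
    rw [← Finset.sum_mul]
    exact mul_le_mul_of_nonneg_right (one_div_one_sub_le N h0.le h1)
      (by linarith [Real.log_nonpos h0.le h1.le])

/-- The remainders of `∑ uⁿ` and of the series of `-log (1 - u) / u` after `N` terms are at most `u
^ N / (1 - U)`. They are recorded as one extra term of index `N`, so that the sum keeps an
integrable form. -/
theorem crossDensity_upper (N : ℕ) {u U : ℝ} (h0 : 0 < u) (huU : u ≤ U) (h1 : U < 1) :
    crossDensity u ≤ (Real.pi ^ 2)⁻¹ * ∑ n ∈ Finset.range (N + 1),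
      ((if n < N then 1 / ((n : ℝ) + 1) else 1 / (1 - U)) * u ^ n +
        (if n < N then 1 else 1 / (1 - U)) * (u ^ n * -Real.log u)) := by
  have hu1 : u < 1 := huU.trans_lt h1
  have hl : 0 ≤ -Real.log u := by linarith [Real.log_nonpos h0.le hu1.le]
  have hinv : 1 / (1 - u) ≤ 1 / (1 - U) := one_div_le_one_div_of_le (by linarith) (by linarith)
  rw [crossDensity_eq]
  refine mul_le_mul_of_nonneg_left ?_ (by positivity)
  rw [Finset.sum_range_succ, if_neg (lt_irrefl N), if_neg (lt_irrefl N), Finset.sum_congr rfl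
    (g := fun n : ℕ => u ^ (n + 1) / (n + 1) / u + u ^ n * -Real.log u)]
  · rw [Finset.sum_add_distrib, ← Finset.sum_div, ← Finset.sum_mul, add_add_add_comm, ← mul_assoc,
      ← add_mul]
    refine add_le_add ?_ (mul_le_mul_of_nonneg_right ?_ hl)
    · rw [div_add' _ _ _ h0.ne']
      refine div_le_div_of_nonneg_right ?_ h0.le
      refine (neg_log_one_sub_le N h0.le hu1).trans ?_
      rw [mul_assoc, ← pow_succ, div_eq_mul_one_div, mul_comm (u ^ (N + 1))]
      gcongr
    · rw [one_div_one_sub_eq N hu1, div_eq_mul_one_div, mul_comm (u ^ N)]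
      gcongr
  · intro n hn
    rw [if_pos (Finset.mem_range.1 hn), if_pos (Finset.mem_range.1 hn), pow_succ]
    field_simp

end RandomTorus

/-! ### Numerical bracket and uniqueness of the median. -/

namespace RandomTorus

open scoped ENNReal
open Filter Topology

theorem lintegral_crossDensity_lower (N : ℕ) {U : ℝ} (h0 : 0 < U) (h1 : U < 1) :
    ENNReal.ofReal ((Real.pi ^ 2)⁻¹ * ∑ n ∈ Finset.range N,
      (1 / ((n : ℝ) + 1) * (U ^ (n + 1) / (n + 1)) +
        1 * (U ^ (n + 1) * (1 / (n + 1) ^ 2 - Real.log U / (n + 1))))) ≤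
    ∫⁻ u in Set.Ioo 0 U, ENNReal.ofReal (crossDensity u) := by
  have h := setLIntegral_sum_pow_log (s := Finset.range N) (e := fun n => n)
    (α := fun n => 1 / ((n : ℝ) + 1)) (β := fun _ => 1) (fun n => by positivity)
    (fun _ => zero_le_one) h0.le h1.le
  rw [ENNReal.ofReal_mul (by positivity), ← h, ← lintegral_const_mul' _ _ ENNReal.ofReal_ne_top]
  refine setLIntegral_mono' measurableSet_Ioo fun u hu => ?_
  rw [← ENNReal.ofReal_mul (by positivity)]
  exact ENNReal.ofReal_le_ofReal (crossDensity_lower N ⟨hu.1, hu.2.trans h1⟩)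

theorem lintegral_crossDensity_upper (N : ℕ) {U : ℝ} (h0 : 0 < U) (h1 : U < 1) :
    ∫⁻ u in Set.Ioo 0 U, ENNReal.ofReal (crossDensity u) ≤
    ENNReal.ofReal ((Real.pi ^ 2)⁻¹ * ∑ n ∈ Finset.range (N + 1),
      ((if n < N then 1 / ((n : ℝ) + 1) else 1 / (1 - U)) * (U ^ (n + 1) / (n + 1)) +
        (if n < N then 1 else 1 / (1 - U)) *
          (U ^ (n + 1) * (1 / (n + 1) ^ 2 - Real.log U / (n + 1))))) := by
  have hU : 0 ≤ 1 / (1 - U) := one_div_nonneg.2 (by linarith)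
  have h := setLIntegral_sum_pow_log (s := Finset.range (N + 1)) (e := fun n => n)
    (α := fun n => if n < N then 1 / ((n : ℝ) + 1) else 1 / (1 - U))
    (β := fun n => if n < N then 1 else 1 / (1 - U))
    (fun n => by split_ifs <;> positivity) (fun n => by split_ifs <;> positivity) h0.le h1.le
  rw [ENNReal.ofReal_mul (by positivity), ← h, ← lintegral_const_mul' _ _ ENNReal.ofReal_ne_top]
  refine setLIntegral_mono' measurableSet_Ioo fun u hu => ?_
  rw [← ENNReal.ofReal_mul (by positivity)]
  exact ENNReal.ofReal_le_ofReal (crossDensity_upper N hu.1 hu.2.le h1)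

theorem tanh_half_sq (x : ℝ) : Real.tanh (x / 2) ^ 2 =
    ((Real.exp x - 1) / (Real.exp x + 1)) ^ 2 := by
  congr 1
  have h : Real.exp x = Real.exp (x / 2) * Real.exp (x / 2) := by rw [← Real.exp_add]; ring_nf
  have hp := Real.exp_pos (x / 2)
  rw [Real.tanh_eq, h, Real.exp_neg]
  field_simp

/-- As the argument is close to 1, the decimals of `e` and the inequality `1 + s ≤ exp s` for the
small difference suffice; `(E - 1)/(E + 1)` is increasing in `E = exp x`. -/
theorem tanh_half_sq_upper : Real.tanh (0.99929 / 2) ^ 2 < 0.213296 := by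
  have h1 : Real.exp 0.99929 * 1.00071 ≤ Real.exp 1 := by
    rw [show (1 : ℝ) = 0.99929 + 0.00071 by norm_num, Real.exp_add]
    refine mul_le_mul_of_nonneg_left ?_ (Real.exp_pos _).le
    have := Real.add_one_le_exp 0.00071
    linarith
  have h2 := Real.exp_one_lt_d9
  have h3 : (1 : ℝ) ≤ Real.exp 0.99929 := Real.one_le_exp (by norm_num)
  rw [tanh_half_sq]
  have h4 : (Real.exp 0.99929 - 1) / (Real.exp 0.99929 + 1) ≤ 0.461839 := by
    rw [div_le_iff₀ (by linarith)]
    linarith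
  have h5 : 0 ≤ (Real.exp 0.99929 - 1) / (Real.exp 0.99929 + 1) :=
    div_nonneg (by linarith) (by linarith)
  nlinarith

theorem tanh_half_sq_lower : 0.2132975 < Real.tanh (0.99930 / 2) ^ 2 := by
  have h1 : Real.exp 1 * 0.9993 ≤ Real.exp 0.99930 := by
    rw [show (0.99930 : ℝ) = 1 + (-0.0007) by norm_num, Real.exp_add]
    refine mul_le_mul_of_nonneg_left ?_ (Real.exp_pos _).le
    have := Real.add_one_le_exp (-0.0007)
    linarith
  have h2 := Real.exp_one_gt_d9
  rw [tanh_half_sq]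
  have h4 : 0.4618415 ≤ (Real.exp 0.99930 - 1) / (Real.exp 0.99930 + 1) := by
    rw [le_div_iff₀ (by linarith)]
    linarith
  nlinarith

/-- Writing the argument as `(1 - x)/4` with small `x` reduces this to `log 2` and eight terms of
the logarithm series. -/
theorem log_lower : -1.5450746 ≤ Real.log 0.213296 := by
  have h := Real.abs_log_sub_add_sum_range_le (x := 0.146816) (by norm_num [abs_lt]) 8
  have h2 := Real.log_two_lt_d9
  have e : Real.log 0.213296 = Real.log (1 - 0.146816) - 2 * Real.log 2 := by
    rw [show (0.213296 : ℝ) = (1 - 0.146816) / 2 ^ 2 by norm_num,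
      Real.log_div (by norm_num) (by norm_num), Real.log_pow]
    push_cast
    ring
  rw [abs_le] at h
  have h' := h.1
  rw [e]
  norm_num [Finset.sum_range_succ] at h' ⊢
  linarith

theorem log_upper : Real.log 0.2132975 ≤ -1.545067 := by
  have h := Real.abs_log_sub_add_sum_range_le (x := 0.14681) (by norm_num [abs_lt]) 8
  have h2 := Real.log_two_gt_d9
  have e : Real.log 0.2132975 = Real.log (1 - 0.14681) - 2 * Real.log 2 := by
    rw [show (0.2132975 : ℝ) = (1 - 0.14681) / 2 ^ 2 by norm_num,
      Real.log_div (by norm_num) (by norm_num), Real.log_pow]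
    push_cast
    ring
  rw [abs_le] at h
  have h' := h.2
  rw [e]
  norm_num [Finset.sum_range_succ] at h' ⊢
  linarith

theorem le_maxLength : 0.99930 ≤ maxLength := by
  by_contra! h
  have := tanh_sq_strictMonoOn (Set.mem_Ici.2 maxLength_pos.le)
    (Set.mem_Ici.2 (by norm_num)) h
  simp only [tanh_maxLength] at this
  have h3 : Real.exp 0.99930 < 4 := by
    have := Real.exp_one_lt_d9
    have h4 : Real.exp 0.99930 ≤ Real.exp 1 := Real.exp_le_exp.2 (by norm_num)
    linarith
  have h5 : (1 : ℝ) ≤ Real.exp 0.99930 := Real.one_le_exp (by norm_num)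
  rw [tanh_half_sq] at this
  have h4 : (Real.exp 0.99930 - 1) / (Real.exp 0.99930 + 1) ≤ 0.6 := by
    rw [div_le_iff₀ (by linarith)]
    linarith
  have h6 : 0 ≤ (Real.exp 0.99930 - 1) / (Real.exp 0.99930 + 1) :=
    div_nonneg (by linarith) (by linarith)
  nlinarith

theorem lengthLaw_Iic_lt : lengthLaw (Set.Iic 0.99929) < 1 / 2 := by
  rw [lengthLaw_Iic (by norm_num) (le_trans (by norm_num) le_maxLength)]
  have h1 : ∫⁻ u in Set.Ioo 0 (Real.tanh (0.99929 / 2) ^ 2), ENNReal.ofReal (crossDensity u) ≤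
      ∫⁻ u in Set.Ioo 0 0.213296, ENNReal.ofReal (crossDensity u) :=
    lintegral_mono_set (Set.Ioo_subset_Ioo_right tanh_half_sq_upper.le)
  -- Nine terms are enough, since the next power after integration is `0.2133 ^ 10 < 2 · 10⁻⁷`.
  have h2 := h1.trans (lintegral_crossDensity_upper 9 (by norm_num) (by norm_num))
  have hhalf : (1 / 2 : ℝ≥0∞) = ENNReal.ofReal (1 / 2) := by
    rw [ENNReal.ofReal_div_of_pos two_pos]; simp
  refine (mul_le_mul_right h2 6).trans_lt ?_
  rw [← ENNReal.ofReal_ofNat 6, ← ENNReal.ofReal_mul (by norm_num), hhalf]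
  refine (ENNReal.ofReal_lt_ofReal_iff (by norm_num)).2 ?_
  have hpi := Real.pi_gt_d6
  have hpi2 : 9.869600 < Real.pi ^ 2 := by nlinarith
  rw [mul_left_comm, inv_mul_lt_iff₀ (by positivity)]
  have hlog := log_lower
  norm_num [Finset.sum_range_succ] at hlog ⊢
  linarith

theorem lt_lengthLaw_Iic : 1 / 2 < lengthLaw (Set.Iic 0.99930) := by
  rw [lengthLaw_Iic (by norm_num) le_maxLength]
  have h1 : ∫⁻ u in Set.Ioo 0 0.2132975, ENNReal.ofReal (crossDensity u) ≤
      ∫⁻ u in Set.Ioo 0 (Real.tanh (0.99930 / 2) ^ 2), ENNReal.ofReal (crossDensity u) :=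
    lintegral_mono_set (Set.Ioo_subset_Ioo_right tanh_half_sq_lower.le)
  have h2 := (lintegral_crossDensity_lower 9 (by norm_num) (by norm_num)).trans h1
  have hhalf : (1 / 2 : ℝ≥0∞) = ENNReal.ofReal (1 / 2) := by
    rw [ENNReal.ofReal_div_of_pos two_pos]; simp
  refine lt_of_lt_of_le ?_ (mul_le_mul_right h2 6)
  rw [← ENNReal.ofReal_ofNat 6, ← ENNReal.ofReal_mul (by norm_num), hhalf]
  have hpi := Real.pi_lt_d6
  have hpi2 : Real.pi ^ 2 < 9.869607 := by nlinarith [Real.pi_pos]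
  have hlog := log_upper
  have key : 1 / 2 < (6 : ℝ) * ((Real.pi ^ 2)⁻¹ * ∑ n ∈ Finset.range 9,
      (1 / ((n : ℝ) + 1) * (0.2132975 ^ (n + 1) / (n + 1)) +
        1 * (0.2132975 ^ (n + 1) * (1 / (n + 1) ^ 2 - Real.log 0.2132975 / (n + 1))))) := by
    rw [mul_left_comm, lt_inv_mul_iff₀ (by positivity)]
    norm_num [Finset.sum_range_succ] at hlog ⊢
    linarith
  exact (ENNReal.ofReal_lt_ofReal_iff (one_half_pos.trans key)).2 key

/-- Strict positivity on the support is what makes the distribution function strictly increasing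
there, hence the median unique. -/
theorem lengthDensity_pos {x : ℝ} (hx : x ∈ Set.Ioc 0 maxLength) : 0 < lengthDensity x := by
  have hs := Real.sinh_pos_iff.2 (half_pos hx.1)
  have hs' := Real.sinh_pos_iff.2 hx.1
  have hc := Real.one_lt_cosh.2 (half_pos hx.1).ne'
  have hc' := Real.one_lt_cosh.2 hx.1.ne'
  have hlog := Real.log_pos hc
  have hlog' : 0 ≤ Real.log (Real.cosh (x / 2) / Real.sinh (x / 2)) :=
    Real.log_nonneg ((one_le_div hs).2 (Real.sinh_lt_cosh _).le)
  have h1 : 0 ≤ 2 * (Real.cosh x - 1) * Real.log (Real.cosh (x / 2) / Real.sinh (x / 2)) :=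
    mul_nonneg (by linarith) hlog'
  rw [lengthDensity, Set.indicator_of_mem hx, lengthFormula]
  have hp := Real.pi_pos
  exact mul_pos (by positivity) (by linarith)

theorem lengthLaw_Iic_eq_ofReal (x : ℝ) :
    lengthLaw (Set.Iic x) = ENNReal.ofReal (∫ t in Set.Iic x, lengthDensity t) := by
  rw [lengthLaw, withDensity_apply _ measurableSet_Iic,
    ofReal_integral_eq_lintegral_ofReal integrable_lengthDensity.integrableOn
    (Eventually.of_forall lengthDensity_nonneg)]

/-- The law of the length has exactly one median. -/
theorem exists_median_lengthLaw : ∃ m ∈ Set.Ico (0.99929 : ℝ) 0.99930, ∀ x : ℝ,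
    lengthLaw (Set.Iic x) = 1 / 2 ↔ x = m := by
  have hcont : Continuous fun x => ∫ t in Set.Iic x, lengthDensity t := by
    have h := intervalIntegral.continuous_primitive
      (fun a b => integrable_lengthDensity.intervalIntegrable (a := a) (b := b)) 0
    have e : (fun x => ∫ t in Set.Iic x, lengthDensity t) =
        fun x => (∫ t in Set.Iic 0, lengthDensity t) + ∫ t in (0 : ℝ)..x, lengthDensity t := by
      funext x
      rw [← intervalIntegral.integral_Iic_sub_Iic integrable_lengthDensity.integrableOn
        integrable_lengthDensity.integrableOn]
      ring
    rw [e]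
    exact h.const_add _
  have hcont' : Continuous fun x => lengthLaw (Set.Iic x) := by
    simp only [lengthLaw_Iic_eq_ofReal]
    exact ENNReal.continuous_ofReal.comp hcont
  obtain ⟨m, hm, hval⟩ := intermediate_value_Icc (by norm_num : (0.99929 : ℝ) ≤ 0.99930)
    hcont'.continuousOn ⟨lengthLaw_Iic_lt.le, lt_lengthLaw_Iic.le⟩
  simp only at hval
  have hmono : ∀ {x y : ℝ}, x ≤ y → lengthLaw (Set.Iic x) ≤ lengthLaw (Set.Iic y) := fun h =>
    measure_mono (Set.Iic_subset_Iic.2 h)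
  have hstrict : ∀ x y : ℝ, 0 ≤ x → x < y → y ≤ maxLength →
      lengthLaw (Set.Iic x) < lengthLaw (Set.Iic y) := by
    intro x y hx hxy hy
    have hpos : 0 < lengthLaw (Set.Ioc x y) := by
      rw [lengthLaw, pos_iff_ne_zero, ne_eq, withDensity_apply_eq_zero
        measurable_lengthDensity.ennreal_ofReal]
      have : {t | ENNReal.ofReal (lengthDensity t) ≠ 0} ∩ Set.Ioc x y = Set.Ioc x y := by
        rw [Set.inter_eq_right]
        intro t ht
        simpa using lengthDensity_pos ⟨hx.trans_lt ht.1, ht.2.trans hy⟩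
      rw [this, Real.volume_Ioc]
      simpa using hxy
    rw [← Set.Iic_union_Ioc_eq_Iic hxy.le, measure_union (by
      rw [Set.disjoint_left]; intro t h1 h2; exact absurd h1 (not_le.2 h2.1)) measurableSet_Ioc]
    exact ENNReal.lt_add_right (measure_ne_top _ _) hpos.ne'
  refine ⟨m, ⟨hm.1, hm.2.lt_of_ne ?_⟩, fun x => ⟨fun hx => ?_, fun hx => hx ▸ hval⟩⟩
  · rintro rfl
    exact lt_lengthLaw_Iic.ne' hval
  -- Monotonicity confines every solution to the bracket, which lies inside the support; there
  -- strict monotonicity leaves only `m`.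
  · have hx1 : 0.99929 < x := by
      by_contra! h
      exact absurd hx ((hmono h).trans_lt lengthLaw_Iic_lt).ne
    have hx2 : x < 0.99930 := by
      by_contra! h
      exact absurd hx (lt_lengthLaw_Iic.trans_le (hmono h)).ne'
    rcases lt_trichotomy x m with h | h | h
    · exact absurd (hx.trans hval.symm) (hstrict x m (by linarith) h (hm.2.trans le_maxLength)).ne
    · exact h
    · exact absurd (hx.trans hval.symm) (hstrict m x (by linarith [hm.1]) h (by linarith [le_maxLength])).ne'

end RandomTorus

/-! ### Numerical value of the mean. -/

namespace RandomTorus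

open scoped ENNReal
open Filter Topology

/-- The coefficients of the product of `∑ yⁱ / (2 i + 1)` with the power series `∑ c j yʲ`. -/
noncomputable def oddConv (c : ℕ → ℝ) (n : ℕ) : ℝ :=
  ∑ k ∈ Finset.range (n + 1), 1 / (2 * (k : ℝ) + 1) * c (n - k)

theorem oddConv_nonneg {c : ℕ → ℝ} (hc : ∀ n, 0 ≤ c n) (n : ℕ) : 0 ≤ oddConv c n :=
  Finset.sum_nonneg fun k _ => mul_nonneg (by positivity) (hc _)

/-- Since `c 0 = 0`, only `n` of the `n + 1` products can be nonzero, and each is at most one. -/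
theorem oddConv_le {c : ℕ → ℝ} (h0 : c 0 = 0) (hc : ∀ n, 0 ≤ c n) (hc1 : ∀ n, c n ≤ 1) (n : ℕ) :
    oddConv c n ≤ n := by
  rw [oddConv, Finset.sum_range_succ, Nat.sub_self, h0, mul_zero, add_zero]
  refine (Finset.sum_le_card_nsmul _ _ 1 fun k _ => ?_).trans (by simp)
  refine mul_le_one₀ ?_ (hc _) (hc1 _)
  rw [div_le_one (by positivity)]
  linarith [Nat.cast_nonneg (α := ℝ) k]

theorem hasSum_artanh_div {w : ℝ} (hw : w ∈ Set.Ioo (0 : ℝ) 1) :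
    HasSum (fun k : ℕ => 1 / (2 * (k : ℝ) + 1) * (w ^ 2) ^ k) (Real.artanh w / w) := by
  obtain ⟨h0, h1⟩ := hw
  have h := (Real.hasSum_log_sub_log_of_abs_lt_one (x := w) (by rwa [abs_of_pos h0])).mul_left
    (1 / (2 * w))
  have e : 1 / (2 * w) * (Real.log (1 + w) - Real.log (1 - w)) = Real.artanh w / w := by
    rw [Real.artanh_eq_half_log ⟨by linarith, h1.le⟩,
      Real.log_div (by linarith) (by linarith)]
    field_simp
  rw [e] at h
  refine h.congr_fun ?_
  intro k
  rw [← pow_mul, pow_succ w (2 * k)]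
  field_simp

theorem hasSum_oddConv {c : ℕ → ℝ} (hc : ∀ n, 0 ≤ c n) {w C : ℝ} (hw : w ∈ Set.Ioo (0 : ℝ) 1)
    (hC : HasSum (fun j => c j * (w ^ 2) ^ j) C) :
    HasSum (fun n => oddConv c n * (w ^ 2) ^ n) (Real.artanh w / w * C) := by
  have hA := hasSum_artanh_div hw
  have hA' : Summable fun k : ℕ => ‖1 / (2 * (k : ℝ) + 1) * (w ^ 2) ^ k‖ := by
    refine hA.summable.congr fun k => ?_
    rw [Real.norm_of_nonneg (by positivity)]
  have hC' : Summable fun j : ℕ => ‖c j * (w ^ 2) ^ j‖ := by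
    refine hC.summable.congr fun k => ?_
    rw [Real.norm_of_nonneg (mul_nonneg (hc k) (by positivity))]
  have h := hasSum_sum_range_mul_of_summable_norm hA' hC'
  rw [hA.tsum_eq, hC.tsum_eq] at h
  refine h.congr_fun fun n => ?_
  rw [oddConv, Finset.sum_mul]
  refine Finset.sum_congr rfl fun k hk => ?_
  have : (w ^ 2) ^ n = (w ^ 2) ^ k * (w ^ 2) ^ (n - k) := by
    rw [← pow_add, Nat.add_sub_cancel' (Nat.lt_succ_iff.1 (Finset.mem_range.1 hk))]
  rw [this]
  ring

/-- The tail is at most `y ^ N ∑ (n + N) yⁿ`, and for `y ≤ 1/2` both `∑ n yⁿ` and `∑ yⁿ` are at most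
2. -/
theorem hasSum_le_sum_add {d : ℕ → ℝ} (hd : ∀ n, d n ≤ n) {y S : ℝ} (h0 : 0 ≤ y) (h1 : y ≤ 1 / 2)
    (hS : HasSum (fun n => d n * y ^ n) S) (N : ℕ) :
    S ≤ ∑ n ∈ Finset.range N, d n * y ^ n + (2 * N + 2) * y ^ N := by
  have hy : ‖y‖ < 1 := by rw [Real.norm_of_nonneg h0]; linarith
  have hy1 : 1 / 2 ≤ 1 - y := by linarith
  have h2 := (hasSum_nat_add_iff' N).2 hS
  have h3 := ((hasSum_coe_mul_geometric_of_norm_lt_one hy).add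
    ((hasSum_geometric_of_norm_lt_one hy).mul_left (N : ℝ))).mul_left (y ^ N)
  have h4 := hasSum_le (fun n => ?_) h2 h3
  · have h5 : y / (1 - y) ^ 2 ≤ 2 := by
      rw [div_le_iff₀ (by positivity)]
      nlinarith
    have h6 : (1 - y)⁻¹ ≤ 2 := by
      rw [inv_le_comm₀ (by linarith) two_pos]
      linarith
    have h7 : y ^ N * (y / (1 - y) ^ 2 + N * (1 - y)⁻¹) ≤ y ^ N * (2 + N * 2) := by gcongr
    linarith
  · have := hd (n + N)
    push_cast at this
    calc d (n + N) * y ^ (n + N) ≤ (n + N) * y ^ (n + N) := by gcongr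
      _ = _ := by rw [pow_add]; ring

/-- Indexing from zero is legitimate because `1 / 0 = 0` supplies the vanishing constant term, as
`oddConv_le` requires. -/
theorem hasSum_neg_log_one_sub {y : ℝ} (h0 : 0 ≤ y) (h1 : y < 1) :
    HasSum (fun j : ℕ => 1 / (j : ℝ) * y ^ j) (-Real.log (1 - y)) := by
  rw [← hasSum_nat_add_iff' 1]
  have h := Real.hasSum_pow_div_log_of_abs_lt_one (x := y) (by rwa [abs_of_nonneg h0])
  simp only [Finset.range_one, Finset.sum_singleton, Nat.cast_zero, div_zero, zero_mul, sub_zero]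
  refine h.congr_fun fun n => ?_
  push_cast
  ring

theorem hasSum_div_one_sub {y : ℝ} (h0 : 0 ≤ y) (h1 : y < 1) :
    HasSum (fun j : ℕ => (if j = 0 then 0 else 1) * y ^ j) (y / (1 - y)) := by
  rw [← hasSum_nat_add_iff' 1]
  have h := (hasSum_geometric_of_lt_one h0 h1).mul_left y
  simp only [Finset.range_one, Finset.sum_singleton, if_true, zero_mul, sub_zero]
  refine h.congr_fun fun n => ?_
  rw [if_neg (Nat.succ_ne_zero n), pow_succ]
  ring

/-- The integrand of the mean length in the variable `w = tanh (x / 2)`. -/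
theorem meanIntegrand_eq {w : ℝ} (hw : w ∈ Set.Ioo (0 : ℝ) 1) :
    2 * Real.artanh w * (12 * w * crossDensity (w ^ 2)) = 6 / Real.pi ^ 2 *
      (4 * (Real.artanh w / w * -Real.log (1 - w ^ 2)) +
        8 * (Real.artanh w / w * (w ^ 2 / (1 - w ^ 2))) * -Real.log w) := by
  have h0 := hw.1
  have h1 : 1 - w ^ 2 ≠ 0 := by nlinarith [hw.1, hw.2]
  have hp := Real.pi_ne_zero
  rw [crossDensity_eq, Real.log_pow]
  push_cast
  field_simp
  ring

/-- In the variable `w = tanh (x / 2)` the length is `2 artanh w`, and `artanh w / w` is a power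
series in `w²`; the mean integrand thus involves only even powers of `w`, with or without `-log w`.
-/
theorem lintegral_lengthFormula_tanh (Φ : ℝ → ℝ≥0∞) :
    ∫⁻ x in Set.Ioo 0 maxLength, Φ (Real.tanh (x / 2)) * ENNReal.ofReal (lengthFormula x) =
      ∫⁻ w in Set.Ioo 0 √(1 / 2), Φ w * ENNReal.ofReal (12 * w * crossDensity (w ^ 2)) := by
  have hpos : ∀ x : ℝ, 0 < x → 0 < Real.tanh (x / 2) := fun x hx => by
    rw [Real.tanh_eq_sinh_div_cosh]
    exact div_pos (Real.sinh_pos_iff.2 (half_pos hx)) (Real.cosh_pos _)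
  have himg : (fun x : ℝ => Real.tanh (x / 2)) '' Set.Ioo 0 maxLength = Set.Ioo 0 √(1 / 2) := by
    have h2 := image_tanh_sq maxLength_pos.le
    rw [tanh_maxLength] at h2
    ext w
    constructor
    · rintro ⟨x, hx, rfl⟩
      refine ⟨hpos x hx.1, Real.lt_sqrt_of_sq_lt ?_⟩
      exact (h2.subset ⟨x, hx, rfl⟩).2
    · rintro ⟨hw0, hw1⟩
      obtain ⟨x, hx, hxw⟩ := h2.superset ⟨pow_pos hw0 2, (Real.lt_sqrt hw0.le).1 hw1⟩
      exact ⟨x, hx, (pow_left_inj₀ (hpos x hx.1).le hw0.le two_ne_zero).1 hxw⟩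
  have hinj : Set.InjOn (fun x : ℝ => Real.tanh (x / 2)) (Set.Ioo 0 maxLength) := by
    intro x _ y _ hxy
    have := Real.tanh_injective hxy
    linarith
  rw [← himg, lintegral_image_eq_lintegral_abs_deriv_mul measurableSet_Ioo
    (fun x _ => (hasDerivAt_tanh_half x).hasDerivWithinAt) hinj]
  refine setLIntegral_congr_fun measurableSet_Ioo fun x hx => ?_
  have hc := Real.cosh_pos (x / 2)
  rw [mul_left_comm, abs_of_pos (by positivity), ← ENNReal.ofReal_mul (by positivity),
    lengthFormula_eq_crossDensity hx.1]
  congr 2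
  rw [Real.tanh_eq_sinh_div_cosh]
  field_simp
  ring

theorem lintegral_id_lengthLaw : ∫⁻ x, ENNReal.ofReal x ∂lengthLaw =
    ∫⁻ w in Set.Ioo 0 √(1 / 2), ENNReal.ofReal (2 * Real.artanh w * (12 * w * crossDensity (w ^ 2))) := by
  rw [lintegral_lengthLaw ENNReal.measurable_ofReal]
  have h := lintegral_lengthFormula_tanh fun w => ENNReal.ofReal (2 * Real.artanh w)
  simp only [Real.artanh_tanh, mul_div_cancel₀ _ (two_ne_zero' ℝ)] at h
  rw [h]
  refine setLIntegral_congr_fun measurableSet_Ioo fun w hw => ?_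
  exact (ENNReal.ofReal_mul (mul_nonneg zero_le_two (Real.artanh_nonneg hw.1.le))).symm

theorem pow_sqrt_half (n : ℕ) : √(1 / 2 : ℝ) ^ (2 * n + 1) = (1 / 2) ^ n * √(1 / 2) := by
  rw [pow_succ, pow_mul, Real.sq_sqrt (by norm_num)]

theorem log_sqrt_half : Real.log √(1 / 2) = -(Real.log 2 / 2) := by
  rw [Real.log_sqrt (by norm_num), one_div, Real.log_inv]
  ring

/-- At the endpoint `√(1/2)` odd powers are rational multiples of `√(1/2)` and the logarithm is
`-log 2 / 2`. For rational coefficients, evaluation therefore needs only `√(1/2)`, `log 2`, `π²` and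
two rational sums. -/
theorem setLIntegral_sum_even_pow_log {s : Finset ℕ} {α β : ℕ → ℝ} (hα : ∀ n, 0 ≤ α n)
    (hβ : ∀ n, 0 ≤ β n) :
    ∫⁻ w in Set.Ioo 0 √(1 / 2), ENNReal.ofReal (6 / Real.pi ^ 2 *
      ∑ n ∈ s, (α n * w ^ (2 * n) + β n * (w ^ (2 * n) * -Real.log w))) =
    ENNReal.ofReal (6 / Real.pi ^ 2 * (√(1 / 2) *
      (∑ n ∈ s, (1 / 2) ^ n * (α n / (2 * n + 1) + β n / (2 * n + 1) ^ 2) +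
        Real.log 2 * ∑ n ∈ s, (1 / 2) ^ n * (β n / (2 * (2 * n + 1)))))) := by
  have hW : √(1 / 2 : ℝ) ≤ 1 := Real.sqrt_le_one.2 (by norm_num)
  have h := setLIntegral_sum_pow_log (s := s) (e := fun n => 2 * n) hα hβ (Real.sqrt_nonneg (1 / 2)) hW
  have hp : 0 ≤ 6 / Real.pi ^ 2 := by positivity
  simp only [ENNReal.ofReal_mul hp]
  rw [lintegral_const_mul' _ _ ENNReal.ofReal_ne_top, h]
  congr 2
  rw [Finset.mul_sum, ← Finset.sum_add_distrib, Finset.mul_sum]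
  refine Finset.sum_congr rfl fun n _ => ?_
  rw [pow_sqrt_half, log_sqrt_half]
  push_cast
  field_simp
  ring

theorem inv_coeff_le_one (j : ℕ) : 1 / (j : ℝ) ≤ 1 := by
  rcases Nat.eq_zero_or_pos j with rfl | hj
  · simp
  · exact (div_le_one (by positivity)).2 (by exact_mod_cast hj)

theorem ite_coeff_nonneg (j : ℕ) : (0 : ℝ) ≤ if j = 0 then 0 else 1 := by split_ifs <;> norm_num

theorem ite_coeff_le_one (j : ℕ) : (if j = 0 then 0 else 1 : ℝ) ≤ 1 := by split_ifs <;> norm_num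

theorem lintegral_id_lengthLaw_lower (N : ℕ) :
    ENNReal.ofReal (6 / Real.pi ^ 2 * (√(1 / 2) *
      (∑ n ∈ Finset.range N, (1 / 2) ^ n * (4 * oddConv (fun j => 1 / (j : ℝ)) n / (2 * n + 1) +
        8 * oddConv (fun j => if j = 0 then 0 else 1) n / (2 * n + 1) ^ 2) +
      Real.log 2 * ∑ n ∈ Finset.range N, (1 / 2) ^ n *
        (8 * oddConv (fun j => if j = 0 then 0 else 1) n / (2 * (2 * n + 1)))))) ≤
    ∫⁻ x, ENNReal.ofReal x ∂lengthLaw := by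
  have hc : ∀ j : ℕ, 0 ≤ 1 / (j : ℝ) := fun j => by positivity
  rw [lintegral_id_lengthLaw, ← setLIntegral_sum_even_pow_log
    (fun n => mul_nonneg (by norm_num) (oddConv_nonneg hc n))
    (fun n => mul_nonneg (by norm_num) (oddConv_nonneg ite_coeff_nonneg n))]
  refine setLIntegral_mono' measurableSet_Ioo fun w hw => ENNReal.ofReal_le_ofReal ?_
  have hy : w ^ 2 < 1 / 2 := (Real.lt_sqrt hw.1.le).1 hw.2
  have hw1 : w < 1 := by nlinarith [hw.1]
  have hl : 0 ≤ -Real.log w := by linarith [Real.log_nonpos hw.1.le hw1.le]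
  rw [meanIntegrand_eq ⟨hw.1, hw1⟩]
  refine mul_le_mul_of_nonneg_left ?_ (by positivity)
  have h1 := sum_le_hasSum (Finset.range N)
    (fun n _ => mul_nonneg (oddConv_nonneg hc n) (by positivity))
    (hasSum_oddConv hc ⟨hw.1, hw1⟩ (hasSum_neg_log_one_sub (sq_nonneg w) (by linarith)))
  have h2 := sum_le_hasSum (Finset.range N)
    (fun n _ => mul_nonneg (oddConv_nonneg ite_coeff_nonneg n) (by positivity))
    (hasSum_oddConv ite_coeff_nonneg ⟨hw.1, hw1⟩ (hasSum_div_one_sub (sq_nonneg w) (by linarith)))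
  rw [Finset.sum_add_distrib]
  refine add_le_add ((le_of_eq ?_).trans (mul_le_mul_of_nonneg_left h1 zero_le_four)) ?_
  · rw [Finset.mul_sum]
    exact Finset.sum_congr rfl fun n _ => by rw [pow_mul, mul_assoc]
  · refine (le_of_eq ?_).trans (mul_le_mul_of_nonneg_right
      (mul_le_mul_of_nonneg_left h2 (by norm_num : (0 : ℝ) ≤ 8)) hl)
    rw [Finset.mul_sum, Finset.sum_mul]
    exact Finset.sum_congr rfl fun n _ => by rw [pow_mul]; ring

/-- Both series tails are absorbed into one additional term of index `N` with coefficient `2 * N +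
2`, as in `hasSum_le_sum_add`. -/
theorem lintegral_id_lengthLaw_upper (N : ℕ) :
    ∫⁻ x, ENNReal.ofReal x ∂lengthLaw ≤
    ENNReal.ofReal (6 / Real.pi ^ 2 * (√(1 / 2) *
      (∑ n ∈ Finset.range (N + 1), (1 / 2) ^ n *
        (4 * (if n < N then oddConv (fun j => 1 / (j : ℝ)) n else 2 * N + 2) / (2 * n + 1) +
        8 * (if n < N then oddConv (fun j => if j = 0 then 0 else 1) n else 2 * N + 2) /
          (2 * n + 1) ^ 2) +
      Real.log 2 * ∑ n ∈ Finset.range (N + 1), (1 / 2) ^ n *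
        (8 * (if n < N then oddConv (fun j => if j = 0 then 0 else 1) n else 2 * N + 2) /
          (2 * (2 * n + 1)))))) := by
  have hc : ∀ j : ℕ, 0 ≤ 1 / (j : ℝ) := fun j => by positivity
  have hite : ∀ (c : ℕ → ℝ), (∀ j, 0 ≤ c j) → ∀ n,
      0 ≤ if n < N then oddConv c n else 2 * (N : ℝ) + 2 := by
    intro c hc n
    split_ifs
    · exact oddConv_nonneg hc n
    · positivity
  have hsum : ∀ (c : ℕ → ℝ) (y : ℝ), ∑ n ∈ Finset.range (N + 1),
      (if n < N then oddConv c n else 2 * (N : ℝ) + 2) * y ^ n =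
      ∑ n ∈ Finset.range N, oddConv c n * y ^ n + (2 * N + 2) * y ^ N := by
    intro c y
    rw [Finset.sum_range_succ, if_neg (lt_irrefl N)]
    congr 1
    exact Finset.sum_congr rfl fun n hn => by rw [if_pos (Finset.mem_range.1 hn)]
  rw [lintegral_id_lengthLaw, ← setLIntegral_sum_even_pow_log
    (fun n => mul_nonneg (by norm_num) (hite _ hc n))
    (fun n => mul_nonneg (by norm_num) (hite _ ite_coeff_nonneg n))]
  refine setLIntegral_mono' measurableSet_Ioo fun w hw => ENNReal.ofReal_le_ofReal ?_
  have hy : w ^ 2 < 1 / 2 := (Real.lt_sqrt hw.1.le).1 hw.2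
  have hw1 : w < 1 := by nlinarith [hw.1]
  have hl : 0 ≤ -Real.log w := by linarith [Real.log_nonpos hw.1.le hw1.le]
  rw [meanIntegrand_eq ⟨hw.1, hw1⟩]
  refine mul_le_mul_of_nonneg_left ?_ (by positivity)
  have h1 := hasSum_le_sum_add (oddConv_le (by simp) hc inv_coeff_le_one) (sq_nonneg w) hy.le
    (hasSum_oddConv hc ⟨hw.1, hw1⟩ (hasSum_neg_log_one_sub (sq_nonneg w) (by linarith))) N
  have h2 := hasSum_le_sum_add (oddConv_le (by simp) ite_coeff_nonneg ite_coeff_le_one)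
    (sq_nonneg w) hy.le
    (hasSum_oddConv ite_coeff_nonneg ⟨hw.1, hw1⟩ (hasSum_div_one_sub (sq_nonneg w) (by linarith))) N
  rw [← hsum] at h1 h2
  rw [Finset.sum_add_distrib]
  refine add_le_add ((mul_le_mul_of_nonneg_left h1 zero_le_four).trans (le_of_eq ?_)) ?_
  · rw [Finset.mul_sum]
    exact Finset.sum_congr rfl fun n _ => by rw [pow_mul, mul_assoc]
  · refine (mul_le_mul_of_nonneg_right
      (mul_le_mul_of_nonneg_left h2 (by norm_num : (0 : ℝ) ≤ 8)) hl).trans (le_of_eq ?_)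
    rw [Finset.mul_sum, Finset.sum_mul]
    exact Finset.sum_congr rfl fun n _ => by rw [pow_mul]; ring

theorem integral_id_eq_toReal : ∫ x, x ∂lengthLaw = (∫⁻ x, ENNReal.ofReal x ∂lengthLaw).toReal :=
  integral_eq_lintegral_of_nonneg_ae (ae_lengthLaw_mem_Ioc.mono fun _ hx => hx.1.le)
    measurable_id.aestronglyMeasurable

theorem sqrt_half_bounds : 0.70710678118 < √(1 / 2 : ℝ) ∧ √(1 / 2 : ℝ) < 0.70710678119 :=
  ⟨Real.lt_sqrt_of_sq_lt (by norm_num), (Real.sqrt_lt' (by norm_num)).2 (by norm_num)⟩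

-- An exact rational evaluation. With 23 terms the remainder, of order `2⁻²³`, is below the
-- precision needed for six decimals of the mean.
set_option maxHeartbeats 1000000 in
theorem sum_oddConv_bounds : |∑ n ∈ Finset.range 23, (1 / 2 : ℝ) ^ n *
      (4 * oddConv (fun j => 1 / (j : ℝ)) n / (2 * n + 1) +
        8 * oddConv (fun j => if j = 0 then 0 else 1) n / (2 * n + 1) ^ 2) - 1.5087397421| ≤ 0.000000001 := by
  norm_num [Finset.sum_range_succ, oddConv, abs_le]

theorem sum_oddConv_ite_bounds : |∑ n ∈ Finset.range 23, (1 / 2 : ℝ) ^ n *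
        (8 * oddConv (fun j => if j = 0 then 0 else 1) n / (2 * (2 * n + 1))) - 1.1262918474| ≤
      0.000000001 := by
  norm_num [Finset.sum_range_succ, oddConv, abs_le]

theorem mean_lower : 0.984154 ≤ ∫ x, x ∂lengthLaw := by
  have hfin : ∫⁻ x, ENNReal.ofReal x ∂lengthLaw ≠ ⊤ := integrable_id_lengthLaw.lintegral_lt_top.ne
  have h := lintegral_id_lengthLaw_lower 23
  rw [ENNReal.ofReal_le_iff_le_toReal hfin, ← integral_id_eq_toReal] at h
  refine le_trans ?_ h
  have e1 := (abs_le.1 sum_oddConv_bounds).1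
  have e2 := (abs_le.1 sum_oddConv_ite_bounds).1
  have hpi : Real.pi ^ 2 < 9.8696044011 := by
    have := Real.pi_lt_d20
    have := Real.pi_pos
    nlinarith
  rw [div_mul_eq_mul_div, le_div_iff₀ (by positivity)]
  calc 0.984154 * Real.pi ^ 2 ≤ 0.984154 * 9.8696044011 := by gcongr
    _ ≤ 6 * (0.70710678118 * (1.508739741 + 0.6931471803 * 1.126291846)) := by norm_num
    _ ≤ _ := by
      gcongr
      · exact sqrt_half_bounds.1.le
      · linarith
      · exact Real.log_two_gt_d9.le
      · linarith

theorem mean_upper : ∫ x, x ∂lengthLaw < 0.984155 := by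
  have h := lintegral_id_lengthLaw_upper 23
  -- Separates the tail term of index 23, whose coefficient is `2 · 23 + 2 = 48`, from the sums
  -- already evaluated.
  have hsum : ∀ F : ℕ → ℝ → ℝ → ℝ, ∀ a b : ℕ → ℝ, ∑ n ∈ Finset.range (23 + 1),
      F n (if n < 23 then a n else 2 * (23 : ℕ) + 2) (if n < 23 then b n else 2 * (23 : ℕ) + 2) =
      ∑ n ∈ Finset.range 23, F n (a n) (b n) + F 23 48 48 := by
    intro F a b
    rw [Finset.sum_range_succ, if_neg (lt_irrefl 23), if_neg (lt_irrefl 23)]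
    refine congrArg₂ (· + ·) (Finset.sum_congr rfl fun n hn => ?_) (by norm_num)
    rw [if_pos (Finset.mem_range.1 hn), if_pos (Finset.mem_range.1 hn)]
  rw [hsum fun n a b => (1 / 2) ^ n * (4 * a / (2 * n + 1) + 8 * b / (2 * n + 1) ^ 2),
    hsum (fun n _ b => (1 / 2) ^ n * (8 * b / (2 * (2 * n + 1)))) 0] at h
  rw [integral_id_eq_toReal]
  refine ENNReal.toReal_lt_of_lt_ofReal (h.trans_lt
    ((ENNReal.ofReal_lt_ofReal_iff (by norm_num)).2 ?_))
  have e1 := (abs_le.1 sum_oddConv_bounds).2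
  have e2 := abs_le.1 sum_oddConv_ite_bounds
  have t1 : (1 / 2 : ℝ) ^ 23 * (4 * 48 / (2 * (23 : ℕ) + 1) + 8 * 48 / (2 * (23 : ℕ) + 1) ^ 2) ≤
    0.0000006 := by norm_num
  have t2 : (1 / 2 : ℝ) ^ 23 * (8 * 48 / (2 * (2 * (23 : ℕ) + 1))) ≤ 0.0000006 := by norm_num
  have t3 : 0 ≤ (1 / 2 : ℝ) ^ 23 * (8 * 48 / (2 * (2 * (23 : ℕ) + 1))) := by positivity
  have hpi : 9.86960440108 < Real.pi ^ 2 := by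
    have := Real.pi_gt_d20
    nlinarith
  have hlog := Real.log_two_lt_d9
  have hlog0 := Real.log_pos one_lt_two
  have hs := sqrt_half_bounds.2
  rw [div_mul_eq_mul_div, div_lt_iff₀ (by positivity)]
  calc _ ≤ 6 * (0.70710678119 * (1.508741 + 0.6931471808 * 1.126293)) := by
        refine mul_le_mul_of_nonneg_left ?_ (by norm_num)
        refine mul_le_mul hs.le (add_le_add (by linarith) ?_) ?_ (by norm_num)
        · exact mul_le_mul hlog.le (by linarith) (by linarith) (by norm_num)
        · refine add_nonneg ?_ (mul_nonneg hlog0.le (by linarith))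
          have := (abs_le.1 sum_oddConv_bounds).1
          have t0 : 0 ≤ (1 / 2 : ℝ) ^ 23 *
            (4 * 48 / (2 * (23 : ℕ) + 1) + 8 * 48 / (2 * (23 : ℕ) + 1) ^ 2) := by positivity
          linarith
    _ < (0.984155 : ℝ) * 9.86960440108 := by norm_num
    _ < 0.984155 * Real.pi ^ 2 := by gcongr

end RandomTorus

/-! ### The theorem. -/

theorem theorem5p7 {Ω : Type*} [MeasurableSpace Ω] (P : Measure Ω) [IsProbabilityMeasure P]
    (θ : Fin 4 → Ω → ℝ) (hmeas : ∀ j, Measurable (θ j)) (hindep : iIndepFun θ P)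
    (hunif : ∀ j, pdf.IsUniform (θ j) (Set.Icc 0 (2 * Real.pi)) P volume) :
    -- almost surely the rectangular punctured torus of the quadrilateral exists
    (∀ᵐ ω ∂P, ∃ Γ : Subgroup SL(2, ℝ),
      RandomTorus.IsRectangularTorusGroup (fun j => Circle.exp (θ j ω)) Γ) ∧
    ∀ Γ : Ω → Subgroup SL(2, ℝ),
      (∀ᵐ ω ∂P,
        RandomTorus.IsRectangularTorusGroup (fun j => Circle.exp (θ j ω)) (Γ ω)) →
      -- almost surely there is a shortest closed geodesic
      (∀ᵐ ω ∂P, IsLeast (RandomTorus.closedGeodesicLengths (Γ ω))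
        (RandomTorus.shortestLength (Γ ω))) ∧
      -- its length has the stated density
      AEMeasurable (fun ω => RandomTorus.shortestLength (Γ ω)) P ∧
      P.map (fun ω => RandomTorus.shortestLength (Γ ω)) =
        volume.withDensity (fun x => ENNReal.ofReal (RandomTorus.lengthDensity x)) ∧
      -- expected value
      Integrable (fun ω => RandomTorus.shortestLength (Γ ω)) P ∧
      ∫ ω, RandomTorus.shortestLength (Γ ω) ∂P =
        ∫ x in (0 : ℝ)..RandomTorus.maxLength, RandomTorus.lengthFormula x * x ∧
      ∫ ω, RandomTorus.shortestLength (Γ ω) ∂P ∈ Set.Ico (0.984154 : ℝ) 0.984155 ∧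
      -- the median is unique and has the stated value
      ∃ m ∈ Set.Ico (0.99929 : ℝ) 0.99930, ∀ x : ℝ,
        RandomTorus.IsMedian P (fun ω => RandomTorus.shortestLength (Γ ω)) x ↔ x = m := by
  have hX := RandomTorus.measurable_lengthOfModulus_quadModulus.comp (measurable_pi_lambda _ hmeas)
  refine ⟨?_, fun Γ hΓ => ?_⟩
  · filter_upwards [RandomTorus.ae_angles hmeas hindep hunif] with ω hω
    exact RandomTorus.exists_isRectangularTorusGroup hω.1 hω.2
  have hae := RandomTorus.ae_isLeast_shortestLength hmeas hindep hunif hΓ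
  have heq := hae.mono fun ω h => h.2
  -- The choice of `Γ` is arbitrary on a null set, so the length is only almost everywhere equal to
  -- the measurable function of the angles.
  have hm : AEMeasurable (fun ω => RandomTorus.shortestLength (Γ ω)) P := ⟨_, hX, heq⟩
  have hlaw : P.map (fun ω => RandomTorus.shortestLength (Γ ω)) = RandomTorus.lengthLaw := by
    rw [Measure.map_congr heq, ← RandomTorus.map_angleLaw, ← RandomTorus.map_angles hmeas hindep hunif,
      Measure.map_map RandomTorus.measurable_lengthOfModulus_quadModulus
        (measurable_pi_lambda _ hmeas)]
    rfl
  have hmean : ∫ ω, RandomTorus.shortestLength (Γ ω) ∂P = ∫ x, x ∂(RandomTorus.lengthLaw) := by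
    rw [← hlaw]
    exact (integral_map hm measurable_id.aestronglyMeasurable).symm
  refine ⟨hae.mono fun ω h => h.1, hm, hlaw, ?_, ?_, ?_, ?_⟩
  · have h := RandomTorus.integrable_id_lengthLaw
    rw [← hlaw] at h
    exact h.comp_aemeasurable hm
  · rw [hmean, RandomTorus.integral_id_lengthLaw]
  · rw [hmean]
    exact ⟨RandomTorus.mean_lower, RandomTorus.mean_upper⟩
  · obtain ⟨m, hm', h⟩ := RandomTorus.exists_median_lengthLaw
    exact ⟨m, hm', fun x => (RandomTorus.isMedian_iff hm hlaw x).trans (h x)⟩
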